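/- Let $S\subset\mathbb R^2$ be a finite set of points, no two of which have the same $x$-coordinate or the same $y$-coordinate, and let $k$ be a natural number. A $k$-clustering of $S$ is a partition of $S$ into exactly $k$ nonempty clusters; its cost is the sum of the perimeters of the convex hulls of its clusters (the perimeter of a segment is twice its length, that of a point is $0$). Let $\mathcal C$ be any $k$-clustering of minimum cost. The edges of $\mathcal C$ are the counterclockwise oriented edges of the convex hulls of its clusters; a hull that is a segment $pq$ has the two oriented edges $pq$ and $qp$, and a hull that is a point $p$ has the loop $pp$ as its only edge. For every $p=(x_p,y_p)\in S$ there are two vertical main lines $v_p^-$ and $v_p^+$ with $x$-coordinate $x_p$, lying formally just to the left and just to the right of $p$, and two horizontal main lines with $y$-coordinate $y_p$, lying formally just below and just above $p$. For two points of $S$ with consecutive $x$-coordinates $x<x'$ there are $19999$ vertical help lines, with $x$-coordinates $x+\frac{x'-x}{20000}j$ for $1\le j\le 19999$; horizontal help lines are defined in the same way from the $y$-coordinates. Parallel lines are ordered by coordinate and, for equal coordinates, formally. Thus positions of lines are elements of $\mathbb R\times\{-1,0,1\}$ with the lexicographic order (with second entry $-1$ or $+1$ for main lines and $0$ for help lines),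 and the formal plane consists of pairs of such positions. A formal point $((x,\sigma),(y,\tau))$ lies on an edge $e$ if $z=(x,y)\in e$ and there is a point $w\in e$ such that $\sigma\in\{0,\operatorname{sgn}(w_x-x)\}$ and $\tau\in\{0,\operatorname{sgn}(w_y-y)\}$; in particular, an edge whose left endpoint is $p$ meets $v_p^+$ at $p$ but does not meet $v_p^-$. An edge intersects a (closed) set of the formal plane if some formal point of the set lies on the edge. A box is a closed axis-parallel rectangle of the formal plane whose four edges are contained in main or help lines, with its left edge strictly before its right edge and its bottom edge strictly before its top edge in the above order. A box is elementary if no vertical main or help line lies strictly between its left and right edges and no horizontal main or help line lies strictly between its bottom and top edges. A box satisfies the box invariant if each of its four edges is intersected by at most two edges of $\mathcal C$. A vertical (horizontal) separator of $B$ is the intersection of $B$ with a vertical (horizontal) line lying strictly between its left and right (bottom and top) edges; it is good if it is intersected by at most two edges of $\mathcal C$. Then the following hold. 1. If $B$ is an elementary box, then at most two edges of $\mathcal C$ intersect $B$; in particular $B$ satisfies the box invariant. 2. If $B$ is a box that is not elementary and satisfies the box invariant, then $B$ has a good vertical or horizontal separator that is contained in a main or help line and divides $B$ into two strictly smaller boxes,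 both of which satisfy the box invariant. -/

import Mathlib

/-- The Euclidean plane; `p 0` is the `x`-coordinate and `p 1` the `y`-coordinate of `p`. -/
abbrev Plane : Type := EuclideanSpace ℝ (Fin 2)

noncomputable section

/-- The orientation determinant of `(p, q, r)`: it is nonnegative iff `r` lies on the left of, or
on, the line directed from `p` to `q`. -/
def orient (p q r : Plane) : ℝ :=
  (q 0 - p 0) * (r 1 - p 1) - (q 1 - p 1) * (r 0 - p 0)

open scoped Classical in
/-- The edges of the boundary of the convex hull of a finite set `A`, oriented counterclockwise.
An oriented edge from `p` to `q` is the pair `(p, q)`. If the hull is a nondegenerate segment, both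
orientations of that segment are edges; if `A = {p}`, the only edge is the loop `(p, p)`. -/
def hullEdges (A : Finset Plane) : Finset (Plane × Plane) :=
  (A ×ˢ A).filter fun e =>
    e.1 ∈ (convexHull ℝ (A : Set Plane)).extremePoints ℝ ∧
    e.2 ∈ (convexHull ℝ (A : Set Plane)).extremePoints ℝ ∧
    (e.1 ≠ e.2 ∨ A = {e.1}) ∧
    ∀ r ∈ A, 0 ≤ orient e.1 e.2 r

/-- The perimeter of the convex hull of `A` (twice the length for a segment, `0` for a point). -/
def hullPerimeter (A : Finset Plane) : ℝ :=
  ∑ e ∈ hullEdges A, dist e.1 e.2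

/-- A clustering of `S` is a partition of `S` into nonempty clusters. -/
abbrev Clustering (S : Finset Plane) : Type := Finpartition S

namespace Clustering

variable {S : Finset Plane}

/-- The cost of a clustering: the sum of the perimeters of the hulls of its clusters. -/
def cost (C : Clustering S) : ℝ :=
  ∑ A ∈ C.parts, hullPerimeter A

/-- `C` is an optimal clustering of `S` into exactly `k` clusters. -/
def IsOptimal (C : Clustering S) (k : ℕ) : Prop :=
  C.parts.card = k ∧ ∀ C' : Clustering S, C'.parts.card = k → C.cost ≤ C'.cost

/-- The (oriented) edges of the convex hulls of the clusters of `C`. -/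
def edges (C : Clustering S) : Set (Plane × Plane) :=
  {e | ∃ A ∈ C.parts, e ∈ hullEdges A}

end Clustering

/-- The formal position of an axis-parallel line. `(x, 0)` is the actual coordinate `x`, while
`(x, -1)` and `(x, 1)` have the same coordinate `x` but count as lying formally just before, and
formally just after, everything that has the actual coordinate `x`. Positions are ordered
lexicographically, so that `(x, -1) < (x, 0) < (x, 1)`. -/
abbrev Pos : Type := ℝ ×ₗ SignType

/-- The point of the formal plane at which the lines `x = P 0` and `y = P 1` meet. -/
abbrev FormalPoint : Type := Fin 2 → Pos

/-- The trace of the edge `e` in the formal plane. A formal point lies on `e` if its actual location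
`z` lies on `e` and if every formal displacement it has, to the left or right and downwards or
upwards, is one that is made by moving along `e` from `z` towards one and the same point `w` of `e`.
In particular an edge whose left endpoint is `p` meets the line at position `(p 0, 1)` in `p`,
but does not meet the line at position `(p 0, -1)`. -/
def edgeTrace (e : Plane × Plane) : Set FormalPoint :=
  {P | ∃ z ∈ segment ℝ e.1 e.2, ∃ w ∈ segment ℝ e.1 e.2, ∀ i : Fin 2,
    (ofLex (P i)).1 = z i ∧
      ((ofLex (P i)).2 = 0 ∨ (ofLex (P i)).2 = SignType.sign (w i - z i))}

/-- At most two edges of the clustering `C` intersect the set `X`. -/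
def AtMostTwoEdges {S : Finset Plane} (C : Clustering S) (X : Set FormalPoint) : Prop :=
  {e ∈ C.edges | (edgeTrace e ∩ X).Nonempty}.encard ≤ 2

/-- Main lines: for each input point one line formally before it and one formally after it.
`i = 0` gives the vertical main lines, `i = 1` the horizontal ones. -/
def mainLines (S : Finset Plane) (i : Fin 2) : Set Pos :=
  {c | ∃ p ∈ S, c = toLex (p i, -1) ∨ c = toLex (p i, 1)}

/-- Help lines: the `19999` lines dividing the gap between two input points that are consecutive in
the `i`-th coordinate into `20000` parts of equal length. -/
def helpLines (S : Finset Plane) (i : Fin 2) : Set Pos :=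
  {c | ∃ p ∈ S, ∃ q ∈ S, p i < q i ∧ (∀ r ∈ S, ¬ (p i < r i ∧ r i < q i)) ∧
    ∃ j : ℕ, 1 ≤ j ∧ j ≤ 19999 ∧ c = toLex (p i + (q i - p i) / 20000 * (j : ℝ), 0)}

/-- All main and help lines that are vertical (`i = 0`) or horizontal (`i = 1`). -/
def gridLines (S : Finset Plane) (i : Fin 2) : Set Pos :=
  mainLines S i ∪ helpLines S i

/-- A box: a rectangle whose edges are contained in main or help lines. Its left and right edges
have positions `lo 0 < hi 0`, its bottom and top edges have positions `lo 1 < hi 1`. -/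
structure Box (S : Finset Plane) where
  lo : FormalPoint
  hi : FormalPoint
  lo_mem : ∀ i, lo i ∈ gridLines S i
  hi_mem : ∀ i, hi i ∈ gridLines S i
  lo_lt_hi : ∀ i, lo i < hi i

namespace Box

variable {S : Finset Plane}

/-- The (closed) rectangle covered by the box. -/
def region (B : Box S) : Set FormalPoint := Set.Icc B.lo B.hi

/-- The part of the box on the line at position `c` that is vertical for `i = 0` and horizontal for
`i = 1`. -/
def slice (B : Box S) (i : Fin 2) (c : Pos) : Set FormalPoint := {P ∈ B.region | P i = c}

/-- No main or help line lies strictly between two opposite edges of the box. -/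
def IsElementary (B : Box S) : Prop :=
  ∀ i, ∀ c ∈ gridLines S i, ¬ (B.lo i < c ∧ c < B.hi i)

/-- The box invariant: each of the four edges of the box is intersected by at most two edges of
the clustering. -/
def Invariant (B : Box S) (C : Clustering S) : Prop :=
  ∀ i, AtMostTwoEdges C (B.slice i (B.lo i)) ∧ AtMostTwoEdges C (B.slice i (B.hi i))

/-- The line at position `c`, vertical for `i = 0` and horizontal for `i = 1`, runs strictly between
two opposite edges of the box, so that its slice is a vertical or horizontal separator. -/
def IsSeparator (B : Box S) (i : Fin 2) (c : Pos) : Prop := B.lo i < c ∧ c < B.hi i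

/-- The line at position `c`, vertical for `i = 0` and horizontal for `i = 1`, divides `B` into the
box `Bl` (left of or below the line) and the box `Br` (right of or above the line). -/
def Divides (B : Box S) (i : Fin 2) (c : Pos) (Bl Br : Box S) : Prop :=
  Bl.lo = B.lo ∧ Bl.hi = Function.update B.hi i c ∧
    Br.lo = Function.update B.lo i c ∧ Br.hi = B.hi

end Box

end

/-! By Cauchy's formula the perimeter of a convex hull is the integral over θ in [0, π] of the width
of the point set in direction θ (`hullPerimeter_eq_meanPerimeter`). Comparisons of perimeters thus
become inequalities between lengths of intervals on a line, integrated over θ. Optimality enters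
through `IsOptimal.sum_le`: clusters may be exchanged for at most as many others with the same
union, because splitting off a point never raises the cost. By `IsOptimal.lt_union`, merging two
clusters is always strictly worse.

Hence edges of different clusters cannot run side by side for long: joining their hulls at the ends
of such a pair would be cheaper (`meanPerimeter_union_le`). Hulls whose projections overlap in every
direction could be merged for free. Nor can a thin part of one cluster, free of input points, run
beside another cluster: one cuts that part out and gives one remaining piece to the neighbour
(`le_of_strip`). Finally, a convex polygon has at most one edge crossing a given line in each sense
(`hullEdge_unique`).

Elementary boxes: in each direction such a box has actual width zero or occupies at most 1/20000 of
a gap between consecutive coordinates, and an edge meeting it reaches across that gap. Two such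
edges of different clusters are either monotone in the same sense or in opposite senses; both are
impossible. Three in one cluster contradict convexity (`not_three_spans`).

Other boxes: suppose every grid separator is bad. Both directions then have grid separators, since
otherwise a slice would be thin as above. Let w be the side in one direction and h the other side.
If a gap longer than 200w meets the side w, three edges run together over a length of 99w, and
`gap_le` forces 8w ≤ h. Otherwise grid lines lie within w/100 of every position, and three edges
cross almost every line through the side. Such an edge may leave the box first, but only near one of
at most four exits through the two sides that cross the separators. So the edges inside the box have
total projection at least (3 - 8/100)w. On the other hand their total length is at most 2(w + h), or
else merging all their clusters would pay (`sum_dist_le`). These bounds are incompatible; the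
tightest case compares 2.92(w + h) with √2 · 2(w + h). -/

noncomputable section

open Finset

/-! ### Rotated coordinates, and length as a mean of projections -/

/-- The coordinate of a point in the direction of angle `θ`. -/
def proj (θ : ℝ) : Plane →ₗ[ℝ] ℝ where
  toFun x := x 0 * Real.cos θ + x 1 * Real.sin θ
  map_add' x y := by simp; ring
  map_smul' c x := by simp; ring

/-- The coordinate of a point orthogonal to the direction of angle `θ`. -/
def coproj (θ : ℝ) : Plane →ₗ[ℝ] ℝ := proj (θ + Real.pi / 2)

lemma proj_apply (θ : ℝ) (x : Plane) : proj θ x = x 0 * Real.cos θ + x 1 * Real.sin θ := rfl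

lemma coproj_apply (θ : ℝ) (x : Plane) :
    coproj θ x = -(x 0 * Real.sin θ) + x 1 * Real.cos θ := by
  simp [coproj, proj_apply, Real.cos_add_pi_div_two, Real.sin_add_pi_div_two]

lemma continuous_proj_angle (x : Plane) : Continuous fun θ => proj θ x := by
  simp only [proj_apply]; fun_prop

/-- The rotated frame is orthonormal and positively oriented. Arguments about lines orthogonal to
one direction therefore serve for every direction. -/
lemma orient_eq (θ : ℝ) (p q r : Plane) : orient p q r =
    (proj θ q - proj θ p) * (coproj θ r - coproj θ p) -
      (coproj θ q - coproj θ p) * (proj θ r - proj θ p) := by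
  simp only [orient, proj_apply, coproj_apply]
  linear_combination -((q 0 - p 0) * (r 1 - p 1) - (q 1 - p 1) * (r 0 - p 0)) *
    (Real.sin_sq_add_cos_sq θ)

lemma norm_sq_plane (v : Plane) : ‖v‖ ^ 2 = v 0 ^ 2 + v 1 ^ 2 := by
  rw [EuclideanSpace.norm_sq_eq]; simp [Fin.sum_univ_two]

lemma norm_sq_eq_proj (θ : ℝ) (v : Plane) : ‖v‖ ^ 2 = proj θ v ^ 2 + coproj θ v ^ 2 := by
  rw [norm_sq_plane]
  simp only [proj_apply, coproj_apply]
  linear_combination -(v 0 ^ 2 + v 1 ^ 2) * (Real.sin_sq_add_cos_sq θ)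

lemma abs_proj_le_norm (θ : ℝ) (v : Plane) : |proj θ v| ≤ ‖v‖ := by
  apply abs_le_of_sq_le_sq _ (norm_nonneg v)
  rw [norm_sq_eq_proj θ]; nlinarith [sq_nonneg (coproj θ v)]

lemma norm_le_abs_add_abs (v : Plane) : ‖v‖ ≤ |v 0| + |v 1| := by
  apply le_of_sq_le_sq _ (by positivity)
  rw [norm_sq_plane]
  nlinarith [sq_abs (v 0), sq_abs (v 1), mul_nonneg (abs_nonneg (v 0)) (abs_nonneg (v 1))]

lemma plane_ext_proj {θ : ℝ} {x y : Plane} (h : proj θ x = proj θ y)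
    (h' : coproj θ x = coproj θ y) : x = y := by
  rw [← sub_eq_zero, ← norm_eq_zero, ← sq_eq_zero_iff, norm_sq_eq_proj θ, map_sub, map_sub, h, h']
  simp

lemma integral_abs_cos : ∫ x in (0 : ℝ)..Real.pi, |Real.cos x| = 2 := by
  have hi : ∀ a b : ℝ, IntervalIntegrable (fun x => |Real.cos x|) MeasureTheory.volume a b :=
    fun a b => (Real.continuous_cos.abs).intervalIntegrable a b
  rw [← intervalIntegral.integral_add_adjacent_intervals (hi 0 (Real.pi / 2)) (hi _ Real.pi)]
  have h1 : ∫ x in (0 : ℝ)..(Real.pi / 2), |Real.cos x| = ∫ x in (0 : ℝ)..(Real.pi / 2), Real.cos x := by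
    apply intervalIntegral.integral_congr
    intro x hx
    rw [Set.uIcc_of_le (by positivity)] at hx
    exact abs_of_nonneg (Real.cos_nonneg_of_mem_Icc ⟨by linarith [hx.1, Real.pi_pos], hx.2⟩)
  have h2 : ∫ x in (Real.pi / 2)..Real.pi, |Real.cos x| = ∫ x in (Real.pi / 2)..Real.pi, -Real.cos x := by
    apply intervalIntegral.integral_congr
    intro x hx
    rw [Set.uIcc_of_le (by linarith [Real.pi_pos])] at hx
    exact abs_of_nonpos (Real.cos_nonpos_of_pi_div_two_le_of_le hx.1 (by linarith [hx.2, Real.pi_pos]))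
  rw [h1, h2]
  simp
  norm_num

/-- The length of a vector is half the integral of its projections. -/
lemma integral_abs_proj (v : Plane) : ∫ θ in (0 : ℝ)..Real.pi, |proj θ v| = 2 * ‖v‖ := by
  -- In polar form the projection is ‖v‖ cos (θ - arg z); since |cos| has period π, the shift by arg
  -- z does not affect the integral.
  set z : ℂ := ⟨v 0, v 1⟩ with hz
  have hn : ‖z‖ = ‖v‖ := by
    rw [← sq_eq_sq₀ (norm_nonneg _) (norm_nonneg _), norm_sq_plane, ← Complex.normSq_eq_norm_sq,
      Complex.normSq_apply]
    simp [hz]; ring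
  have h : ∀ θ, |proj θ v| = ‖v‖ * |Real.cos (θ - z.arg)| := by
    intro θ
    have e0 : v 0 = ‖z‖ * Real.cos z.arg := by rw [Complex.norm_mul_cos_arg]
    have e1 : v 1 = ‖z‖ * Real.sin z.arg := by rw [Complex.norm_mul_sin_arg]
    rw [proj_apply, Real.cos_sub, ← hn, ← abs_of_nonneg (norm_nonneg z), ← abs_mul]
    congr 1
    rw [e0, e1]; ring
  simp only [h]
  rw [intervalIntegral.integral_const_mul, intervalIntegral.integral_comp_sub_right
    (fun x => |Real.cos x|)]
  have hp : Function.Periodic (fun x => |Real.cos x|) Real.pi := by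
    intro x; simp [Real.cos_add_pi]
  have := hp.intervalIntegral_add_eq (0 - z.arg) 0
  rw [show Real.pi - z.arg = 0 - z.arg + Real.pi by ring, this, zero_add, integral_abs_cos]
  ring

lemma integral_abs_proj_sub (p q : Plane) :
    ∫ θ in (0 : ℝ)..Real.pi, |proj θ p - proj θ q| = 2 * dist p q := by
  simp only [← map_sub]
  rw [integral_abs_proj, dist_eq_norm]

/-! ### Widths and their integral -/

/-- The width of a finite set in the direction of angle `θ`. -/
def width (θ : ℝ) (A : Finset Plane) : ℝ :=
  if h : A.Nonempty then A.sup' h (proj θ) - A.inf' h (proj θ) else 0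

lemma width_spec (θ : ℝ) {A : Finset Plane} (hA : A.Nonempty) :
    ∃ m ∈ A, ∃ M ∈ A, (∀ x ∈ A, proj θ m ≤ proj θ x ∧ proj θ x ≤ proj θ M) ∧
      width θ A = proj θ M - proj θ m := by
  obtain ⟨M, hM, hM'⟩ := A.exists_mem_eq_sup' hA (proj θ)
  obtain ⟨m, hm, hm'⟩ := A.exists_mem_eq_inf' hA (proj θ)
  refine ⟨m, hm, M, hM, fun x hx => ⟨?_, ?_⟩, ?_⟩
  · rw [← hm']; exact Finset.inf'_le _ hx
  · rw [← hM']; exact Finset.le_sup' _ hx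
  · rw [width, dif_pos hA, hM', hm']

lemma continuous_width (A : Finset Plane) : Continuous fun θ => width θ A := by
  unfold width
  by_cases h : A.Nonempty
  · simp only [h, dif_pos]
    exact (Continuous.finset_sup'_apply h fun x _ => continuous_proj_angle x).sub
      (Continuous.finset_inf'_apply h fun x _ => continuous_proj_angle x)
  · simp only [h, dif_neg, not_false_eq_true]; exact continuous_const

lemma sub_le_width (θ : ℝ) {A : Finset Plane} {x y : Plane} (hx : x ∈ A) (hy : y ∈ A) :
    proj θ x - proj θ y ≤ width θ A := by
  obtain ⟨m, hm, M, hM, h, hw⟩ := width_spec θ ⟨x, hx⟩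
  rw [hw]; linarith [h x hx, h y hy]

lemma width_nonneg (θ : ℝ) (A : Finset Plane) : 0 ≤ width θ A := by
  rcases A.eq_empty_or_nonempty with rfl | ⟨x, hx⟩
  · simp [width]
  · simpa using sub_le_width θ hx hx

lemma proj_le_of_mem_convexHull {θ c : ℝ} {A : Set Plane} (h : ∀ x ∈ A, proj θ x ≤ c) {z : Plane}
    (hz : z ∈ convexHull ℝ A) : proj θ z ≤ c :=
  convexHull_min (t := {x | proj θ x ≤ c}) h (convex_halfSpace_le (proj θ).isLinear c) hz

lemma le_proj_of_mem_convexHull {θ c : ℝ} {A : Set Plane} (h : ∀ x ∈ A, c ≤ proj θ x) {z : Plane}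
    (hz : z ∈ convexHull ℝ A) : c ≤ proj θ z :=
  convexHull_min (t := {x | c ≤ proj θ x}) h (convex_halfSpace_ge (proj θ).isLinear c) hz

lemma width_le_of_subset_convexHull (θ : ℝ) {A B : Finset Plane}
    (h : ∀ x ∈ A, x ∈ convexHull ℝ (B : Set Plane)) : width θ A ≤ width θ B := by
  rcases A.eq_empty_or_nonempty with rfl | hA
  · simpa [width] using width_nonneg θ B
  obtain ⟨m, hm, M, hM, -, hw⟩ := width_spec θ hA
  have hB : B.Nonempty := by
    have := h m hm
    rw [← Finset.coe_nonempty, ← convexHull_nonempty_iff (𝕜 := ℝ)]; exact ⟨m, this⟩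
  obtain ⟨m', hm', M', hM', hb, hw'⟩ := width_spec θ hB
  rw [hw, hw']
  have h1 := proj_le_of_mem_convexHull (fun x hx => (hb x hx).2) (h M hM)
  have h2 := le_proj_of_mem_convexHull (fun x hx => (hb x hx).1) (h m hm)
  linarith

lemma width_mono (θ : ℝ) {A B : Finset Plane} (h : A ⊆ B) : width θ A ≤ width θ B :=
  width_le_of_subset_convexHull θ fun _ hx => subset_convexHull ℝ _ (h hx)

lemma width_singleton (θ : ℝ) (p : Plane) : width θ {p} = 0 := by
  simp [width]

/-- The integral of the widths, which is the perimeter of the convex hull. -/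
def meanPerimeter (A : Finset Plane) : ℝ := ∫ θ in (0 : ℝ)..Real.pi, width θ A

lemma intervalIntegrable_width (A : Finset Plane) :
    IntervalIntegrable (fun θ => width θ A) MeasureTheory.volume 0 Real.pi :=
  (continuous_width A).intervalIntegrable _ _

lemma continuous_abs_proj_sub (p q : Plane) : Continuous fun θ => |proj θ p - proj θ q| :=
  ((continuous_proj_angle p).sub (continuous_proj_angle q)).abs

lemma intervalIntegrable_abs_proj_sub (p q : Plane) :
    IntervalIntegrable (fun θ => |proj θ p - proj θ q|) MeasureTheory.volume 0 Real.pi :=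
  (continuous_abs_proj_sub p q).intervalIntegrable _ _

/-! ### Total length of families of intervals -/

lemma integral_sum_indicator_Ioo {ι : Type*} (F : Finset ι) (l r : ι → ℝ) (h : ∀ i ∈ F, l i ≤ r i) :
    ∫ x, ∑ i ∈ F, (Set.Ioo (l i) (r i)).indicator (fun _ => (1 : ℝ)) x = ∑ i ∈ F, (r i - l i) := by
  rw [MeasureTheory.integral_finsetSum]
  · refine Finset.sum_congr rfl fun i hi => ?_
    rw [MeasureTheory.integral_indicator measurableSet_Ioo]
    simp [h i hi]
  · intro i _
    exact (MeasureTheory.integrable_indicator_iff measurableSet_Ioo).2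
      (MeasureTheory.integrableOn_const (by simp))

lemma integrable_sum_indicator_Ioo {ι : Type*} (F : Finset ι) (l r : ι → ℝ) :
    MeasureTheory.Integrable
      fun x => ∑ i ∈ F, (Set.Ioo (l i) (r i)).indicator (fun _ => (1 : ℝ)) x :=
  MeasureTheory.integrable_finsetSum _ fun _ _ =>
    (MeasureTheory.integrable_indicator_iff measurableSet_Ioo).2
      (MeasureTheory.integrableOn_const (by simp))

lemma ae_notMem_of_finite {N : Set ℝ} (hN : N.Finite) : ∀ᵐ x : ℝ, x ∉ N :=
  hN.countable.ae_notMem _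

/-- If two families of intervals cover almost every point in a comparable way, then their total
lengths compare in the same way. -/
lemma sum_length_le_sum_length {ι κ : Type*} (F : Finset ι) (G : Finset κ) (l r : ι → ℝ)
    (l' r' : κ → ℝ) (h : ∀ i ∈ F, l i ≤ r i) (h' : ∀ i ∈ G, l' i ≤ r' i) {N : Set ℝ}
    (hN : N.Finite)
    (hle : ∀ x ∉ N, ∑ i ∈ F, (Set.Ioo (l i) (r i)).indicator (fun _ => (1 : ℝ)) x ≤
      ∑ i ∈ G, (Set.Ioo (l' i) (r' i)).indicator (fun _ => (1 : ℝ)) x) :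
    ∑ i ∈ F, (r i - l i) ≤ ∑ i ∈ G, (r' i - l' i) := by
  rw [← integral_sum_indicator_Ioo F l r h, ← integral_sum_indicator_Ioo G l' r' h']
  refine MeasureTheory.integral_mono_ae (integrable_sum_indicator_Ioo F l r)
    (integrable_sum_indicator_Ioo G l' r') ?_
  filter_upwards [ae_notMem_of_finite hN] with x hx using hle x hx

/-- Pairwise disjoint open intervals inside an interval have at most its total length. -/
lemma sum_length_le_of_disjoint {ι : Type*} (F : Finset ι) (l r : ι → ℝ) (h : ∀ i ∈ F, l i ≤ r i)
    {a b : ℝ} (hab : a ≤ b) (hin : ∀ i ∈ F, a ≤ l i ∧ r i ≤ b)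
    (hdisj : ∀ i ∈ F, ∀ j ∈ F, ∀ x, l i < x → x < r i → l j < x → x < r j → i = j) :
    ∑ i ∈ F, (r i - l i) ≤ b - a := by
  have := sum_length_le_sum_length F {()} l r (fun _ => a) (fun _ => b) h (by simpa using hab)
    (N := ∅) Set.finite_empty ?_
  · simpa using this
  intro x _
  rw [Finset.sum_singleton]
  by_cases hx : ∃ i ∈ F, x ∈ Set.Ioo (l i) (r i)
  · obtain ⟨i, hi, hxi⟩ := hx
    rw [Finset.sum_eq_single_of_mem i hi]
    · have hxab : x ∈ Set.Ioo a b :=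
        ⟨(hin i hi).1.trans_lt hxi.1, hxi.2.trans_le (hin i hi).2⟩
      simp [hxi, hxab]
    · intro j hj hji
      apply Set.indicator_of_notMem
      intro hxj
      exact hji (hdisj j hj i hi x hxj.1 hxj.2 hxi.1 hxi.2)
  · push Not at hx
    rw [Finset.sum_eq_zero]
    · exact Set.indicator_nonneg (fun _ _ => zero_le_one) x
    · intro i hi
      exact Set.indicator_of_notMem (hx i hi) _

/-- If almost every point of `(a, b)` lies in at least `n` intervals of a family, then the total
length of the family is at least `n * (b - a)`. -/
lemma mul_length_le_sum_length {ι : Type*} (F : Finset ι) (l r : ι → ℝ) (h : ∀ i ∈ F, l i ≤ r i)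
    {a b : ℝ} (hab : a ≤ b) (n : ℕ) {N : Set ℝ} (hN : N.Finite)
    (hcov : ∀ x ∉ N, a < x → x < b → ∃ G ⊆ F, n ≤ G.card ∧ ∀ i ∈ G, l i ≤ x ∧ x ≤ r i) :
    n * (b - a) ≤ ∑ i ∈ F, (r i - l i) := by
  -- The comparison is with `n` copies of (a, b). Endpoints join the exceptional set, so that closed
  -- membership in `hcov` becomes open membership.
  have := sum_length_le_sum_length (Finset.range n) F (fun _ => a) (fun _ => b) l r
    (fun _ _ => hab) h (N := N ∪ ((F.image l : Set ℝ) ∪ (F.image r : Set ℝ)))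
    (hN.union ((Finset.finite_toSet _).union (Finset.finite_toSet _))) ?_
  · simp only [Finset.sum_const, Finset.card_range, nsmul_eq_mul] at this
    exact this
  intro x hx
  simp only [Set.mem_union, not_or, Finset.coe_image, Set.mem_image, Finset.mem_coe, not_exists,
    not_and] at hx
  obtain ⟨hxN, hxl, hxr⟩ := hx
  have hnn : ∀ i ∈ F, 0 ≤ (Set.Ioo (l i) (r i)).indicator (fun _ => (1 : ℝ)) x := fun i _ =>
    Set.indicator_nonneg (fun _ _ => zero_le_one) x
  by_cases hxab : x ∈ Set.Ioo a b
  · obtain ⟨G, hGF, hn, hG⟩ := hcov x hxN hxab.1 hxab.2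
    calc _ = (n : ℝ) := by simp [hxab]
      _ ≤ G.card := by exact_mod_cast hn
      _ = ∑ i ∈ G, (Set.Ioo (l i) (r i)).indicator (fun _ => (1 : ℝ)) x := by
        rw [Finset.card_eq_sum_ones]; push_cast
        refine Finset.sum_congr rfl fun i hi => ?_
        rw [Set.indicator_of_mem]
        exact ⟨lt_of_le_of_ne (hG i hi).1 (hxl i (hGF hi)),
          lt_of_le_of_ne (hG i hi).2 (Ne.symm (hxr i (hGF hi)))⟩
      _ ≤ _ := Finset.sum_le_sum_of_subset_of_nonneg hGF fun i hi _ => hnn i hi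
  · simp only [Set.indicator_of_notMem hxab, Finset.sum_const_zero]
    exact Finset.sum_nonneg hnn

/-! ### Hull edges crossing a line, and Cauchy's formula -/

lemma orient_nonneg_of_mem_convexHull {p q : Plane} {A : Set Plane} (h : ∀ r ∈ A, 0 ≤ orient p q r)
    {z : Plane} (hz : z ∈ convexHull ℝ A) : 0 ≤ orient p q z := by
  refine convexHull_min (t := {x | 0 ≤ orient p q x}) h ?_ hz
  intro x hx y hy a b ha hb hab
  simp only [Set.mem_ofPred_eq, orient] at *
  have : b = 1 - a := by linarith
  subst this
  simp only [PiLp.add_apply, PiLp.smul_apply, smul_eq_mul]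
  nlinarith [mul_nonneg ha hx, mul_nonneg hb hy]

lemma mem_hullEdges {A : Finset Plane} {e : Plane × Plane} : e ∈ hullEdges A ↔
    (e.1 ∈ A ∧ e.2 ∈ A) ∧ e.1 ∈ (convexHull ℝ (A : Set Plane)).extremePoints ℝ ∧
    e.2 ∈ (convexHull ℝ (A : Set Plane)).extremePoints ℝ ∧
    (e.1 ≠ e.2 ∨ A = {e.1}) ∧ ∀ r ∈ A, 0 ≤ orient e.1 e.2 r := by
  simp [hullEdges, Finset.mem_filter, Finset.mem_product]

lemma orient_nonneg_of_mem_hullEdges {A : Finset Plane} {e : Plane × Plane} (he : e ∈ hullEdges A)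
    {z : Plane} (hz : z ∈ convexHull ℝ (A : Set Plane)) : 0 ≤ orient e.1 e.2 z :=
  orient_nonneg_of_mem_convexHull (fun r hr => (mem_hullEdges.1 he).2.2.2.2 r hr) hz

lemma mem_openSegment_of_orient_eq_zero (θ : ℝ) {p q r : Plane} (h : orient p q r = 0)
    (h1 : proj θ p < proj θ r) (h2 : proj θ r < proj θ q) : r ∈ openSegment ℝ p q := by
  have hD : 0 < proj θ q - proj θ p := by linarith
  rw [orient_eq θ] at h
  refine ⟨(proj θ q - proj θ r) / (proj θ q - proj θ p), (proj θ r - proj θ p) / (proj θ q - proj θ p),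
    div_pos (by linarith) hD, div_pos (by linarith) hD, by field_simp; ring, ?_⟩
  apply plane_ext_proj (θ := θ)
  · simp only [map_add, map_smul, smul_eq_mul]; field_simp; ring
  · simp only [map_add, map_smul, smul_eq_mul]; field_simp; linarith

lemma notMem_openSegment_of_mem_extremePoints {K : Set Plane} {p q r : Plane}
    (hr : r ∈ K.extremePoints ℝ) (hp : p ∈ K) (hq : q ∈ K) (hpr : p ≠ r) :
    r ∉ openSegment ℝ p q := fun h =>
  hpr (mem_extremePoints.1 hr |>.2 p hp q hq h).1

/-- At most one hull edge crosses a given line in a given sense. -/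
lemma hullEdge_unique (θ : ℝ) {A : Finset Plane} {e f : Plane × Plane} (he : e ∈ hullEdges A)
    (hf : f ∈ hullEdges A) {t : ℝ} (he1 : proj θ e.1 < t) (he2 : t < proj θ e.2)
    (hf1 : proj θ f.1 < t) (hf2 : t < proj θ f.2) : e = f := by
  obtain ⟨p, q⟩ := e
  obtain ⟨p', q'⟩ := f
  obtain ⟨⟨hpA, hqA⟩, hp, hq, -, ho⟩ := mem_hullEdges.1 he
  obtain ⟨⟨hpA', hqA'⟩, hp', hq', -, ho'⟩ := mem_hullEdges.1 hf
  simp only at *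
  have sub : ∀ x ∈ A, x ∈ convexHull ℝ (A : Set Plane) := fun x hx => subset_convexHull ℝ _ hx
  have a1 := ho p' hpA'
  have a2 := ho q' hqA'
  have b1 := ho' p hpA
  have b2 := ho' q hqA
  -- Each line of the sum is, up to one common positive factor, the height difference of the two
  -- crossing points with the line at `t`, with opposite signs. All four terms are nonnegative, so
  -- all vanish and the four points are collinear.
  have key : (proj θ q' - t) * orient p q p' + (t - proj θ p') * orient p q q' +
      ((proj θ q - t) * orient p' q' p + (t - proj θ p) * orient p' q' q) = 0 := by
    simp only [orient_eq θ]; ring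
  have c1 : 0 < proj θ q' - t := by linarith
  have c2 : 0 < t - proj θ p' := by linarith
  have c3 : 0 < proj θ q - t := by linarith
  have c4 : 0 < t - proj θ p := by linarith
  have m1 := mul_nonneg c1.le a1
  have m2 := mul_nonneg c2.le a2
  have m3 := mul_nonneg c3.le b1
  have m4 := mul_nonneg c4.le b2
  have z1 : orient p q p' = 0 := by
    have : (proj θ q' - t) * orient p q p' = 0 := by linarith
    exact (mul_eq_zero.1 this).resolve_left c1.ne'
  have z2 : orient p q q' = 0 := by
    have : (t - proj θ p') * orient p q q' = 0 := by linarith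
    exact (mul_eq_zero.1 this).resolve_left c2.ne'
  have z3 : orient p' q' p = 0 := by
    have : (proj θ q - t) * orient p' q' p = 0 := by linarith
    exact (mul_eq_zero.1 this).resolve_left c3.ne'
  have z4 : orient p' q' q = 0 := by
    have : (t - proj θ p) * orient p' q' q = 0 := by linarith
    exact (mul_eq_zero.1 this).resolve_left c4.ne'
  have hD : 0 < proj θ q - proj θ p := by linarith
  have hpp : p = p' := by
    rcases lt_trichotomy (proj θ p) (proj θ p') with h | h | h
    · exact absurd (mem_openSegment_of_orient_eq_zero θ z1 h (by linarith))
        (notMem_openSegment_of_mem_extremePoints hp' (sub p hpA) (sub q hqA) (by rintro rfl; linarith))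
    · rw [orient_eq θ, ← h] at z1
      have : coproj θ p' - coproj θ p = 0 := by
        have : (proj θ q - proj θ p) * (coproj θ p' - coproj θ p) = 0 := by linarith
        exact (mul_eq_zero.1 this).resolve_left hD.ne'
      exact plane_ext_proj h (by linarith)
    · exact absurd (mem_openSegment_of_orient_eq_zero θ z3 h (by linarith))
        (notMem_openSegment_of_mem_extremePoints hp (sub p' hpA') (sub q' hqA') (by rintro rfl; linarith))
  have hqq : q = q' := by
    rcases lt_trichotomy (proj θ q) (proj θ q') with h | h | h
    · exact absurd (mem_openSegment_of_orient_eq_zero θ z4 (by linarith) h)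
        (notMem_openSegment_of_mem_extremePoints hq (sub p' hpA') (sub q' hqA') (by rintro rfl; linarith))
    · rw [orient_eq θ, ← h] at z2
      have : coproj θ q' - coproj θ q = 0 := by
        have : (proj θ q - proj θ p) * (coproj θ q' - coproj θ q) = 0 := by linarith
        exact (mul_eq_zero.1 this).resolve_left hD.ne'
      exact plane_ext_proj h (by linarith)
    · exact absurd (mem_openSegment_of_orient_eq_zero θ z2 (by linarith) h)
        (notMem_openSegment_of_mem_extremePoints hq' (sub p hpA) (sub q hqA) (by rintro rfl; linarith))
  rw [hpp, hqq]

/-- A point of `A` that is lexicographically minimal for two independent linear functionals is an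
extreme point of the convex hull. -/
lemma mem_extremePoints_of_lex (l m : Plane →ₗ[ℝ] ℝ) {A : Set Plane} {p : Plane} (hp : p ∈ A)
    (hinj : ∀ x : Plane, l x = l p → m x = m p → x = p)
    (h : ∀ r ∈ A, l p < l r ∨ l r = l p ∧ m p ≤ m r) :
    p ∈ (convexHull ℝ A).extremePoints ℝ := by
  have hc : convexHull ℝ A ⊆ {x | l p < l x ∨ l x = l p ∧ m p ≤ m x} := by
    refine convexHull_min h ?_
    intro x hx y hy a b ha hb hab
    simp only [Set.mem_ofPred_eq, map_add, map_smul, smul_eq_mul] at *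
    obtain rfl : b = 1 - a := by linarith
    rcases ha.eq_or_lt with rfl | ha
    · simpa using hy
    rcases hb.eq_or_lt with hb0 | hb
    · obtain rfl : a = 1 := by linarith
      simpa using hx
    rcases hx with hx | ⟨hx, hx'⟩ <;> rcases hy with hy | ⟨hy, hy'⟩
    · left; nlinarith
    · left; nlinarith
    · left; nlinarith
    · right; constructor
      · rw [hx, hy]; ring
      · nlinarith
  refine mem_extremePoints_iff_left.2 ⟨subset_convexHull ℝ _ hp, ?_⟩
  rintro x hx y hy ⟨a, b, ha, hb, hab, rfl⟩
  have hx' := hc hx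
  have hy' := hc hy
  simp only [Set.mem_ofPred_eq, map_add, map_smul, smul_eq_mul] at hx' hy' hinj
  obtain rfl : b = 1 - a := by linarith
  rcases hx' with hx' | ⟨hx1, hx2⟩ <;> rcases hy' with hy' | ⟨hy1, hy2⟩
  · nlinarith
  · nlinarith
  · nlinarith
  · exact hinj x hx1 (by nlinarith)

/-- Every line that meets no point of `A` and separates two points of `A` is crossed by a hull edge
in the positive sense. -/
lemma exists_hullEdge (θ : ℝ) {A : Finset Plane} {t : ℝ} (ht : ∀ x ∈ A, proj θ x ≠ t)
    {x y : Plane} (hx : x ∈ A) (hy : y ∈ A) (hxt : proj θ x < t) (hty : t < proj θ y) :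
    ∃ e ∈ hullEdges A, proj θ e.1 < t ∧ t < proj θ e.2 := by
  classical
  -- The height at which the segment `e` crosses the line at `t`. A hull edge is a segment with
  -- lowest crossing.
  set f : Plane × Plane → ℝ := fun e =>
    (coproj θ e.1 * (proj θ e.2 - t) + coproj θ e.2 * (t - proj θ e.1)) / (proj θ e.2 - proj θ e.1)
    with hf
  obtain ⟨e₀, he₀, hmin₀⟩ := ((A ×ˢ A).filter fun e => proj θ e.1 < t ∧ t < proj θ e.2).exists_min_image
    f ⟨(x, y), by simp [*]⟩
  -- Among ties the longest projection is taken, so that collinear points of `A` lie between `p` and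
  -- `q`, which makes both ends extreme.
  obtain ⟨⟨p, q⟩, he, hmax⟩ :=
    ((A ×ˢ A).filter fun e => (proj θ e.1 < t ∧ t < proj θ e.2) ∧ f e = f e₀).exists_max_image
    (fun e => proj θ e.2 - proj θ e.1) ⟨e₀, by
      simp only [Finset.mem_filter] at he₀ ⊢; exact ⟨he₀.1, he₀.2, trivial⟩⟩
  simp only [Finset.mem_filter, Finset.mem_product, and_imp, Prod.forall] at he hmax hmin₀
  obtain ⟨⟨hpA, hqA⟩, ⟨hpt, htq⟩, hfe⟩ := he
  have hmin : ∀ a b : Plane, a ∈ A → b ∈ A → proj θ a < t → t < proj θ b → f (p, q) ≤ f (a, b) := by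
    intro a b ha hb ha' hb'
    rw [hfe]; exact hmin₀ a b ha hb ha' hb'
  have hD : 0 < proj θ q - proj θ p := by linarith
  have left : ∀ r ∈ A, proj θ r < t → f (r, q) - f (p, q) =
      orient p q r * ((proj θ q - t) / ((proj θ q - proj θ p) * (proj θ q - proj θ r))) := by
    intro r _ hrt
    have : 0 < proj θ q - proj θ r := by linarith
    simp only [hf, orient_eq θ]
    field_simp
    ring
  have right : ∀ r ∈ A, t < proj θ r → f (p, r) - f (p, q) =
      orient p q r * ((t - proj θ p) / ((proj θ q - proj θ p) * (proj θ r - proj θ p))) := by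
    intro r _ hrt
    have : 0 < proj θ r - proj θ p := by linarith
    simp only [hf, orient_eq θ]
    field_simp
    ring
  have hl : ∀ r ∈ A, proj θ r < t →
      0 < (proj θ q - t) / ((proj θ q - proj θ p) * (proj θ q - proj θ r)) := fun r _ h =>
    div_pos (by linarith) (mul_pos hD (by linarith))
  have hr : ∀ r ∈ A, t < proj θ r →
      0 < (t - proj θ p) / ((proj θ q - proj θ p) * (proj θ r - proj θ p)) := fun r _ h =>
    div_pos (by linarith) (mul_pos hD (by linarith))
  have hor : ∀ r ∈ A, 0 < orient p q r ∨
      orient p q r = 0 ∧ proj θ p ≤ proj θ r ∧ proj θ r ≤ proj θ q := by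
    intro r hrA
    rcases lt_or_gt_of_ne (ht r hrA) with h | h
    · have h0 := hl r hrA h
      have h1 := left r hrA h
      have h2 := hmin r q hrA hqA h htq
      rcases lt_trichotomy (orient p q r) 0 with h3 | h3 | h3
      · nlinarith [mul_neg_of_neg_of_pos h3 h0]
      · rw [h3, zero_mul] at h1
        have := hmax r q hrA hqA h htq (by linarith)
        exact Or.inr ⟨h3, by linarith, by linarith⟩
      · exact Or.inl h3
    · have h0 := hr r hrA h
      have h1 := right r hrA h
      have h2 := hmin p r hpA hrA hpt h
      rcases lt_trichotomy (orient p q r) 0 with h3 | h3 | h3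
      · nlinarith [mul_neg_of_neg_of_pos h3 h0]
      · rw [h3, zero_mul] at h1
        have := hmax p r hpA hrA hpt h (by linarith)
        exact Or.inr ⟨h3, by linarith, by linarith⟩
      · exact Or.inl h3
  set l : Plane →ₗ[ℝ] ℝ := (proj θ q - proj θ p) • coproj θ - (coproj θ q - coproj θ p) • proj θ
    with hl'
  have hlo : ∀ r, orient p q r = l r - l p := by
    intro r
    simp only [orient_eq θ, hl', LinearMap.sub_apply, LinearMap.smul_apply, smul_eq_mul]; ring
  have hlpq : l q = l p := by
    simp only [hl', LinearMap.sub_apply, LinearMap.smul_apply, smul_eq_mul]; ring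
  have hinj : ∀ a b : Plane, l a = l b → proj θ a = proj θ b → a = b := by
    intro a b h1 h2
    simp only [hl', LinearMap.sub_apply, LinearMap.smul_apply, smul_eq_mul, h2] at h1
    exact plane_ext_proj h2 (mul_left_cancel₀ hD.ne' (by linarith))
  refine ⟨(p, q), mem_hullEdges.2 ⟨⟨hpA, hqA⟩, ?_, ?_, Or.inl ?_, ?_⟩, hpt, htq⟩
  · refine mem_extremePoints_of_lex l (proj θ) hpA (fun a h1 h2 => hinj a p h1 h2) fun r hrA => ?_
    rcases hor r hrA with h | ⟨h, h', -⟩ <;> rw [hlo] at h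
    · left; linarith
    · right; exact ⟨by linarith, h'⟩
  · refine mem_extremePoints_of_lex l (-proj θ) hqA
      (fun a h1 h2 => hinj a q h1 (by simpa using h2)) fun r hrA => ?_
    rcases hor r hrA with h | ⟨h, -, h'⟩ <;> rw [hlo] at h
    · left; linarith
    · right; exact ⟨by linarith, by simpa using h'⟩
  · rintro h
    simp only at h
    rw [h] at hD; simp at hD
  · intro r hrA
    rcases hor r hrA with h | ⟨h, -⟩
    · exact h.le
    · exact h.ge

lemma proj_add_pi (θ : ℝ) (x : Plane) : proj (θ + Real.pi) x = -proj θ x := by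
  simp [proj_apply, Real.cos_add_pi, Real.sin_add_pi]; ring

/-- The hull edges that are ascending in the direction `θ` cover the projection of `A` once. -/
lemma sum_ascending_eq_width (θ : ℝ) {A : Finset Plane} (hA : A.Nonempty) :
    ∑ e ∈ (hullEdges A).filter (fun e => proj θ e.1 < proj θ e.2), (proj θ e.2 - proj θ e.1) =
      width θ A := by
  obtain ⟨m, hm, M, hM, hb, hw⟩ := width_spec θ hA
  rw [hw]
  -- The projected intervals are disjoint by `hullEdge_unique` and, away from projections of points
  -- of `A`, cover by `exists_hullEdge`.
  apply le_antisymm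
  · apply sum_length_le_of_disjoint
    · intro e he; exact (Finset.mem_filter.1 he).2.le
    · exact (hb m hm).2
    · intro e he
      have := (mem_hullEdges.1 (Finset.mem_filter.1 he).1).1
      exact ⟨(hb _ this.1).1, (hb _ this.2).2⟩
    · intro e he f hf t h1 h2 h3 h4
      exact hullEdge_unique θ (Finset.mem_filter.1 he).1 (Finset.mem_filter.1 hf).1 h1 h2 h3 h4
  · have := mul_length_le_sum_length ((hullEdges A).filter (fun e => proj θ e.1 < proj θ e.2))
      (fun e => proj θ e.1) (fun e => proj θ e.2) (fun e he => (Finset.mem_filter.1 he).2.le)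
      (hb m hm).2 1 (N := A.image (proj θ)) (Finset.finite_toSet _) ?_
    · simpa using this
    intro t ht h1 h2
    obtain ⟨e, he, he1, he2⟩ := exists_hullEdge θ (t := t) (A := A)
      (fun x hx h => ht (by simpa using ⟨x, hx, h⟩)) hm hM h1 h2
    exact ⟨{e}, by simpa using ⟨he, he1.trans he2⟩, by simp, by simpa using ⟨he1.le, he2.le⟩⟩

lemma width_add_pi (θ : ℝ) {A : Finset Plane} (hA : A.Nonempty) :
    width (θ + Real.pi) A = width θ A := by
  obtain ⟨m, hm, M, hM, hb, hw⟩ := width_spec θ hA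
  obtain ⟨m', hm', M', hM', hb', hw'⟩ := width_spec (θ + Real.pi) hA
  rw [hw, hw']
  simp only [proj_add_pi] at hb' ⊢
  linarith [(hb m' hm').2, (hb M' hM').1, (hb' m hm).2, (hb' M hM).1]

lemma sum_abs_proj_hullEdges (θ : ℝ) {A : Finset Plane} (hA : A.Nonempty) :
    ∑ e ∈ hullEdges A, |proj θ e.1 - proj θ e.2| = 2 * width θ A := by
  have h1 := sum_ascending_eq_width θ hA
  -- Descending edges are those ascending in the opposite direction.
  have h2 := sum_ascending_eq_width (θ + Real.pi) hA
  rw [width_add_pi θ hA] at h2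
  rw [two_mul]
  nth_rw 1 [← h1]
  rw [← h2, Finset.sum_filter, Finset.sum_filter, ← Finset.sum_add_distrib]
  refine Finset.sum_congr rfl fun e _ => ?_
  simp only [proj_add_pi, neg_lt_neg_iff]
  rcases lt_trichotomy (proj θ e.1) (proj θ e.2) with h | h | h
  · rw [if_pos h, if_neg h.le.not_gt, abs_of_neg (by linarith)]; ring
  · simp [h]
  · rw [if_neg h.le.not_gt, if_pos h, abs_of_pos (by linarith)]; ring

/-- Cauchy's formula for the perimeter of a convex polygon. -/
lemma hullPerimeter_eq_meanPerimeter {A : Finset Plane} (hA : A.Nonempty) :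
    hullPerimeter A = meanPerimeter A := by
  have h : ∫ θ in (0 : ℝ)..Real.pi, ∑ e ∈ hullEdges A, |proj θ e.1 - proj θ e.2| =
      ∑ e ∈ hullEdges A, 2 * dist e.1 e.2 := by
    rw [intervalIntegral.integral_finsetSum fun e _ => intervalIntegrable_abs_proj_sub e.1 e.2]
    exact Finset.sum_congr rfl fun e _ => integral_abs_proj_sub e.1 e.2
  simp only [sum_abs_proj_hullEdges _ hA, intervalIntegral.integral_const_mul,
    ← Finset.mul_sum] at h
  rw [hullPerimeter, meanPerimeter]
  linarith

lemma meanPerimeter_mono {A B : Finset Plane} (h : ∀ x ∈ A, x ∈ convexHull ℝ (B : Set Plane)) :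
    meanPerimeter A ≤ meanPerimeter B :=
  intervalIntegral.integral_mono_on Real.pi_pos.le (intervalIntegrable_width A)
    (intervalIntegrable_width B) fun θ _ => width_le_of_subset_convexHull θ h

lemma meanPerimeter_nonneg (A : Finset Plane) : 0 ≤ meanPerimeter A :=
  intervalIntegral.integral_nonneg Real.pi_pos.le fun θ _ => width_nonneg θ A

lemma meanPerimeter_singleton (p : Plane) : meanPerimeter {p} = 0 := by
  simp [meanPerimeter, width_singleton]

/-! ### Joining two polygons -/

/-- If both extremes of the union lie in `A`, it suffices that the width of `B` is at least |c - d|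
and that |a - b| ≤ |a - c| + |c - d| + |d - b| for the projections. If the minimum is in `A` and the
maximum in `B`, one bounds max(a, b) minus the minimum by the width of `A`, the maximum minus min(c,
d) by the width of `B`, and writes max and min as half sum plus or minus half difference. -/
lemma width_union_le (θ : ℝ) {A B : Finset Plane} {a b c d : Plane}
    (ha : a ∈ A) (hb : b ∈ A) (hc : c ∈ B) (hd : d ∈ B) :
    width θ (A ∪ B) ≤ width θ A + width θ B
      - 2⁻¹ * (|proj θ a - proj θ b| + |proj θ c - proj θ d|)
      + 2⁻¹ * (|proj θ a - proj θ c| + |proj θ b - proj θ d|) := by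
  obtain ⟨m, hm, M, hM, hbd, hw⟩ := width_spec θ (A := A ∪ B) ⟨a, Finset.mem_union_left _ ha⟩
  rw [hw]
  have e1 := abs_le.1 (le_refl |proj θ a - proj θ c|)
  have e2 := abs_le.1 (le_refl |proj θ b - proj θ d|)
  have a1 := sub_le_width θ ha hb
  have a2 := sub_le_width θ hb ha
  have a3 := sub_le_width θ hc hd
  have a4 := sub_le_width θ hd hc
  rw [Finset.mem_union] at hm hM
  rcases hm with hm | hm <;> rcases hM with hM | hM
  · have := sub_le_width θ hM hm
    rcases abs_cases (proj θ a - proj θ b) with h | h <;>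
      rcases abs_cases (proj θ c - proj θ d) with h' | h' <;> linarith
  · have b1 := sub_le_width θ ha hm
    have b2 := sub_le_width θ hb hm
    have b3 := sub_le_width θ hM hc
    have b4 := sub_le_width θ hM hd
    rcases abs_cases (proj θ a - proj θ b) with h | h <;>
      rcases abs_cases (proj θ c - proj θ d) with h' | h' <;> linarith
  · have b1 := sub_le_width θ hM ha
    have b2 := sub_le_width θ hM hb
    have b3 := sub_le_width θ hc hm
    have b4 := sub_le_width θ hd hm
    rcases abs_cases (proj θ a - proj θ b) with h | h <;>
      rcases abs_cases (proj θ c - proj θ d) with h' | h' <;> linarith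
  · have := sub_le_width θ hM hm
    rcases abs_cases (proj θ a - proj θ b) with h | h <;>
      rcases abs_cases (proj θ c - proj θ d) with h' | h' <;> linarith

/-- Joining two polygons along a quadrilateral `a b d c` with `a b` in the one and `c d` in the
other. -/
lemma meanPerimeter_union_le {A B : Finset Plane} {a b c d : Plane}
    (ha : a ∈ A) (hb : b ∈ A) (hc : c ∈ B) (hd : d ∈ B) :
    meanPerimeter (A ∪ B) ≤ meanPerimeter A + meanPerimeter B
      - (dist a b + dist c d) + (dist a c + dist b d) := by
  have hI := intervalIntegrable_abs_proj_sub
  have key : ∫ θ in (0 : ℝ)..Real.pi, (width θ A + width θ B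
      - 2⁻¹ * (|proj θ a - proj θ b| + |proj θ c - proj θ d|)
      + 2⁻¹ * (|proj θ a - proj θ c| + |proj θ b - proj θ d|)) =
      meanPerimeter A + meanPerimeter B - (dist a b + dist c d) + (dist a c + dist b d) := by
    have hA := intervalIntegrable_width A
    have hB := intervalIntegrable_width B
    rw [intervalIntegral.integral_add ((hA.add hB).sub (((hI a b).add (hI c d)).const_mul _))
      (((hI a c).add (hI b d)).const_mul _),
      intervalIntegral.integral_sub (hA.add hB) (((hI a b).add (hI c d)).const_mul _),
      intervalIntegral.integral_add hA hB, intervalIntegral.integral_const_mul,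
      intervalIntegral.integral_const_mul, intervalIntegral.integral_add (hI a b) (hI c d),
      intervalIntegral.integral_add (hI a c) (hI b d)]
    simp only [integral_abs_proj_sub, meanPerimeter]
    ring
  rw [← key, meanPerimeter]
  refine intervalIntegral.integral_mono_on Real.pi_pos.le (intervalIntegrable_width _) ?_
    fun θ _ => width_union_le θ ha hb hc hd
  apply Continuous.intervalIntegrable
  have h1 := continuous_width A
  have h2 := continuous_width B
  have h3 := continuous_abs_proj_sub
  exact ((h1.add h2).sub (continuous_const.mul ((h3 a b).add (h3 c d)))).add
    (continuous_const.mul ((h3 a c).add (h3 b d)))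

/-- Joining two intervals adds only the gap between them. The pair `z`, `w` bounds this gap when `A`
projects above `B`, and `z'`, `w'` when it projects below. -/
lemma width_union_le_of_near (θ : ℝ) {A B : Finset Plane} {z w z' w' : Plane}
    (hz : z ∈ convexHull ℝ (A : Set Plane)) (hw : w ∈ convexHull ℝ (B : Set Plane))
    (hz' : z' ∈ convexHull ℝ (A : Set Plane)) (hw' : w' ∈ convexHull ℝ (B : Set Plane)) {D : ℝ}
    (hD : 0 ≤ D) (h : proj θ z - proj θ w ≤ D) (h' : proj θ w' - proj θ z' ≤ D) :
    width θ (A ∪ B) ≤ width θ A + width θ B + D := by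
  have hA : A.Nonempty := by
    rw [← Finset.coe_nonempty, ← convexHull_nonempty_iff (𝕜 := ℝ)]; exact ⟨z, hz⟩
  have hB : B.Nonempty := by
    rw [← Finset.coe_nonempty, ← convexHull_nonempty_iff (𝕜 := ℝ)]; exact ⟨w, hw⟩
  obtain ⟨m, hm, M, hM, -, hwd⟩ := width_spec θ (A := A ∪ B) (hA.mono Finset.subset_union_left)
  obtain ⟨m₁, hm₁, M₁, hM₁, hb₁, hw₁⟩ := width_spec θ hA
  obtain ⟨m₂, hm₂, M₂, hM₂, hb₂, hw₂⟩ := width_spec θ hB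
  rw [hwd, hw₁, hw₂]
  have a1 := le_proj_of_mem_convexHull (fun x hx => (hb₁ x hx).1) hz
  have a2 := proj_le_of_mem_convexHull (fun x hx => (hb₁ x hx).2) hz'
  have a3 := proj_le_of_mem_convexHull (fun x hx => (hb₂ x hx).2) hw
  have a4 := le_proj_of_mem_convexHull (fun x hx => (hb₂ x hx).1) hw'
  have a5 := (hb₁ m₁ hm₁).2
  have a6 := (hb₂ m₂ hm₂).2
  rw [Finset.mem_union] at hm hM
  rcases hm with hm | hm <;> rcases hM with hM | hM
  · linarith [(hb₁ m hm).1, (hb₁ M hM).2]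
  · linarith [(hb₁ m hm).1, (hb₂ M hM).2]
  · linarith [(hb₂ m hm).1, (hb₁ M hM).2]
  · linarith [(hb₂ m hm).1, (hb₂ M hM).2]

lemma meanPerimeter_union_le_of_near {A B : Finset Plane} {z w : Plane}
    (hz : z ∈ convexHull ℝ (A : Set Plane)) (hw : w ∈ convexHull ℝ (B : Set Plane)) :
    meanPerimeter (A ∪ B) ≤ meanPerimeter A + meanPerimeter B + 2 * dist z w := by
  have hA := intervalIntegrable_width A
  have hB := intervalIntegrable_width B
  have hI := intervalIntegrable_abs_proj_sub z w
  have key : ∫ θ in (0 : ℝ)..Real.pi, (width θ A + width θ B + |proj θ z - proj θ w|) =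
      meanPerimeter A + meanPerimeter B + 2 * dist z w := by
    rw [intervalIntegral.integral_add (hA.add hB) hI, intervalIntegral.integral_add hA hB,
      integral_abs_proj_sub]
    rfl
  rw [← key, meanPerimeter]
  exact intervalIntegral.integral_mono_on Real.pi_pos.le (intervalIntegrable_width _)
    ((hA.add hB).add hI) fun θ _ => width_union_le_of_near θ hz hw hz hw (abs_nonneg _)
      (le_abs_self _) (by rw [abs_sub_comm]; exact le_abs_self _)

/-- Two polygons whose projections overlap in every direction can be joined for free. -/
lemma meanPerimeter_union_le_of_overlap {A B : Finset Plane}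
    (h : ∀ θ, ∃ z ∈ convexHull ℝ (A : Set Plane), ∃ w ∈ convexHull ℝ (B : Set Plane),
      proj θ z ≤ proj θ w) :
    meanPerimeter (A ∪ B) ≤ meanPerimeter A + meanPerimeter B := by
  have hA := intervalIntegrable_width A
  have hB := intervalIntegrable_width B
  rw [meanPerimeter, meanPerimeter, meanPerimeter, ← intervalIntegral.integral_add hA hB]
  refine intervalIntegral.integral_mono_on Real.pi_pos.le (intervalIntegrable_width _)
    (hA.add hB) fun θ _ => ?_
  obtain ⟨z, hz, w, hw, hzw⟩ := h θ
  obtain ⟨z', hz', w', hw', hzw'⟩ := h (θ + Real.pi)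
  simp only [proj_add_pi] at hzw'
  simpa using width_union_le_of_near θ hz hw hz' hw' le_rfl (by linarith) (by linarith)

/-! ### Cutting a polygon along lines -/

lemma exists_mem_segment_eq (f : Plane →ₗ[ℝ] ℝ) {p q : Plane} {t : ℝ} (hp : f p ≤ t)
    (hq : t ≤ f q) : ∃ x ∈ segment ℝ p q, f x = t := by
  rcases (hp.trans hq).eq_or_lt with h | h
  · exact ⟨p, left_mem_segment ℝ p q, by linarith⟩
  · have hD : 0 < f q - f p := by linarith
    refine ⟨_, ⟨(f q - t) / (f q - f p), (t - f p) / (f q - f p), div_nonneg (by linarith) hD.le,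
      div_nonneg (by linarith) hD.le, by field_simp; ring, rfl⟩, ?_⟩
    simp only [map_add, map_smul, smul_eq_mul]; field_simp; ring

lemma le_of_mem_segment (f : Plane →ₗ[ℝ] ℝ) {p q x : Plane} {t : ℝ} (hx : x ∈ segment ℝ p q)
    (hp : f p ≤ t) (hq : f q ≤ t) : f x ≤ t := by
  obtain ⟨a, b, ha, hb, hab, rfl⟩ := hx
  simp only [map_add, map_smul, smul_eq_mul]
  obtain rfl : b = 1 - a := by linarith
  nlinarith

lemma ge_of_mem_segment (f : Plane →ₗ[ℝ] ℝ) {p q x : Plane} {t : ℝ} (hx : x ∈ segment ℝ p q)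
    (hp : t ≤ f p) (hq : t ≤ f q) : t ≤ f x := by
  have := le_of_mem_segment (-f) hx (t := -t) (by simpa using hp) (by simpa using hq)
  simpa using this

/-- Cutting a polygon along a line increases the width at most by the width of the cut. -/
lemma width_add_width_le_of_cut (θ : ℝ) (f : Plane →ₗ[ℝ] ℝ) {P Q : Finset Plane}
    {c D : ℝ} (hP : ∀ x ∈ P, f x ≤ c) (hQ : ∀ x ∈ Q, c ≤ f x) (hPn : P.Nonempty)
    (hQn : Q.Nonempty) (hD0 : 0 ≤ D)
    (hD : ∀ x ∈ convexHull ℝ ((P ∪ Q : Finset Plane) : Set Plane),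
      ∀ y ∈ convexHull ℝ ((P ∪ Q : Finset Plane) : Set Plane),
      f x = c → f y = c → proj θ x - proj θ y ≤ D) :
    width θ P + width θ Q ≤ width θ (P ∪ Q) + D := by
  obtain ⟨m₁, hm₁, M₁, hM₁, hb₁, hw₁⟩ := width_spec θ hPn
  obtain ⟨m₂, hm₂, M₂, hM₂, hb₂, hw₂⟩ := width_spec θ hQn
  have sP : ∀ x ∈ P, x ∈ P ∪ Q := fun x hx => Finset.mem_union_left _ hx
  have sQ : ∀ x ∈ Q, x ∈ P ∪ Q := fun x hx => Finset.mem_union_right _ hx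
  have sub : ∀ x ∈ P ∪ Q, x ∈ convexHull ℝ ((P ∪ Q : Finset Plane) : Set Plane) :=
    fun x hx => subset_convexHull ℝ _ hx
  have hcx := convex_convexHull ℝ ((P ∪ Q : Finset Plane) : Set Plane)
  have u1 := sub_le_width θ (sP _ hM₁) (sP _ hm₁)
  have u2 := sub_le_width θ (sP _ hM₁) (sQ _ hm₂)
  have u3 := sub_le_width θ (sQ _ hM₂) (sP _ hm₁)
  have u4 := sub_le_width θ (sQ _ hM₂) (sQ _ hm₂)
  have b1 := (hb₁ m₁ hm₁).2
  have b2 := (hb₂ m₂ hm₂).2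
  -- A level attained in both hulls is attained on the cut: a segment joining two points at that
  -- level stays there and crosses `f = c`. So the overlap of the two projections has length at most
  -- `D`.
  have level : ∀ t, proj θ m₁ ≤ t → t ≤ proj θ M₁ → proj θ m₂ ≤ t → t ≤ proj θ M₂ →
      ∃ x ∈ convexHull ℝ ((P ∪ Q : Finset Plane) : Set Plane), f x = c ∧ proj θ x = t := by
    intro t h1 h2 h3 h4
    obtain ⟨k, hk, hkt⟩ := exists_mem_segment_eq (proj θ) h1 h2
    obtain ⟨l, hl, hlt⟩ := exists_mem_segment_eq (proj θ) h3 h4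
    obtain ⟨x, hx, hxc⟩ := exists_mem_segment_eq f
      (le_of_mem_segment f hk (hP _ hm₁) (hP _ hM₁)) (ge_of_mem_segment f hl (hQ _ hm₂) (hQ _ hM₂))
    refine ⟨x, ?_, hxc, le_antisymm (le_of_mem_segment _ hx hkt.le hlt.le)
      (ge_of_mem_segment _ hx hkt.ge hlt.ge)⟩
    exact hcx.segment_subset (hcx.segment_subset (sub _ (sP _ hm₁)) (sub _ (sP _ hM₁)) hk)
      (hcx.segment_subset (sub _ (sQ _ hm₂)) (sub _ (sQ _ hM₂)) hl) hx
  have main : min (proj θ M₁) (proj θ M₂) - max (proj θ m₁) (proj θ m₂) ≤ D := by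
    by_cases h : max (proj θ m₁) (proj θ m₂) ≤ min (proj θ M₁) (proj θ M₂)
    · simp only [max_le_iff, le_min_iff] at h
      obtain ⟨x, hx, hxc, hxt⟩ := level (min (proj θ M₁) (proj θ M₂))
        (le_min h.1.1 h.2.1) (min_le_left _ _) (le_min h.1.2 h.2.2) (min_le_right _ _)
      obtain ⟨y, hy, hyc, hyt⟩ := level (max (proj θ m₁) (proj θ m₂))
        (le_max_left _ _) (max_le h.1.1 h.1.2) (le_max_right _ _) (max_le h.2.1 h.2.2)
      have := hD x hx y hy hxc hyc
      rwa [hxt, hyt] at this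
    · linarith
  rw [hw₁, hw₂]
  rcases le_total (proj θ M₁) (proj θ M₂) with h | h <;>
    rcases le_total (proj θ m₁) (proj θ m₂) with h' | h' <;>
    simp only [h, h', min_eq_left, min_eq_right, max_eq_left, max_eq_right] at main <;> linarith

lemma width_triangle_le (θ : ℝ) {A : Finset Plane} {x y z : Plane} (hx : x ∈ A) (hy : y ∈ A)
    (hz : z ∈ A) : 2⁻¹ * (|proj θ x - proj θ y| + |proj θ y - proj θ z| + |proj θ z - proj θ x|) ≤
      width θ A := by
  have a1 := sub_le_width θ hx hy
  have a2 := sub_le_width θ hy hx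
  have a3 := sub_le_width θ hy hz
  have a4 := sub_le_width θ hz hy
  have a5 := sub_le_width θ hz hx
  have a6 := sub_le_width θ hx hz
  rcases abs_cases (proj θ x - proj θ y) with h | h <;>
    rcases abs_cases (proj θ y - proj θ z) with h' | h' <;>
    rcases abs_cases (proj θ z - proj θ x) with h'' | h'' <;> linarith

/-- The angle is at most a right one, so ‖v - w‖² ≤ ‖v‖² + ‖w‖². This is the source of every saving
from edges running in similar directions. -/
lemma norm_sub_le_of_inner_nonneg {v w : Plane} {ρ : ℝ} (hi : 0 ≤ v 0 * w 0 + v 1 * w 1)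
    (hρ : 0 ≤ ρ) (hv : ρ ≤ ‖v‖) (hw : ρ ≤ ‖w‖) : ‖v - w‖ ≤ ‖v‖ + ‖w‖ - ρ / 2 := by
  apply le_of_sq_le_sq _ (by linarith)
  have h1 := norm_sq_plane v
  have h2 := norm_sq_plane w
  have h3 := norm_sq_plane (v - w)
  simp only [PiLp.sub_apply] at h3
  have h4 : ‖v - w‖ ^ 2 ≤ ‖v‖ ^ 2 + ‖w‖ ^ 2 := by rw [h1, h2, h3]; nlinarith
  nlinarith [mul_nonneg (norm_nonneg v) (sub_nonneg.2 hw), mul_nonneg (norm_nonneg w) (sub_nonneg.2 hv),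
    sq_nonneg ρ]

lemma inner_eq_proj (θ : ℝ) (v w : Plane) :
    v 0 * w 0 + v 1 * w 1 = proj θ v * proj θ w + coproj θ v * coproj θ w := by
  simp only [proj_apply, coproj_apply]
  linear_combination -(v 0 * w 0 + v 1 * w 1) * Real.sin_sq_add_cos_sq θ

lemma orient_eq_zero_of_mem_segment {p q z : Plane} (h : z ∈ segment ℝ p q) : orient p q z = 0 := by
  obtain ⟨a, b, ha, hb, hab, rfl⟩ := h
  obtain rfl : b = 1 - a := by linarith
  simp only [orient, PiLp.add_apply, PiLp.smul_apply, smul_eq_mul]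
  ring

lemma proj_eq_rotate (θ φ : ℝ) (x : Plane) :
    proj θ x = proj φ x * Real.cos (θ - φ) + coproj φ x * Real.sin (θ - φ) := by
  simp only [proj_apply, coproj_apply, Real.cos_sub, Real.sin_sub]
  linear_combination -(x 0 * Real.cos θ + x 1 * Real.sin θ) * Real.sin_sq_add_cos_sq φ

/-- The chord that a line cuts out of a polygon ends in the two hull edges that the line crosses. -/
lemma proj_sub_le_of_chord (θ φ : ℝ) {A : Finset Plane} {a b a' b' : Plane}
    (he : (a, b) ∈ hullEdges A) (he' : (b', a') ∈ hullEdges A) (hab : proj φ a < proj φ b)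
    (hab' : proj φ a' < proj φ b') {c : ℝ} {z z' x y : Plane} (hz : z ∈ segment ℝ a b)
    (hz' : z' ∈ segment ℝ a' b') (hzc : proj φ z = c) (hzc' : proj φ z' = c)
    (hx : x ∈ convexHull ℝ (A : Set Plane)) (hy : y ∈ convexHull ℝ (A : Set Plane))
    (hxc : proj φ x = c) (hyc : proj φ y = c) :
    proj θ x - proj θ y ≤ |proj θ z - proj θ z'| := by
  have bd : ∀ x ∈ convexHull ℝ (A : Set Plane), proj φ x = c →
      coproj φ z ≤ coproj φ x ∧ coproj φ x ≤ coproj φ z' := by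
    intro x hx hxc
    have h1 := orient_nonneg_of_mem_hullEdges he hx
    have h2 := orient_nonneg_of_mem_hullEdges he' hx
    have h3 := orient_eq_zero_of_mem_segment hz
    have h4 := orient_eq_zero_of_mem_segment (segment_symm ℝ a' b' ▸ hz')
    simp only [orient_eq φ, hxc, hzc, hzc'] at h1 h2 h3 h4
    constructor
    · by_contra! h; nlinarith
    · by_contra! h; nlinarith
  obtain ⟨hx1, hx2⟩ := bd x hx hxc
  obtain ⟨hy1, hy2⟩ := bd y hy hyc
  have e1 : proj θ x - proj θ y = (coproj φ x - coproj φ y) * Real.sin (θ - φ) := by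
    rw [proj_eq_rotate θ φ x, proj_eq_rotate θ φ y, hxc, hyc]; ring
  have e2 : proj θ z - proj θ z' = (coproj φ z - coproj φ z') * Real.sin (θ - φ) := by
    rw [proj_eq_rotate θ φ z, proj_eq_rotate θ φ z', hzc, hzc']; ring
  rw [e1, e2, abs_mul]
  refine (le_abs_self _).trans ?_
  rw [abs_mul]
  refine mul_le_mul_of_nonneg_right ?_ (abs_nonneg _)
  rw [abs_sub_comm (coproj φ z), abs_of_nonneg (by linarith : 0 ≤ coproj φ z' - coproj φ z)]
  exact abs_le.2 ⟨by linarith, by linarith⟩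

/-- Cutting a polygon twice, at both ends of a strip without vertices that is crossed by the two
hull edges `a b` and `b' a'`, and discarding the middle part. -/
lemma meanPerimeter_split_le (φ : ℝ) {A L R : Finset Plane} {a b a' b' : Plane}
    (he : (a, b) ∈ hullEdges A) (he' : (b', a') ∈ hullEdges A) {c β : ℝ} (hcβ : c < β)
    (ha : proj φ a ≤ c) (ha' : proj φ a' ≤ c) (hb : β ≤ proj φ b) (hb' : β ≤ proj φ b')
    (hLA : L ⊆ A) (hRA : R ⊆ A) (hL : ∀ x ∈ L, proj φ x ≤ c) (hR : ∀ x ∈ R, β ≤ proj φ x)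
    (hRn : R.Nonempty) {z z' y y' : Plane} (hz : z ∈ segment ℝ a b) (hz' : z' ∈ segment ℝ a' b')
    (hy : y ∈ segment ℝ a b) (hy' : y' ∈ segment ℝ a' b') (hzc : proj φ z = c)
    (hzc' : proj φ z' = c) (hyβ : proj φ y = β) (hyβ' : proj φ y' = β) :
    meanPerimeter (insert z L) + meanPerimeter R ≤
      meanPerimeter A + 2 * dist z z' + dist y y' - dist z y - dist z y' := by
  obtain ⟨⟨haA, hbA⟩, -⟩ := mem_hullEdges.1 he
  obtain ⟨⟨hbA', haA'⟩, -⟩ := mem_hullEdges.1 he'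
  have hcx := convex_convexHull ℝ (A : Set Plane)
  have sub : ∀ x ∈ A, x ∈ convexHull ℝ (A : Set Plane) := fun x hx => subset_convexHull ℝ _ hx
  have s1 := hcx.segment_subset (sub a haA) (sub b hbA)
  have s2 := hcx.segment_subset (sub a' haA') (sub b' hbA')
  have hQ4 : ∀ x ∈ ({z, z', y, y'} : Finset Plane), x ∈ convexHull ℝ (A : Set Plane) := by
    intro x hx
    simp only [Finset.mem_insert, Finset.mem_singleton] at hx
    rcases hx with rfl | rfl | rfl | rfl
    exacts [s1 hz, s2 hz', s1 hy, s2 hy']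
  have hU1 : ∀ x ∈ ({z, z', y, y'} ∪ R : Finset Plane), x ∈ convexHull ℝ (A : Set Plane) := by
    intro x hx
    rcases Finset.mem_union.1 hx with hx | hx
    · exact hQ4 x hx
    · exact sub x (hRA hx)
  have hU2 : ∀ x ∈ (insert z L ∪ ({z, z', y, y'} ∪ R) : Finset Plane),
      x ∈ convexHull ℝ (A : Set Plane) := by
    intro x hx
    rcases Finset.mem_union.1 hx with hx | hx
    · rcases Finset.mem_insert.1 hx with rfl | hx
      · exact s1 hz
      · exact sub x (hLA hx)
    · exact hU1 x hx
  -- Two cuts add the projections of the chords `z z'` and `y y'`; the discarded middle contains the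
  -- triangle `z y y'`, whose width is at least half the sum of its projected sides.
  have point : ∀ θ, width θ (insert z L) + width θ R ≤ width θ A + |proj θ z - proj θ z'| +
      |proj θ y - proj θ y'| - 2⁻¹ * (|proj θ z - proj θ y| + |proj θ y - proj θ y'| +
        |proj θ y' - proj θ z|) := by
    intro θ
    have c1 := width_add_width_le_of_cut θ (proj φ) (P := insert z L)
      (Q := {z, z', y, y'} ∪ R) (c := c) (D := |proj θ z - proj θ z'|) ?_ ?_ (by simp) (by simp)
      (abs_nonneg _) ?_
    · have c2 := width_add_width_le_of_cut θ (proj φ) (P := {z, z', y, y'}) (Q := R)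
        (c := β) (D := |proj θ y - proj θ y'|) ?_ hR (by simp) hRn (abs_nonneg _) ?_
      · have c3 := width_le_of_subset_convexHull θ hU2
        have c4 := width_triangle_le θ (A := {z, z', y, y'}) (x := z) (y := y) (z := y')
          (by simp) (by simp) (by simp)
        linarith
      · intro x hx
        simp only [Finset.mem_insert, Finset.mem_singleton] at hx
        rcases hx with rfl | rfl | rfl | rfl <;> linarith
      · intro p hp q hq hpc hqc
        exact proj_sub_le_of_chord θ φ he he' (by linarith) (by linarith) hy hy' hyβ hyβ'
          (convexHull_min (fun x hx => hU1 x hx) hcx hp)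
          (convexHull_min (fun x hx => hU1 x hx) hcx hq) hpc hqc
    · intro x hx
      rcases Finset.mem_insert.1 hx with rfl | hx
      · exact hzc.le
      · exact hL x hx
    · intro x hx
      simp only [Finset.mem_union, Finset.mem_insert, Finset.mem_singleton] at hx
      rcases hx with (rfl | rfl | rfl | rfl) | hx
      · exact hzc.ge
      · exact hzc'.ge
      · linarith
      · linarith
      · linarith [hR x hx]
    · intro p hp q hq hpc hqc
      exact proj_sub_le_of_chord θ φ he he' (by linarith) (by linarith) hz hz' hzc hzc'
        (convexHull_min (fun x hx => hU2 x hx) hcx hp)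
        (convexHull_min (fun x hx => hU2 x hx) hcx hq) hpc hqc
  have hI := intervalIntegrable_abs_proj_sub
  have hA := intervalIntegrable_width A
  have hT := (((hI z y).add (hI y y')).add (hI y' z)).const_mul (2⁻¹ : ℝ)
  have hS := ((hA.add (hI z z')).add (hI y y')).sub hT
  have key : ∫ θ in (0 : ℝ)..Real.pi, (width θ A + |proj θ z - proj θ z'| +
      |proj θ y - proj θ y'| - 2⁻¹ * (|proj θ z - proj θ y| + |proj θ y - proj θ y'| +
        |proj θ y' - proj θ z|)) =
      meanPerimeter A + 2 * dist z z' + dist y y' - dist z y - dist z y' := by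
    rw [intervalIntegral.integral_sub ((hA.add (hI z z')).add (hI y y')) hT,
      intervalIntegral.integral_add (hA.add (hI z z')) (hI y y'),
      intervalIntegral.integral_add hA (hI z z'), intervalIntegral.integral_const_mul,
      intervalIntegral.integral_add ((hI z y).add (hI y y')) (hI y' z),
      intervalIntegral.integral_add (hI z y) (hI y y')]
    simp only [integral_abs_proj_sub, meanPerimeter, dist_comm y' z]
    ring
  have h1 := intervalIntegrable_width (insert z L)
  have h2 := intervalIntegrable_width R
  rw [← key, meanPerimeter, meanPerimeter, ← intervalIntegral.integral_add h1 h2]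
  exact intervalIntegral.integral_mono_on Real.pi_pos.le (h1.add h2) hS fun θ _ => point θ

/-! ### Exchange arguments for clusterings -/

lemma pairwiseDisjoint_pair {A B : Finset Plane} (h : Disjoint A B) :
    ((({A, B} : Finset (Finset Plane)) : Set (Finset Plane))).PairwiseDisjoint id := by
  intro X hX Y hY hXY
  simp only [Finset.coe_insert, Finset.coe_singleton, Set.mem_insert_iff,
    Set.mem_singleton_iff] at hX hY
  rcases hX with rfl | rfl <;> rcases hY with rfl | rfl
  exacts [absurd rfl hXY, h, h.symm, absurd rfl hXY]

namespace Clustering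

variable {S : Finset Plane}

lemma nonempty_of_mem_parts (C : Clustering S) {A : Finset Plane} (hA : A ∈ C.parts) :
    A.Nonempty := Finpartition.nonempty_of_mem_parts C hA

lemma subset_of_mem_parts (C : Clustering S) {A : Finset Plane} (hA : A ∈ C.parts) : A ⊆ S :=
  Finpartition.le C hA

lemma eq_of_mem_of_mem (C : Clustering S) {A B : Finset Plane} (hA : A ∈ C.parts)
    (hB : B ∈ C.parts) {x : Plane} (hxA : x ∈ A) (hxB : x ∈ B) : A = B := by
  by_contra h
  exact Finset.disjoint_left.1 (C.disjoint hA hB h) hxA hxB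

lemma cost_eq (C : Clustering S) : C.cost = ∑ A ∈ C.parts, meanPerimeter A :=
  Finset.sum_congr rfl fun _ hA => hullPerimeter_eq_meanPerimeter (C.nonempty_of_mem_parts hA)

/-- Replacing some clusters by other clusters with the same union. -/
lemma exists_replace (C : Clustering S) {𝒜 𝒩 : Finset (Finset Plane)} (h𝒜 : 𝒜 ⊆ C.parts)
    (hne : ∀ N ∈ 𝒩, N.Nonempty) (hd : (𝒩 : Set (Finset Plane)).PairwiseDisjoint id)
    (hU : ∀ x, (∃ N ∈ 𝒩, x ∈ N) ↔ ∃ A ∈ 𝒜, x ∈ A) :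
    ∃ C' : Clustering S, C'.parts = (C.parts \ 𝒜) ∪ 𝒩 := by
  have hcross : ∀ A ∈ C.parts \ 𝒜, ∀ N ∈ 𝒩, Disjoint A N := by
    intro A hA N hN
    rw [Finset.disjoint_left]
    intro x hxA hxN
    obtain ⟨B, hB, hxB⟩ := (hU x).1 ⟨N, hN, hxN⟩
    rw [Finset.mem_sdiff] at hA
    exact hA.2 (C.eq_of_mem_of_mem hA.1 (h𝒜 hB) hxA hxB ▸ hB)
  refine ⟨⟨(C.parts \ 𝒜) ∪ 𝒩, ?_, ?_, ?_⟩, rfl⟩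
  · rw [Finset.supIndep_iff_pairwiseDisjoint]
    intro A hA B hB hAB
    simp only [Finset.coe_union, Set.mem_union, Finset.mem_coe] at hA hB
    rcases hA with hA | hA <;> rcases hB with hB | hB
    · exact C.disjoint (Finset.mem_sdiff.1 hA).1 (Finset.mem_sdiff.1 hB).1 hAB
    · exact hcross A hA B hB
    · exact (hcross B hB A hA).symm
    · exact hd hA hB hAB
  · ext x
    simp only [Finset.mem_sup, id, Finset.mem_union, Finset.mem_sdiff]
    constructor
    · rintro ⟨A, hA | hA, hx⟩
      · exact C.subset_of_mem_parts hA.1 hx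
      · obtain ⟨B, hB, hxB⟩ := (hU x).1 ⟨A, hA, hx⟩
        exact C.subset_of_mem_parts (h𝒜 hB) hxB
    · intro hx
      obtain ⟨A, hA, hxA⟩ := C.exists_mem hx
      by_cases h : A ∈ 𝒜
      · obtain ⟨N, hN, hxN⟩ := (hU x).2 ⟨A, h, hxA⟩
        exact ⟨N, Or.inr hN, hxN⟩
      · exact ⟨A, Or.inl ⟨hA, h⟩, hxA⟩
  · intro h
    rcases Finset.mem_union.1 h with h | h
    · exact C.bot_notMem (Finset.mem_sdiff.1 h).1
    · simpa using hne _ h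

lemma cost_le_of_parts_eq {C C' : Clustering S} {𝒜 𝒩 : Finset (Finset Plane)} (h𝒜 : 𝒜 ⊆ C.parts)
    (h : C'.parts = (C.parts \ 𝒜) ∪ 𝒩) :
    C'.cost + ∑ A ∈ 𝒜, meanPerimeter A ≤ C.cost + ∑ A ∈ 𝒩, meanPerimeter A := by
  rw [cost_eq, cost_eq, h]
  have h1 := Finset.sum_union_inter (s₁ := C.parts \ 𝒜) (s₂ := 𝒩) (f := meanPerimeter)
  have h2 : 0 ≤ ∑ A ∈ (C.parts \ 𝒜) ∩ 𝒩, meanPerimeter A :=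
    Finset.sum_nonneg fun A _ => meanPerimeter_nonneg A
  have h3 := Finset.sum_sdiff h𝒜 (f := meanPerimeter)
  linarith

/-- Clusters can be split into smaller ones without increasing the cost. -/
lemma exists_card_eq (k : ℕ) (hk : k ≤ S.card) (C : Clustering S) (hC : C.parts.card ≤ k) :
    ∃ C' : Clustering S, C'.parts.card = k ∧ C'.cost ≤ C.cost := by
  induction h : k - C.parts.card generalizing C with
  | zero => exact ⟨C, by omega, le_rfl⟩
  | succ n ih =>
    have hlt : C.parts.card < S.card := by omega
    -- By counting, some cluster has two points. Splitting off one of them is free: a singleton has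
    -- perimeter zero and the rest does not grow.
    obtain ⟨A, hA, hA1⟩ : ∃ A ∈ C.parts, 1 < A.card := by
      by_contra! hcon
      have := C.sum_card_parts
      have h2 : ∑ A ∈ C.parts, A.card ≤ C.parts.card • 1 :=
        Finset.sum_le_card_nsmul C.parts Finset.card 1 hcon
      rw [smul_eq_mul, mul_one, this] at h2
      omega
    obtain ⟨v, hv⟩ := C.nonempty_of_mem_parts hA
    have hne : (A.erase v).Nonempty := by
      rw [← Finset.card_pos, Finset.card_erase_of_mem hv]; omega
    have hvne : A.erase v ≠ {v} := fun h' => by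
      have : v ∈ A.erase v := h' ▸ Finset.mem_singleton_self v
      simp at this
    obtain ⟨C', hC'⟩ := C.exists_replace (𝒜 := {A}) (𝒩 := {A.erase v, {v}}) (by simpa using hA)
      (by simp [hne]) (pairwiseDisjoint_pair (by simp)) (by
        intro x
        simp only [Finset.mem_insert, Finset.mem_singleton, exists_eq_or_imp, exists_eq_left,
          Finset.mem_erase]
        by_cases hx : x = v
        · simp [hx, hv]
        · simp [hx])
    have hcard : C'.parts.card = C.parts.card + 1 := by
      have hdis : Disjoint (C.parts \ {A}) ({A.erase v, {v}} : Finset (Finset Plane)) := by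
        rw [Finset.disjoint_left]
        intro B hB hB'
        rw [Finset.mem_sdiff, Finset.mem_singleton] at hB
        simp only [Finset.mem_insert, Finset.mem_singleton] at hB'
        rcases hB' with rfl | rfl
        · obtain ⟨x, hx⟩ := hne
          exact hB.2 (C.eq_of_mem_of_mem hB.1 hA hx (Finset.mem_of_mem_erase hx))
        · exact hB.2 (C.eq_of_mem_of_mem hB.1 hA (Finset.mem_singleton_self v) hv)
      rw [hC', Finset.card_union_of_disjoint hdis, Finset.card_sdiff_of_subset (by simpa using hA),
        Finset.card_pair hvne, Finset.card_singleton]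
      have : 0 < C.parts.card := Finset.card_pos.2 ⟨A, hA⟩
      omega
    have hcost := cost_le_of_parts_eq (C := C) (𝒜 := {A}) (by simpa using hA) hC'
    rw [Finset.sum_pair hvne, Finset.sum_singleton, meanPerimeter_singleton] at hcost
    have hmono := meanPerimeter_mono (A := A.erase v) (B := A)
      fun x hx => subset_convexHull ℝ _ (Finset.mem_of_mem_erase hx)
    obtain ⟨C'', h1, h2⟩ := ih C' (by omega) (by omega)
    exact ⟨C'', h1, by linarith⟩

/-- In an optimal clustering no exchange of clusters for at most as many other clusters pays. -/
lemma IsOptimal.sum_le {C : Clustering S} {k : ℕ} (hC : C.IsOptimal k)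
    {𝒜 𝒩 : Finset (Finset Plane)} (h𝒜 : 𝒜 ⊆ C.parts) (hne : ∀ N ∈ 𝒩, N.Nonempty)
    (hd : (𝒩 : Set (Finset Plane)).PairwiseDisjoint id)
    (hU : ∀ x, (∃ N ∈ 𝒩, x ∈ N) ↔ ∃ A ∈ 𝒜, x ∈ A) (hcard : 𝒩.card ≤ 𝒜.card) :
    ∑ A ∈ 𝒜, meanPerimeter A ≤ ∑ A ∈ 𝒩, meanPerimeter A := by
  obtain ⟨C', hC'⟩ := C.exists_replace h𝒜 hne hd hU
  have hle := cost_le_of_parts_eq h𝒜 hC'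
  have h1 : C'.parts.card ≤ k := by
    rw [hC', ← hC.1]
    refine (Finset.card_union_le _ _).trans ?_
    rw [Finset.card_sdiff_of_subset h𝒜]
    have := Finset.card_le_card h𝒜
    omega
  obtain ⟨C'', h2, h3⟩ := exists_card_eq k (hC.1 ▸ C.card_parts_le_card) C' h1
  have := hC.2 C'' h2
  linarith

lemma proj_zero_apply (x : Plane) : proj 0 x = x 0 := by simp [proj_apply]

/-- Merging two clusters of an optimal clustering strictly increases the total perimeter. -/
lemma IsOptimal.lt_union (hS : Set.InjOn (fun p : Plane => p 0) (S : Set Plane)) {C : Clustering S}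
    {k : ℕ} (hC : C.IsOptimal k) {A B : Finset Plane} (hA : A ∈ C.parts) (hB : B ∈ C.parts)
    (hAB : A ≠ B) : meanPerimeter A + meanPerimeter B < meanPerimeter (A ∪ B) := by
  obtain ⟨a, ha⟩ := C.nonempty_of_mem_parts hA
  obtain ⟨b, hb⟩ := C.nonempty_of_mem_parts hB
  have hab : a ≠ b := by
    rintro rfl; exact hAB (C.eq_of_mem_of_mem hA hB ha hb)
  have hUS : A ∪ B ⊆ S := Finset.union_subset (C.subset_of_mem_parts hA) (C.subset_of_mem_parts hB)
  -- `v` is the rightmost point. Exchanging the two clusters for `(A ∪ B).erase v` and `{v}` is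
  -- admissible, and as x-coordinates are distinct, erasing `v` strictly lowers the width at angle
  -- 0, hence the integral by continuity.
  obtain ⟨m, hm, v, hv, hbd, hw⟩ := width_spec 0 (A := A ∪ B) ⟨a, Finset.mem_union_left _ ha⟩
  have hne : ((A ∪ B).erase v).Nonempty := by
    by_cases h : a = v
    · exact ⟨b, Finset.mem_erase.2 ⟨h ▸ hab.symm, Finset.mem_union_right _ hb⟩⟩
    · exact ⟨a, Finset.mem_erase.2 ⟨h, Finset.mem_union_left _ ha⟩⟩
  have hvne : (A ∪ B).erase v ≠ {v} := fun h' => by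
    have : v ∈ (A ∪ B).erase v := h' ▸ Finset.mem_singleton_self v
    simp at this
  have hle := hC.sum_le (𝒜 := {A, B}) (𝒩 := {(A ∪ B).erase v, {v}})
    (by simp [Finset.insert_subset_iff, hA, hB]) (by simp [hne]) (pairwiseDisjoint_pair (by simp)) (by
      intro x
      simp only [Finset.mem_insert, Finset.mem_singleton, exists_eq_or_imp, exists_eq_left,
        Finset.mem_erase, Finset.mem_union]
      by_cases hx : x = v
      · simpa [hx] using hv
      · simp [hx]) (by rw [Finset.card_pair hAB]; exact Finset.card_le_two)
  rw [Finset.sum_pair hAB, Finset.sum_pair hvne, meanPerimeter_singleton, add_zero] at hle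
  refine hle.trans_lt ?_
  refine intervalIntegral.integral_lt_integral_of_continuousOn_of_le_of_exists_lt Real.pi_pos
    (continuous_width _).continuousOn (continuous_width _).continuousOn
    (fun θ _ => width_mono θ (Finset.erase_subset _ _)) ⟨0, by simp [Real.pi_pos.le], ?_⟩
  obtain ⟨m', hm', v', hv', -, hw'⟩ := width_spec 0 hne
  rw [hw, hw']
  rw [Finset.mem_erase] at hm' hv'
  have h1 := (hbd m' hm'.2).1
  have h2 : proj 0 v' < proj 0 v := by
    refine lt_of_le_of_ne (hbd v' hv'.2).2 fun h => hv'.1 ?_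
    rw [proj_zero_apply, proj_zero_apply] at h
    exact hS (hUS hv'.2) (hUS hv) h
  linarith

end Clustering

/-! ### Length of the edges inside a rectangle -/

/-- The corners of an axis-parallel rectangle. -/
def corners (l u : Fin 2 → ℝ) : Finset Plane :=
  {!₂[l 0, l 1], !₂[u 0, l 1], !₂[l 0, u 1], !₂[u 0, u 1]}

lemma proj_mk (θ a b : ℝ) : proj θ !₂[a, b] = a * Real.cos θ + b * Real.sin θ := by
  simp [proj_apply]

lemma exists_corner_ge (θ : ℝ) {l u : Fin 2 → ℝ} {z : Plane} (hl : ∀ i, l i ≤ z i)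
    (hu : ∀ i, z i ≤ u i) : ∃ q ∈ corners l u, proj θ z ≤ proj θ q := by
  have h0 := hl 0
  have h1 := hl 1
  have h2 := hu 0
  have h3 := hu 1
  rcases le_total 0 (Real.cos θ) with hc | hc <;> rcases le_total 0 (Real.sin θ) with hs | hs
  · refine ⟨!₂[u 0, u 1], by simp [corners], ?_⟩
    rw [proj_mk, proj_apply]; nlinarith
  · refine ⟨!₂[u 0, l 1], by simp [corners], ?_⟩
    rw [proj_mk, proj_apply]; nlinarith
  · refine ⟨!₂[l 0, u 1], by simp [corners], ?_⟩
    rw [proj_mk, proj_apply]; nlinarith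
  · refine ⟨!₂[l 0, l 1], by simp [corners], ?_⟩
    rw [proj_mk, proj_apply]; nlinarith

lemma meanPerimeter_corners_le {l u : Fin 2 → ℝ} (h : ∀ i, l i ≤ u i) :
    meanPerimeter (corners l u) ≤ 2 * ((u 0 - l 0) + (u 1 - l 1)) := by
  have h0 := h 0
  have h1 := h 1
  have hI := intervalIntegrable_abs_proj_sub
  set a : Plane := !₂[l 0, l 1] with ha
  set b : Plane := !₂[u 0, l 1] with hb
  set c : Plane := !₂[l 0, u 1] with hc
  have d1 : dist a b = u 0 - l 0 := by
    rw [EuclideanSpace.dist_eq]; simp [ha, hb, Fin.sum_univ_two, Real.dist_eq]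
    rw [Real.sqrt_sq_eq_abs, abs_sub_comm, abs_of_nonneg (by linarith)]
  have d2 : dist a c = u 1 - l 1 := by
    rw [EuclideanSpace.dist_eq]; simp [ha, hc, Fin.sum_univ_two, Real.dist_eq]
    rw [Real.sqrt_sq_eq_abs, abs_sub_comm, abs_of_nonneg (by linarith)]
  rw [← d1, ← d2, mul_add, ← integral_abs_proj_sub, ← integral_abs_proj_sub,
    ← intervalIntegral.integral_add (hI a b) (hI a c)]
  refine intervalIntegral.integral_mono_on Real.pi_pos.le (intervalIntegrable_width _)
    ((hI a b).add (hI a c)) fun θ _ => ?_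
  obtain ⟨m, hm, M, hM, -, hw⟩ := width_spec θ (A := corners l u) ⟨a, by simp [corners, ha]⟩
  rw [hw]
  simp only [corners, Finset.mem_insert, Finset.mem_singleton] at hm hM
  have e1 : proj θ a - proj θ b = -((u 0 - l 0) * Real.cos θ) := by
    simp only [ha, hb, proj_mk]; ring
  have e2 : proj θ a - proj θ c = -((u 1 - l 1) * Real.sin θ) := by
    simp only [ha, hc, proj_mk]; ring
  rw [e1, e2, abs_neg, abs_neg]
  have b1 := abs_le.1 (le_refl |(u 0 - l 0) * Real.cos θ|)
  have b2 := abs_le.1 (le_refl |(u 1 - l 1) * Real.sin θ|)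
  rcases hm with rfl | rfl | rfl | rfl <;> rcases hM with rfl | rfl | rfl | rfl <;>
    simp only [proj_mk] <;> linarith

/-- The hull edges of a polygon `A` that are ascending in the direction `θ`, clipped by a set of
points whose projections lie in the interval `[lo, hi]`. -/
lemma sum_clipped_ascending_le (θ : ℝ) {A : Finset Plane} {E : Finset (Plane × Plane)}
    (hE : E ⊆ hullEdges A) {s t : Plane × Plane → Plane} (hs : ∀ e ∈ E, s e ∈ segment ℝ e.1 e.2)
    (ht : ∀ e ∈ E, t e ∈ segment ℝ e.1 e.2) {lo hi : ℝ} (hlohi : lo ≤ hi)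
    (hbs : ∀ e ∈ E, lo ≤ proj θ (s e) ∧ proj θ (s e) ≤ hi)
    (hbt : ∀ e ∈ E, lo ≤ proj θ (t e) ∧ proj θ (t e) ≤ hi) :
    ∑ e ∈ E.filter (fun e => proj θ e.1 < proj θ e.2), |proj θ (s e) - proj θ (t e)| ≤ hi - lo := by
  have := sum_length_le_of_disjoint (E.filter (fun e => proj θ e.1 < proj θ e.2))
    (fun e => min (proj θ (s e)) (proj θ (t e))) (fun e => max (proj θ (s e)) (proj θ (t e)))
    (fun e _ => min_le_max) hlohi ?_ ?_
  · refine le_trans (le_of_eq (Finset.sum_congr rfl fun e _ => ?_)) this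
    rw [max_sub_min_eq_abs']
  · intro e he
    have he := (Finset.mem_filter.1 he).1
    exact ⟨le_min (hbs e he).1 (hbt e he).1, max_le (hbs e he).2 (hbt e he).2⟩
  · intro e he f hf x h1 h2 h3 h4
    have he' := Finset.mem_filter.1 he
    have hf' := Finset.mem_filter.1 hf
    have bd : ∀ e ∈ E, proj θ e.1 < proj θ e.2 → proj θ e.1 ≤ min (proj θ (s e)) (proj θ (t e)) ∧
        max (proj θ (s e)) (proj θ (t e)) ≤ proj θ e.2 := by
      intro e he hlt
      exact ⟨le_min (ge_of_mem_segment _ (hs e he) le_rfl hlt.le)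
        (ge_of_mem_segment _ (ht e he) le_rfl hlt.le),
        max_le (le_of_mem_segment _ (hs e he) hlt.le le_rfl)
        (le_of_mem_segment _ (ht e he) hlt.le le_rfl)⟩
    obtain ⟨a1, a2⟩ := bd e he'.1 he'.2
    obtain ⟨a3, a4⟩ := bd f hf'.1 hf'.2
    exact hullEdge_unique θ (hE he'.1) (hE hf'.1) (a1.trans_lt h1) (h2.trans_le a2)
      (a3.trans_lt h3) (h4.trans_le a4)

/-- The factor 2 counts the ascending and the descending edges; edges orthogonal to the direction
contribute nothing. -/
lemma sum_clipped_le (θ : ℝ) {A : Finset Plane} {E : Finset (Plane × Plane)}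
    (hE : E ⊆ hullEdges A) {s t : Plane × Plane → Plane} (hs : ∀ e ∈ E, s e ∈ segment ℝ e.1 e.2)
    (ht : ∀ e ∈ E, t e ∈ segment ℝ e.1 e.2) {lo hi : ℝ} (hlohi : lo ≤ hi)
    (hbs : ∀ e ∈ E, lo ≤ proj θ (s e) ∧ proj θ (s e) ≤ hi)
    (hbt : ∀ e ∈ E, lo ≤ proj θ (t e) ∧ proj θ (t e) ≤ hi) :
    ∑ e ∈ E, |proj θ (s e) - proj θ (t e)| ≤ 2 * (hi - lo) := by
  have h1 := sum_clipped_ascending_le θ hE hs ht hlohi hbs hbt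
  have h2 := sum_clipped_ascending_le (θ + Real.pi) hE hs ht (lo := -hi) (hi := -lo) (by linarith)
    (fun e he => by rw [proj_add_pi]; constructor <;> linarith [hbs e he])
    (fun e he => by rw [proj_add_pi]; constructor <;> linarith [hbt e he])
  have h3 : ∑ e ∈ E, |proj θ (s e) - proj θ (t e)| =
      ∑ e ∈ E.filter (fun e => proj θ e.1 < proj θ e.2), |proj θ (s e) - proj θ (t e)| +
      ∑ e ∈ E.filter (fun e => proj (θ + Real.pi) e.1 < proj (θ + Real.pi) e.2),
        |proj (θ + Real.pi) (s e) - proj (θ + Real.pi) (t e)| := by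
    rw [Finset.sum_filter, Finset.sum_filter, ← Finset.sum_add_distrib]
    refine Finset.sum_congr rfl fun e he => ?_
    simp only [proj_add_pi, neg_lt_neg_iff]
    rcases lt_trichotomy (proj θ e.1) (proj θ e.2) with h | h | h
    · rw [if_pos h, if_neg h.le.not_gt, add_zero]
    · have e1 := le_of_mem_segment _ (hs e he) h.le le_rfl
      have e2 := ge_of_mem_segment _ (hs e he) h.ge le_rfl
      have e3 := le_of_mem_segment _ (ht e he) h.le le_rfl
      have e4 := ge_of_mem_segment _ (ht e he) h.ge le_rfl
      rw [show proj θ (s e) - proj θ (t e) = 0 by linarith]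
      simp [h]
    · rw [if_neg h.le.not_gt, if_pos h, zero_add, ← abs_neg]; congr 1; ring
  linarith

/-- The effect on the width of joining a polygon `A` to a set that contains the corners of a
rectangle: what `A` has in the rectangle is saved. -/
lemma width_union_le_sub_clipped (θ : ℝ) {X A : Finset Plane} {l u : Fin 2 → ℝ}
    (hX : corners l u ⊆ X) {E : Finset (Plane × Plane)} (hE : E ⊆ hullEdges A) (hEn : E.Nonempty)
    {s t : Plane × Plane → Plane} (hs : ∀ e ∈ E, s e ∈ segment ℝ e.1 e.2)
    (ht : ∀ e ∈ E, t e ∈ segment ℝ e.1 e.2) (hbs : ∀ e ∈ E, ∀ i, l i ≤ s e i ∧ s e i ≤ u i)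
    (hbt : ∀ e ∈ E, ∀ i, l i ≤ t e i ∧ t e i ≤ u i) :
    width θ (X ∪ A) ≤ width θ X + (width θ A - 2⁻¹ * ∑ e ∈ E, |proj θ (s e) - proj θ (t e)|) := by
  obtain ⟨e₀, he₀⟩ := hEn
  have hA : A.Nonempty := ⟨e₀.1, (mem_hullEdges.1 (hE he₀)).1.1⟩
  obtain ⟨m₁, hm₁, M₁, hM₁, hb₁, hw₁⟩ := width_spec θ (A := X) ⟨!₂[l 0, l 1], hX (by simp [corners])⟩
  obtain ⟨m₂, hm₂, M₂, hM₂, hb₂, hw₂⟩ := width_spec θ hA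
  have box : ∀ z : Plane, (∀ i, l i ≤ z i ∧ z i ≤ u i) →
      proj θ m₁ ≤ proj θ z ∧ proj θ z ≤ proj θ M₁ := by
    intro z hz
    obtain ⟨q, hq, h⟩ := exists_corner_ge θ (fun i => (hz i).1) (fun i => (hz i).2)
    obtain ⟨q', hq', h'⟩ := exists_corner_ge (θ + Real.pi) (fun i => (hz i).1) (fun i => (hz i).2)
    simp only [proj_add_pi] at h'
    exact ⟨by linarith [(hb₁ q' (hX hq')).1], by linarith [(hb₁ q (hX hq)).2]⟩
  have seg : ∀ e ∈ E, ∀ z ∈ segment ℝ e.1 e.2, proj θ m₂ ≤ proj θ z ∧ proj θ z ≤ proj θ M₂ := by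
    intro e he z hz
    have := (mem_hullEdges.1 (hE he)).1
    exact ⟨ge_of_mem_segment _ hz (hb₂ _ this.1).1 (hb₂ _ this.2).1,
      le_of_mem_segment _ hz (hb₂ _ this.1).2 (hb₂ _ this.2).2⟩
  -- The clipped edges project into the overlap of the two intervals, and the overlap is what the
  -- union saves.
  have key := sum_clipped_le θ hE hs ht (lo := max (proj θ m₁) (proj θ m₂))
    (hi := min (proj θ M₁) (proj θ M₂)) ?_ ?_ ?_
  · obtain ⟨m, hm, M, hM, -, hw⟩ := width_spec θ (A := X ∪ A) (hA.mono Finset.subset_union_right)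
    rw [hw, hw₁, hw₂]
    have hM' : proj θ M ≤ max (proj θ M₁) (proj θ M₂) := by
      rcases Finset.mem_union.1 hM with h | h
      · exact le_max_of_le_left (hb₁ M h).2
      · exact le_max_of_le_right (hb₂ M h).2
    have hm' : min (proj θ m₁) (proj θ m₂) ≤ proj θ m := by
      rcases Finset.mem_union.1 hm with h | h
      · exact min_le_of_left_le (hb₁ m h).1
      · exact min_le_of_right_le (hb₂ m h).1
    have e1 := min_add_max (proj θ M₁) (proj θ M₂)
    have e2 := min_add_max (proj θ m₁) (proj θ m₂)
    linarith
  · obtain ⟨a1, a2⟩ := box _ (hbs e₀ he₀)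
    obtain ⟨a3, a4⟩ := seg e₀ he₀ _ (hs e₀ he₀)
    exact (max_le a1 a3).trans (le_min a2 a4)
  · intro e he
    obtain ⟨a1, a2⟩ := box _ (hbs e he)
    obtain ⟨a3, a4⟩ := seg e he _ (hs e he)
    exact ⟨max_le a1 a3, le_min a2 a4⟩
  · intro e he
    obtain ⟨a1, a2⟩ := box _ (hbt e he)
    obtain ⟨a3, a4⟩ := seg e he _ (ht e he)
    exact ⟨max_le a1 a3, le_min a2 a4⟩

/-- In an optimal clustering the total length of the edges inside a rectangle is at most the
perimeter of the rectangle. -/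
lemma Clustering.IsOptimal.sum_dist_le {S : Finset Plane} {C : Clustering S} {k : ℕ}
    (hC : C.IsOptimal k) {E : Finset (Plane × Plane)} (hE : ∀ e ∈ E, e ∈ C.edges)
    {s t : Plane × Plane → Plane} (hs : ∀ e ∈ E, s e ∈ segment ℝ e.1 e.2)
    (ht : ∀ e ∈ E, t e ∈ segment ℝ e.1 e.2) {l u : Fin 2 → ℝ} (hlu : ∀ i, l i ≤ u i)
    (hbs : ∀ e ∈ E, ∀ i, l i ≤ s e i ∧ s e i ≤ u i)
    (hbt : ∀ e ∈ E, ∀ i, l i ≤ t e i ∧ t e i ≤ u i) :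
    ∑ e ∈ E, dist (s e) (t e) ≤ 2 * ((u 0 - l 0) + (u 1 - l 1)) := by
  classical
  refine le_trans ?_ (meanPerimeter_corners_le hlu)
  set F : Finset Plane → Finset (Plane × Plane) := fun A => E.filter (· ∈ hullEdges A) with hF
  set 𝒜 := C.parts.filter fun A => (F A).Nonempty with h𝒜
  have hsum : ∑ e ∈ E, dist (s e) (t e) ≤ ∑ A ∈ 𝒜, ∑ e ∈ F A, dist (s e) (t e) := by
    rw [← Finset.sum_biUnion]
    · refine Finset.sum_le_sum_of_subset_of_nonneg ?_ fun _ _ _ => dist_nonneg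
      intro e he
      obtain ⟨A, hA, heA⟩ := hE e he
      have : e ∈ F A := Finset.mem_filter.2 ⟨he, heA⟩
      exact Finset.mem_biUnion.2 ⟨A, Finset.mem_filter.2 ⟨hA, e, this⟩, this⟩
    · intro A hA B hB hAB
      rw [Function.onFun, Finset.disjoint_left]
      intro e h1 h2
      exact hAB (C.eq_of_mem_of_mem (Finset.mem_filter.1 hA).1 (Finset.mem_filter.1 hB).1
        (mem_hullEdges.1 (Finset.mem_filter.1 h1).2).1.1
        (mem_hullEdges.1 (Finset.mem_filter.1 h2).2).1.1)
  refine hsum.trans ?_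
  have hint : ∀ A, ∫ θ in (0 : ℝ)..Real.pi,
      (width θ A - 2⁻¹ * ∑ e ∈ F A, |proj θ (s e) - proj θ (t e)|) =
      meanPerimeter A - ∑ e ∈ F A, dist (s e) (t e) := by
    intro A
    rw [intervalIntegral.integral_sub (intervalIntegrable_width A),
      intervalIntegral.integral_const_mul, intervalIntegral.integral_finsetSum
        fun e _ => intervalIntegrable_abs_proj_sub (s e) (t e)]
    · simp only [integral_abs_proj_sub, ← Finset.mul_sum]
      rw [meanPerimeter]; ring
    · exact Continuous.intervalIntegrable (continuous_const.mul
        (continuous_finsetSum _ fun e _ => continuous_abs_proj_sub (s e) (t e))) _ _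
  have hcont : ∀ A, Continuous fun θ =>
      (width θ A - 2⁻¹ * ∑ e ∈ F A, |proj θ (s e) - proj θ (t e)|) := fun A =>
    (continuous_width A).sub (continuous_const.mul
      (continuous_finsetSum _ fun e _ => continuous_abs_proj_sub (s e) (t e)))
  rcases 𝒜.eq_empty_or_nonempty with h0 | hne
  · rw [h0]; simpa using meanPerimeter_nonneg _
  -- Clusters are added one at a time to the same rectangle, whose perimeter is paid only once while
  -- each cluster saves its clipped length.
  have hstep : ∀ θ, ∀ ℬ ⊆ 𝒜, width θ (corners l u ∪ ℬ.biUnion id) ≤ width θ (corners l u) +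
      ∑ A ∈ ℬ, (width θ A - 2⁻¹ * ∑ e ∈ F A, |proj θ (s e) - proj θ (t e)|) := by
    intro θ ℬ
    induction ℬ using Finset.induction_on with
    | empty => intro _; simp
    | insert A ℬ hA ih =>
      intro hsub
      have h1 := ih fun B hB => hsub (Finset.mem_insert_of_mem hB)
      have hA𝒜 := Finset.mem_filter.1 (hsub (Finset.mem_insert_self A ℬ))
      have h2 := width_union_le_sub_clipped θ (X := corners l u ∪ ℬ.biUnion id) (A := A)
        Finset.subset_union_left (E := F A) (fun e he => (Finset.mem_filter.1 he).2) hA𝒜.2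
        (fun e he => hs e (Finset.mem_filter.1 he).1) (fun e he => ht e (Finset.mem_filter.1 he).1)
        (fun e he => hbs e (Finset.mem_filter.1 he).1)
        (fun e he => hbt e (Finset.mem_filter.1 he).1)
      rw [Finset.sum_insert hA, Finset.biUnion_insert]
      have h3 : corners l u ∪ (id A ∪ ℬ.biUnion id) = corners l u ∪ ℬ.biUnion id ∪ A := by
        simp only [id]; rw [Finset.union_assoc, Finset.union_comm A]
      rw [h3]
      linarith
  have hM : meanPerimeter (𝒜.biUnion id) ≤ meanPerimeter (corners l u) +
      ∑ A ∈ 𝒜, (meanPerimeter A - ∑ e ∈ F A, dist (s e) (t e)) := by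
    simp only [← hint]
    rw [← intervalIntegral.integral_finsetSum fun A _ => (hcont A).intervalIntegrable _ _]
    have hc2 : Continuous fun θ => ∑ A ∈ 𝒜,
        (width θ A - 2⁻¹ * ∑ e ∈ F A, |proj θ (s e) - proj θ (t e)|) :=
      continuous_finsetSum _ fun A _ => hcont A
    rw [meanPerimeter, meanPerimeter, ← intervalIntegral.integral_add (intervalIntegrable_width _)
      (hc2.intervalIntegrable _ _)]
    refine intervalIntegral.integral_mono_on Real.pi_pos.le (intervalIntegrable_width _)
      ((intervalIntegrable_width _).add (hc2.intervalIntegrable _ _)) fun θ _ => ?_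
    exact (width_mono θ Finset.subset_union_right).trans (hstep θ 𝒜 subset_rfl)
  -- The whole family is exchanged for its union; having fewer clusters is allowed.
  have hopt := hC.sum_le (𝒜 := 𝒜) (𝒩 := {𝒜.biUnion id}) (Finset.filter_subset _ _) (by
      obtain ⟨A, hA⟩ := hne
      obtain ⟨x, hx⟩ := C.nonempty_of_mem_parts (Finset.mem_filter.1 hA).1
      simp only [Finset.mem_singleton, forall_eq]
      exact ⟨x, Finset.mem_biUnion.2 ⟨A, hA, hx⟩⟩) (by simp) (by intro x; simp)
    (by rw [Finset.card_singleton]; exact hne.card_pos)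
  rw [Finset.sum_singleton] at hopt
  rw [Finset.sum_sub_distrib] at hM
  linarith

/-! ### Edges running together along a gap -/

lemma exists_ne_iff (P : Fin 3 → Prop) : ∃ m n l : Fin 3, m ≠ n ∧ m ≠ l ∧ n ≠ l ∧ (P m ↔ P n) := by
  by_cases h0 : P 0 <;> by_cases h1 : P 1 <;> by_cases h2 : P 2
  all_goals
    first
    | exact ⟨0, 1, 2, by decide, by decide, by decide, by tauto⟩
    | exact ⟨0, 2, 1, by decide, by decide, by decide, by tauto⟩
    | exact ⟨1, 2, 0, by decide, by decide, by decide, by tauto⟩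

lemma exists_mul_nonneg (g : Fin 3 → ℝ) :
    ∃ m n l : Fin 3, m ≠ n ∧ m ≠ l ∧ n ≠ l ∧ 0 ≤ g m * g n := by
  obtain ⟨m, n, l, h1, h2, h3, h⟩ := exists_ne_iff fun n => 0 ≤ g n
  refine ⟨m, n, l, h1, h2, h3, ?_⟩
  by_cases h0 : 0 ≤ g m
  · exact mul_nonneg h0 (h.1 h0)
  · exact mul_nonneg_of_nonpos_of_nonpos (by linarith) (by linarith [mt h.2 h0])

lemma exists_angle (i : Fin 2) : ∃ θ, ∀ x : Plane, proj θ x = x i := by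
  fin_cases i
  · exact ⟨0, fun x => by simp [proj_apply]⟩
  · exact ⟨Real.pi / 2, fun x => by simp [proj_apply]⟩

lemma exists_angle_neg (i : Fin 2) : ∃ θ, ∀ x : Plane, proj θ x = -x i := by
  obtain ⟨θ, h⟩ := exists_angle i
  exact ⟨θ + Real.pi, fun x => by rw [proj_add_pi, h]⟩

lemma sub_eq_smul_of_mem_segment {f : Plane →ₗ[ℝ] ℝ} {a b x y : Plane} (hab : f a < f b)
    (hx : x ∈ segment ℝ a b) (hy : y ∈ segment ℝ a b) :
    y - x = ((f y - f x) / (f b - f a)) • (b - a) := by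
  obtain ⟨s, t, -, -, hst, rfl⟩ := hx
  obtain ⟨s', t', -, -, hst', rfl⟩ := hy
  obtain rfl : s = 1 - t := by linarith
  obtain rfl : s' = 1 - t' := by linarith
  have hD : f b - f a ≠ 0 := by linarith
  simp only [map_add, map_smul, smul_eq_mul]
  have : ((1 - t') * f a + t' * f b - ((1 - t) * f a + t * f b)) / (f b - f a) = t' - t := by
    field_simp; ring
  rw [this]
  module

/-- Both segments advance in the direction φ and drift sideways in the same sense, so the
displacements have nonnegative inner product and each is at least ρ long. -/
lemma dist_le_of_coproj_mul_nonneg (φ : ℝ) {a b a' b' z z' y y' : Plane} {c ρ : ℝ} (hρ : 0 ≤ ρ)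
    (hab : proj φ a < proj φ b) (hab' : proj φ a' < proj φ b')
    (hm : 0 ≤ coproj φ (b - a) * coproj φ (b' - a')) (hz : z ∈ segment ℝ a b)
    (hz' : z' ∈ segment ℝ a' b') (hy : y ∈ segment ℝ a b) (hy' : y' ∈ segment ℝ a' b')
    (hzc : proj φ z = c) (hzc' : proj φ z' = c) (hyc : c + ρ ≤ proj φ y)
    (hyc' : c + ρ ≤ proj φ y') :
    dist y y' ≤ dist z z' + dist z y + dist z' y' - ρ / 2 := by
  have hv := sub_eq_smul_of_mem_segment hab hz hy
  have hv' := sub_eq_smul_of_mem_segment hab' hz' hy'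
  have n1 : ρ ≤ ‖y - z‖ := by
    refine le_trans ?_ (abs_proj_le_norm φ (y - z))
    rw [map_sub]
    exact le_trans (by linarith) (le_abs_self _)
  have n2 : ρ ≤ ‖y' - z'‖ := by
    refine le_trans ?_ (abs_proj_le_norm φ (y' - z'))
    rw [map_sub]
    exact le_trans (by linarith) (le_abs_self _)
  have hi : 0 ≤ (y - z) 0 * (y' - z') 0 + (y - z) 1 * (y' - z') 1 := by
    rw [inner_eq_proj φ, map_sub, map_sub]
    have h1 : 0 ≤ (proj φ y - proj φ z) * (proj φ y' - proj φ z') :=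
      mul_nonneg (by linarith) (by linarith)
    have h2 : 0 ≤ coproj φ (y - z) * coproj φ (y' - z') := by
      rw [hv, hv', map_smul, map_smul, smul_eq_mul, smul_eq_mul, mul_mul_mul_comm]
      refine mul_nonneg (mul_nonneg ?_ ?_) hm <;> apply div_nonneg <;> linarith
    linarith
  have key := norm_sub_le_of_inner_nonneg hi hρ n1 n2
  have tri : dist y y' ≤ dist z z' + ‖(y - z) - (y' - z')‖ := by
    rw [dist_eq_norm, dist_eq_norm]
    refine le_trans (le_of_eq ?_) (norm_add_le (z - z') ((y - z) - (y' - z')))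
    congr 1; abel
  rw [dist_comm z y, dist_comm z' y', dist_eq_norm y z, dist_eq_norm y' z']
  linarith

lemma hullEdges_subset_convexHull {A : Finset Plane} {e : Plane × Plane} (he : e ∈ hullEdges A) :
    segment ℝ e.1 e.2 ⊆ convexHull ℝ (A : Set Plane) :=
  have h := (mem_hullEdges.1 he).1
  (convex_convexHull ℝ _).segment_subset (subset_convexHull ℝ _ h.1) (subset_convexHull ℝ _ h.2)

namespace Clustering.IsOptimal

variable {S : Finset Plane} {C : Clustering S} {k : ℕ}

/-- Two edges of different clusters cannot run close to each other in similar directions for a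
long way. -/
lemma le_of_two_clusters (hS : Set.InjOn (fun p : Plane => p 0) (S : Set Plane))
    (hC : C.IsOptimal k) (φ : ℝ) {c ρ h : ℝ} (hρ : 0 ≤ ρ) {A B : Finset Plane} (hA : A ∈ C.parts)
    (hB : B ∈ C.parts) (hAB : A ≠ B) {a b a' b' z z' : Plane} (ha : a ∈ A) (hb : b ∈ A)
    (ha' : a' ∈ B) (hb' : b' ∈ B) (hab : proj φ a < proj φ b) (hab' : proj φ a' < proj φ b')
    (hz : z ∈ segment ℝ a b) (hz' : z' ∈ segment ℝ a' b') (hzc : proj φ z = c)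
    (hzc' : proj φ z' = c) (hbρ : c + ρ ≤ proj φ b) (hbρ' : c + ρ ≤ proj φ b')
    (hm : 0 ≤ coproj φ (b - a) * coproj φ (b' - a')) (hd : dist z z' ≤ h) : ρ ≤ 4 * h := by
  -- Replacing `a b`, `a' b'` by the bridges `a a'`, `b b'` changes the perimeter by at most 2h -
  -- ρ/2, which must be positive.
  have h1 := hC.lt_union hS hA hB hAB
  have h2 := meanPerimeter_union_le ha hb ha' hb'
  have h3 := dist_le_of_coproj_mul_nonneg φ hρ hab hab' hm hz hz' (right_mem_segment ℝ a b)
    (right_mem_segment ℝ a' b') hzc hzc' hbρ hbρ'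
  have h4 := dist_add_dist_of_mem_segment hz
  have h5 := dist_add_dist_of_mem_segment hz'
  have h6 := dist_triangle4 a z z' a'
  rw [dist_comm z' a'] at h6
  linarith

/-- A thin part of a cluster without points, close to another cluster, is short. -/
lemma le_of_strip (hC : C.IsOptimal k) (φ : ℝ) {α β c ρ h : ℝ}
    (hgap : ∀ x ∈ S, proj φ x ≤ α ∨ β ≤ proj φ x) (hα : α ≤ c) (hρ : 0 < ρ) (hβ : c + ρ ≤ β)
    {A B : Finset Plane} (hA : A ∈ C.parts) (hB : B ∈ C.parts) (hAB : A ≠ B)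
    {a b a' b' z z' ζ : Plane} (he : (a, b) ∈ hullEdges A) (he' : (b', a') ∈ hullEdges A)
    (ha : proj φ a ≤ α) (ha' : proj φ a' ≤ α) (hb : β ≤ proj φ b) (hb' : β ≤ proj φ b')
    (hz : z ∈ segment ℝ a b) (hz' : z' ∈ segment ℝ a' b') (hzc : proj φ z = c)
    (hzc' : proj φ z' = c) (hm : 0 ≤ coproj φ (b - a) * coproj φ (b' - a'))
    (hζ : ζ ∈ convexHull ℝ (B : Set Plane)) (hd : dist z z' ≤ h) (hd' : dist z ζ ≤ h) :
    ρ ≤ 12 * h := by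
  obtain ⟨⟨haA, hbA⟩, -⟩ := mem_hullEdges.1 he
  obtain ⟨⟨hbA', haA'⟩, -⟩ := mem_hullEdges.1 he'
  obtain ⟨y, hy, hyβ⟩ := exists_mem_segment_eq (proj φ) (p := a) (q := b) (t := β) (by linarith) hb
  obtain ⟨y', hy', hyβ'⟩ := exists_mem_segment_eq (proj φ) (p := a') (q := b') (t := β)
    (by linarith) hb'
  -- Since the strip contains no points, `L` and `R` partition `A`. The exchange is `A`, `B` for `L
  -- ∪ B`, `R`.
  set L := A.filter fun x => proj φ x ≤ α with hL
  set R := A.filter fun x => β ≤ proj φ x with hR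
  have haL : a ∈ L := Finset.mem_filter.2 ⟨haA, ha⟩
  have hbR : b ∈ R := Finset.mem_filter.2 ⟨hbA, hb⟩
  have split := meanPerimeter_split_le φ he he' (c := c) (β := β) (L := L) (R := R) (by linarith)
    (by linarith) (by linarith) hb hb' (Finset.filter_subset _ _) (Finset.filter_subset _ _)
    (fun x hx => by linarith [(Finset.mem_filter.1 hx).2])
    (fun x hx => (Finset.mem_filter.1 hx).2) ⟨b, hbR⟩ hz hz' hy hy' hzc hzc' hyβ hyβ'
  have bridge := dist_le_of_coproj_mul_nonneg φ hρ.le (by linarith) (by linarith) hm hz hz' hy hy'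
    hzc hzc' (by rw [hyβ]; exact hβ) (by rw [hyβ']; exact hβ)
  have near := meanPerimeter_union_le_of_near (A := insert z L) (B := B) (z := z)
    (subset_convexHull ℝ _ (by simp)) hζ
  have mono := meanPerimeter_mono (A := L ∪ B) (B := insert z L ∪ B) fun x hx =>
    subset_convexHull ℝ _ (by
      simp only [Finset.coe_union, Finset.coe_insert]
      rcases Finset.mem_union.1 hx with hx | hx
      · exact Or.inl (Or.inr hx)
      · exact Or.inr hx)
  have hdisj : ∀ x ∈ A, x ∉ B := fun x hx hx' => hAB (C.eq_of_mem_of_mem hA hB hx hx')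
  have hLR : L ∪ B ≠ R := by
    intro h'
    have : a ∈ R := h' ▸ Finset.mem_union_left _ haL
    linarith [(Finset.mem_filter.1 this).2]
  have opt := hC.sum_le (𝒜 := {A, B}) (𝒩 := {L ∪ B, R}) (by simp [Finset.insert_subset_iff, hA, hB])
    (by
      simp only [Finset.mem_insert, Finset.mem_singleton, forall_eq_or_imp, forall_eq]
      exact ⟨⟨a, Finset.mem_union_left _ haL⟩, ⟨b, hbR⟩⟩)
    (pairwiseDisjoint_pair (by
      rw [Finset.disjoint_left]
      intro x hx hxR
      have hxR := Finset.mem_filter.1 hxR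
      rcases Finset.mem_union.1 hx with hx | hx
      · linarith [(Finset.mem_filter.1 hx).2, hxR.2]
      · exact hdisj x hxR.1 hx)) (by
      intro x
      simp only [Finset.mem_insert, Finset.mem_singleton, exists_eq_or_imp, exists_eq_left,
        Finset.mem_union, hL, hR, Finset.mem_filter]
      constructor
      · tauto
      · rintro (hx | hx)
        · rcases hgap x (C.subset_of_mem_parts hA hx) with h' | h' <;> tauto
        · tauto) (by rw [Finset.card_pair hAB]; exact Finset.card_le_two)
  rw [Finset.sum_pair hAB, Finset.sum_pair hLR] at opt
  -- Cutting costs at most 4h - ρ/2 by `split`, `bridge` and this inequality, and attaching the left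
  -- piece to `B` costs 2h. Optimality gives 0 ≤ 6h - ρ/2.
  have tri := dist_triangle z' z y'
  rw [dist_comm z' z] at tri
  linarith

/-- At most two edges of a clustering can run together along a long gap. -/
lemma gap_le (hS : Set.InjOn (fun p : Plane => p 0) (S : Set Plane)) (hC : C.IsOptimal k) (φ : ℝ)
    {α β c ρ h : ℝ} (hgap : ∀ x ∈ S, proj φ x ≤ α ∨ β ≤ proj φ x) (hα : α ≤ c) (hρ : 0 < ρ)
    (hβ : c + ρ ≤ β) {e : Fin 3 → Plane × Plane} (he : Function.Injective e)
    (heC : ∀ n, e n ∈ C.edges)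
    (hspan : ∀ n, proj φ (e n).1 ≤ α ∧ β ≤ proj φ (e n).2 ∨ proj φ (e n).2 ≤ α ∧ β ≤ proj φ (e n).1)
    {z : Fin 3 → Plane} (hz : ∀ n, z n ∈ segment ℝ (e n).1 (e n).2) (hzc : ∀ n, proj φ (z n) = c)
    (hd : ∀ m n, dist (z m) (z n) ≤ h) : ρ ≤ 12 * h := by
  have h0 : 0 ≤ h := dist_nonneg.trans (hd 0 0)
  choose A hA heA using heC
  have hab : ∀ n, ∃ a b, (e n = (a, b) ∨ e n = (b, a)) ∧ proj φ a ≤ α ∧ β ≤ proj φ b := by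
    intro n
    rcases hspan n with h' | h'
    · exact ⟨_, _, Or.inl rfl, h'⟩
    · exact ⟨_, _, Or.inr rfl, h'⟩
  choose a b hor ha hb using hab
  have hmem : ∀ n, a n ∈ A n ∧ b n ∈ A n := by
    intro n
    have := (mem_hullEdges.1 (heA n)).1
    rcases hor n with h' | h' <;> rw [h'] at this
    exacts [this, this.symm]
  have hzs : ∀ n, z n ∈ segment ℝ (a n) (b n) := by
    intro n
    have := hz n
    rcases hor n with h' | h' <;> rw [h'] at this
    · exact this
    · exact segment_symm ℝ (b n) (a n) ▸ this
  -- Two of the three edges drift sideways in the same sense. Either they belong to different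
  -- clusters or they bound a strip of one cluster.
  obtain ⟨m, n, l, hmn, hml, hnl, hpos⟩ := exists_mul_nonneg fun n => coproj φ (b n - a n)
  by_cases hAmn : A m = A n
  swap
  · have := hC.le_of_two_clusters hS φ hρ.le (hA m) (hA n) hAmn (hmem m).1 (hmem m).2 (hmem n).1
      (hmem n).2 (by linarith [ha m, hb m]) (by linarith [ha n, hb n]) (hzs m) (hzs n) (hzc m)
      (hzc n) (hβ.trans (hb m)) (hβ.trans (hb n)) hpos (hd m n)
    linarith
  have up : ∀ i j, A i = A j → e i = (a i, b i) → e j = (a j, b j) → i = j := by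
    intro i j hij hi hj
    apply he
    refine hullEdge_unique φ (heA i) (hij ▸ heA j) (t := (α + β) / 2) ?_ ?_ ?_ ?_ <;>
      simp only [hi, hj] <;> linarith [ha i, ha j, hb i, hb j]
  have down : ∀ i j, A i = A j → e i = (b i, a i) → e j = (b j, a j) → i = j := by
    intro i j hij hi hj
    apply he
    refine hullEdge_unique (φ + Real.pi) (heA i) (hij ▸ heA j) (t := -((α + β) / 2)) ?_ ?_ ?_ ?_ <;>
      simp only [hi, hj, proj_add_pi] <;> linarith [ha i, ha j, hb i, hb j]
  -- A polygon has at most one ascending and one descending edge across the strip, so the third edge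
  -- belongs to a neighbouring cluster.
  have hAl : A m ≠ A l := by
    intro h'
    rcases hor m with h1 | h1 <;> rcases hor n with h2 | h2 <;> rcases hor l with h3 | h3
    · exact hmn (up m n hAmn h1 h2)
    · exact hmn (up m n hAmn h1 h2)
    · exact hml (up m l h' h1 h3)
    · exact hnl (down n l (hAmn ▸ h') h2 h3)
    · exact hnl (up n l (hAmn ▸ h') h2 h3)
    · exact hml (down m l h' h1 h3)
    · exact hmn (down m n hAmn h1 h2)
    · exact hmn (down m n hAmn h1 h2)
  have hζ : z l ∈ convexHull ℝ (A l : Set Plane) := hullEdges_subset_convexHull (heA l) (hz l)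
  have em := heA m
  have en := heA n
  rcases hor m with h1 | h1 <;> rcases hor n with h2 | h2
  · exact absurd (up m n hAmn h1 h2) hmn
  · rw [h1] at em
    rw [h2, ← hAmn] at en
    exact hC.le_of_strip φ hgap hα hρ hβ (hA m) (hA l) hAl em en (ha m) (ha n) (hb m) (hb n)
      (hzs m) (hzs n) (hzc m) (hzc n) hpos hζ (hd m n) (hd m l)
  · rw [h1, hAmn] at em
    rw [h2] at en
    rw [hAmn] at hAl
    exact hC.le_of_strip φ hgap hα hρ hβ (hA n) (hA l) hAl en em (ha n) (ha m) (hb n) (hb m)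
      (hzs n) (hzs m) (hzc n) (hzc m) (by rwa [mul_comm]) hζ (hd n m) (hd n l)
  · exact absurd (down m n hAmn h1 h2) hmn

end Clustering.IsOptimal

/-! ### Three edges through a small region -/

lemma orient_rotate (p q r : Plane) : orient q r p = orient p q r := by
  simp only [orient]; ring

lemma orient_swap (p q r : Plane) : orient p r q = -orient p q r := by
  simp only [orient]; ring

/-- No three extreme points are collinear. -/
lemma orient_ne_zero {A : Finset Plane}
    (hinj : Set.InjOn (fun p : Plane => p 0) (A : Set Plane)) {p q r : Plane} (hpA : p ∈ A)
    (hqA : q ∈ A) (hrA : r ∈ A) (hp : p ∈ (convexHull ℝ (A : Set Plane)).extremePoints ℝ)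
    (hq : q ∈ (convexHull ℝ (A : Set Plane)).extremePoints ℝ)
    (hr : r ∈ (convexHull ℝ (A : Set Plane)).extremePoints ℝ) (hpq : p ≠ q) (hpr : p ≠ r)
    (hqr : q ≠ r) : orient p q r ≠ 0 := by
  intro h0
  have aux : ∀ {x y w : Plane}, x ∈ A → y ∈ A → w ∈ (convexHull ℝ (A : Set Plane)).extremePoints ℝ →
      orient x y w = 0 → ¬ (proj 0 x < proj 0 w ∧ proj 0 w < proj 0 y) := by
    rintro x y w hx hy hw h ⟨h1, h2⟩
    exact notMem_openSegment_of_mem_extremePoints hw (subset_convexHull ℝ _ hx)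
      (subset_convexHull ℝ _ hy) (by rintro rfl; exact h1.false)
      (mem_openSegment_of_orient_eq_zero 0 h h1 h2)
  have o1 : orient q r p = 0 := by rw [orient_rotate, h0]
  have o2 : orient r p q = 0 := by rw [orient_rotate, o1]
  have o3 : orient q p r = 0 := by rw [orient_swap, o1, neg_zero]
  have o4 : orient p r q = 0 := by rw [orient_swap, h0, neg_zero]
  have o5 : orient r q p = 0 := by rw [orient_swap, o2, neg_zero]
  have n : ∀ x ∈ A, ∀ y ∈ A, x ≠ y → proj 0 x < proj 0 y ∨ proj 0 y < proj 0 x := by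
    intro x hx y hy hxy
    apply lt_or_gt_of_ne
    simp only [Clustering.proj_zero_apply]
    exact fun h => hxy (hinj hx hy h)
  have b1 := aux hpA hqA hr h0
  have b2 := aux hqA hrA hp o1
  have b3 := aux hrA hpA hq o2
  have b4 := aux hqA hpA hr o3
  have b5 := aux hpA hrA hq o4
  have b6 := aux hrA hqA hp o5
  rcases n p hpA q hqA hpq with h1 | h1 <;> rcases n p hpA r hrA hpr with h2 | h2 <;>
    rcases n q hqA r hrA hqr with h3 | h3 <;> tauto

/-- At most two hull edges of a polygon pass through a given point. -/
lemma not_three_hullEdges_through {A : Finset Plane}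
    (hinj : Set.InjOn (fun p : Plane => p 0) (A : Set Plane)) {e : Fin 3 → Plane × Plane}
    (he : Function.Injective e) (heA : ∀ n, e n ∈ hullEdges A) {z : Plane}
    (hz : ∀ n, z ∈ segment ℝ (e n).1 (e n).2) : False := by
  have hmem := fun n => mem_hullEdges.1 (heA n)
  have sub : ∀ x ∈ A, x ∈ convexHull ℝ (A : Set Plane) := fun x hx => subset_convexHull ℝ _ hx
  have loop : ∀ n, (e n).1 ≠ (e n).2 := by
    intro n hn
    have hA := (hmem n).2.2.2.1.resolve_left (fun h => h hn)
    have all : ∀ j, e j = ((e n).1, (e n).1) := by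
      intro j
      have := (hmem j).1
      rw [hA, Finset.mem_singleton, Finset.mem_singleton] at this
      exact Prod.ext this.1 this.2
    exact absurd (he ((all 0).trans (all 1).symm)) (by decide)
  have hne : ∀ n, proj 0 (e n).1 ≠ proj 0 (e n).2 := by
    intro n h
    rw [Clustering.proj_zero_apply, Clustering.proj_zero_apply] at h
    exact loop n (hinj (hmem n).1.1 (hmem n).1.2 h)
  by_cases hext : z ∈ (convexHull ℝ (A : Set Plane)).extremePoints ℝ
  · have hend : ∀ n, z = (e n).1 ∨ z = (e n).2 := by
      intro n
      by_contra! hcon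
      have := mem_openSegment_of_ne_left_right hcon.1.symm hcon.2.symm (hz n)
      exact notMem_openSegment_of_mem_extremePoints hext (sub _ (hmem n).1.1) (sub _ (hmem n).1.2)
        hcon.1.symm this
    -- Two of the edges both leave `z` or both enter it. The other end of each lies weakly left of
    -- the other edge, which forces three collinear extreme points.
    obtain ⟨m, n, -, hmn, -, -, h⟩ := exists_ne_iff fun n => z = (e n).1
    have hemn : e m ≠ e n := he.ne hmn
    by_cases hm : z = (e m).1
    · have hn := h.1 hm
      have h2 : (e m).2 ≠ (e n).2 := fun h2 => hemn (Prod.ext (hm.symm.trans hn) h2)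
      have o1 := (hmem m).2.2.2.2 _ (hmem n).1.2
      have o2 := (hmem n).2.2.2.2 _ (hmem m).1.2
      rw [← hm] at o1
      rw [← hn, orient_swap] at o2
      refine orient_ne_zero hinj (hm ▸ (hmem m).1.1) (hmem m).1.2 (hmem n).1.2 hext (hmem m).2.2.1
        (hmem n).2.2.1 (by rw [hm]; exact loop m) (by rw [hn]; exact loop n) h2 (by linarith)
    · have hm' := (hend m).resolve_left hm
      have hn' := (hend n).resolve_left fun h' => hm (h.2 h')
      have h2 : (e m).1 ≠ (e n).1 := fun h2 => hemn (Prod.ext h2 (hm'.symm.trans hn'))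
      have o1 := (hmem m).2.2.2.2 _ (hmem n).1.1
      have o2 := (hmem n).2.2.2.2 _ (hmem m).1.1
      rw [← hm', ← orient_rotate, orient_swap] at o1
      rw [← hn', ← orient_rotate] at o2
      refine orient_ne_zero hinj (hm' ▸ (hmem m).1.2) (hmem m).1.1 (hmem n).1.1 hext (hmem m).2.1
        (hmem n).2.1 (by rw [hm']; exact (loop m).symm) (by rw [hn']; exact (loop n).symm) h2
        (by linarith)
  · have hopen : ∀ n, z ∈ openSegment ℝ (e n).1 (e n).2 := by
      intro n
      refine mem_openSegment_of_ne_left_right ?_ ?_ (hz n)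
      · intro h; exact hext (h ▸ (hmem n).2.1)
      · intro h; exact hext (h ▸ (hmem n).2.2.1)
    have hstrict : ∀ n θ, proj θ (e n).1 < proj θ (e n).2 →
        proj θ (e n).1 < proj θ z ∧ proj θ z < proj θ (e n).2 := by
      intro n θ hlt
      obtain ⟨s, t, hs, ht, hst, hz⟩ := hopen n
      obtain rfl : s = 1 - t := by linarith
      rw [← hz]
      simp only [map_add, map_smul, smul_eq_mul]
      constructor <;> nlinarith
    obtain ⟨m, n, -, hmn, -, -, h⟩ := exists_ne_iff fun n => proj 0 (e n).1 < proj 0 (e n).2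
    by_cases hm : proj 0 (e m).1 < proj 0 (e m).2
    · have h1 := hstrict m 0 hm
      have h2 := hstrict n 0 (h.1 hm)
      exact hmn (he (hullEdge_unique 0 (heA m) (heA n) h1.1 h1.2 h2.1 h2.2))
    · have hm' := lt_of_le_of_ne (not_lt.1 hm) (hne m).symm
      have hn' := lt_of_le_of_ne (not_lt.1 (mt h.2 hm)) (hne n).symm
      have h1 := hstrict m (0 + Real.pi) (by simpa only [proj_add_pi, neg_lt_neg_iff] using hm')
      have h2 := hstrict n (0 + Real.pi) (by simpa only [proj_add_pi, neg_lt_neg_iff] using hn')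
      exact hmn (he (hullEdge_unique (0 + Real.pi) (heA m) (heA n) h1.1 h1.2 h2.1 h2.2))

/-- The edge `e` reaches across the interval `[a, b]` in the `i`-th coordinate. -/
def Spans (e : Plane × Plane) (i : Fin 2) (a b : ℝ) : Prop :=
  (e.1 i ≤ a ∧ b ≤ e.2 i) ∨ (e.2 i ≤ a ∧ b ≤ e.1 i)

lemma abs_apply_le_norm (v : Plane) (i : Fin 2) : |v i| ≤ ‖v‖ := by
  obtain ⟨θ, h⟩ := exists_angle i
  rw [← h]
  exact abs_proj_le_norm θ v

lemma dist_le_abs_add_abs (z w : Plane) : dist z w ≤ |z 0 - w 0| + |z 1 - w 1| := by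
  rw [dist_eq_norm]
  exact norm_le_abs_add_abs (z - w)

lemma dist_le_of_mul_nonneg {b d z z' : Plane} {ρ : ℝ} (hρ : 0 ≤ ρ) (i : Fin 2)
    (hm : ∀ j, 0 ≤ (b j - z j) * (d j - z' j)) (hb : ρ ≤ |b i - z i|) (hd : ρ ≤ |d i - z' i|) :
    dist b d ≤ dist z b + dist z' d - ρ / 2 + dist z z' := by
  have h := norm_sub_le_of_inner_nonneg (v := b - z) (w := d - z') (ρ := ρ)
    (by simpa using add_nonneg (hm 0) (hm 1)) hρ
    (hb.trans (by simpa using abs_apply_le_norm (b - z) i))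
    (hd.trans (by simpa using abs_apply_le_norm (d - z') i))
  rw [← dist_eq_norm b z, ← dist_eq_norm d z', dist_comm b z, dist_comm d z'] at h
  have h2 : b - d = (b - z - (d - z')) + (z - z') := by abel
  rw [dist_eq_norm b d, h2, dist_eq_norm z z']
  linarith [norm_add_le (b - z - (d - z')) (z - z')]

namespace Clustering

variable {S : Finset Plane}

/-- Both edges are monotone in the same sense in both coordinates. In the direction of the longest
gap G they run together for 19999/20000 of G, saving half of that, while the bridges cost twice
`dist z z'`, at most 4G/20000. -/
lemma IsOptimal.false_of_comonotone (hS : Set.InjOn (fun p : Plane => p 0) (S : Set Plane))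
    {C : Clustering S} {k : ℕ} (hC : C.IsOptimal k) {A B : Finset Plane} (hA : A ∈ C.parts)
    (hB : B ∈ C.parts) (hAB : A ≠ B) {a b c d z z' : Plane} (ha : a ∈ A) (hb : b ∈ A) (hc : c ∈ B)
    (hd : d ∈ B) (hz : z ∈ segment ℝ a b) (hz' : z' ∈ segment ℝ c d) {x₀ x₁ l u : Fin 2 → ℝ}
    (hl : ∀ i, x₀ i ≤ l i) (hu : ∀ i, u i ≤ x₁ i)
    (hw : ∀ i, u i - l i ≤ (x₁ i - x₀ i) / 20000) (hzl : ∀ i, l i ≤ z i) (hzu : ∀ i, z i ≤ u i)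
    (hzl' : ∀ i, l i ≤ z' i) (hzu' : ∀ i, z' i ≤ u i)
    (hs : ∀ i, (a i ≤ x₀ i ∧ c i ≤ x₀ i ∧ x₁ i ≤ b i ∧ x₁ i ≤ d i) ∨
      (b i ≤ x₀ i ∧ d i ≤ x₀ i ∧ x₁ i ≤ a i ∧ x₁ i ≤ c i)) : False := by
  obtain ⟨i, hi⟩ : ∃ i : Fin 2, ∀ j, x₁ j - x₀ j ≤ x₁ i - x₀ i := by
    rcases le_total (x₁ 0 - x₀ 0) (x₁ 1 - x₀ 1) with h | h
    · exact ⟨1, fun j => by fin_cases j <;> simp [h]⟩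
    · exact ⟨0, fun j => by fin_cases j <;> simp [h]⟩
  obtain ⟨ρ, σ, hρ, hσ, hsum, hbz, hdz, haz, hcz⟩ : ∃ ρ σ : ℝ, 0 ≤ ρ ∧ 0 ≤ σ ∧
      (x₁ i - x₀ i) * (19999 / 20000) ≤ ρ + σ ∧ ρ ≤ |b i - z i| ∧ ρ ≤ |d i - z' i| ∧
      σ ≤ |a i - z i| ∧ σ ≤ |c i - z' i| := by
    have := hl i; have := hu i; have := hw i; have := hzl i; have := hzu i; have := hzl' i
    have := hzu' i
    rcases hs i with h | h
    · refine ⟨x₁ i - u i, l i - x₀ i, by linarith, by linarith, by linarith, ?_, ?_, ?_, ?_⟩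
      · exact le_trans (by linarith) (le_abs_self _)
      · exact le_trans (by linarith) (le_abs_self _)
      · exact le_trans (by linarith) (neg_le_abs _)
      · exact le_trans (by linarith) (neg_le_abs _)
    · refine ⟨l i - x₀ i, x₁ i - u i, by linarith, by linarith, by linarith, ?_, ?_, ?_, ?_⟩
      · exact le_trans (by linarith) (neg_le_abs _)
      · exact le_trans (by linarith) (neg_le_abs _)
      · exact le_trans (by linarith) (le_abs_self _)
      · exact le_trans (by linarith) (le_abs_self _)
  have h1 := dist_le_of_mul_nonneg (b := b) (d := d) (z := z) (z' := z') hρ i (fun j => by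
    have := hl j; have := hu j; have := hzl j; have := hzu j; have := hzl' j; have := hzu' j
    rcases hs j with h | h
    · exact mul_nonneg (by linarith) (by linarith)
    · exact mul_nonneg_of_nonpos_of_nonpos (by linarith) (by linarith)) hbz hdz
  have h2 := dist_le_of_mul_nonneg (b := a) (d := c) (z := z) (z' := z') hσ i (fun j => by
    have := hl j; have := hu j; have := hzl j; have := hzu j; have := hzl' j; have := hzu' j
    rcases hs j with h | h
    · exact mul_nonneg_of_nonpos_of_nonpos (by linarith) (by linarith)
    · exact mul_nonneg (by linarith) (by linarith)) haz hcz
  have hzz : dist z z' ≤ 2 * ((x₁ i - x₀ i) / 20000) := by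
    refine (dist_le_abs_add_abs z z').trans ?_
    have key : ∀ j, |z j - z' j| ≤ (x₁ i - x₀ i) / 20000 := fun j => by
      rw [abs_le]
      constructor <;> linarith [hw j, hi j, hzl j, hzu j, hzl' j, hzu' j]
    linarith [key 0, key 1]
  have h3 := dist_add_dist_of_mem_segment hz
  have h4 := dist_add_dist_of_mem_segment hz'
  have h5 := hC.lt_union hS hA hB hAB
  have h6 := meanPerimeter_union_le ha hb hc hd
  rw [dist_comm a z] at h3
  rw [dist_comm c z'] at h4
  have : 0 ≤ x₁ i - x₀ i := by linarith [hl i, hu i, hzl i, hzu i]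
  linarith

/-- One edge ascends below-left and above-right of `z'`, the other descends above-left and
below-right of `z`. In each quadrant of directions one of these ends shows that the projections
overlap, so merging would be free. -/
lemma IsOptimal.false_of_antitone (hS : Set.InjOn (fun p : Plane => p 0) (S : Set Plane))
    {C : Clustering S} {k : ℕ} (hC : C.IsOptimal k) {A B : Finset Plane} (hA : A ∈ C.parts)
    (hB : B ∈ C.parts) (hAB : A ≠ B) {a b c d z z' : Plane} (ha : a ∈ A) (hb : b ∈ A) (hc : c ∈ B)
    (hd : d ∈ B) (hz : z ∈ convexHull ℝ (A : Set Plane)) (hz' : z' ∈ convexHull ℝ (B : Set Plane))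
    (haz : ∀ i, a i ≤ z' i) (hbz : ∀ i, z' i ≤ b i) (hc0 : c 0 ≤ z 0) (hc1 : z 1 ≤ c 1)
    (hd0 : z 0 ≤ d 0) (hd1 : d 1 ≤ z 1) : False := by
  have hh : ∀ {X : Finset Plane} {x : Plane}, x ∈ X → x ∈ convexHull ℝ (X : Set Plane) :=
    fun hx => subset_convexHull ℝ _ (mem_coe.2 hx)
  refine (hC.lt_union hS hA hB hAB).not_ge (meanPerimeter_union_le_of_overlap fun θ => ?_)
  simp only [proj_apply]
  rcases le_total 0 (Real.cos θ) with h0 | h0 <;> rcases le_total 0 (Real.sin θ) with h1 | h1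
  · exact ⟨a, hh ha, z', hz', add_le_add (mul_le_mul_of_nonneg_right (haz 0) h0)
      (mul_le_mul_of_nonneg_right (haz 1) h1)⟩
  · exact ⟨z, hz, d, hh hd, add_le_add (mul_le_mul_of_nonneg_right hd0 h0)
      (mul_le_mul_of_nonpos_right hd1 h1)⟩
  · exact ⟨z, hz, c, hh hc, add_le_add (mul_le_mul_of_nonpos_right hc0 h0)
      (mul_le_mul_of_nonneg_right hc1 h1)⟩
  · exact ⟨b, hh hb, z', hz', add_le_add (mul_le_mul_of_nonpos_right (hbz 0) h0)
      (mul_le_mul_of_nonpos_right (hbz 1) h1)⟩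

lemma exists_ends_of_spans {A : Finset Plane} {e : Plane × Plane} (he : e ∈ hullEdges A)
    {x₀ x₁ : Fin 2 → ℝ} (hs : ∀ i, Spans e i (x₀ i) (x₁ i)) {z : Plane}
    (hz : z ∈ segment ℝ e.1 e.2) : ∃ a ∈ A, ∃ b ∈ A, z ∈ segment ℝ a b ∧ a 0 ≤ x₀ 0 ∧ x₁ 0 ≤ b 0 ∧
      ((a 1 ≤ x₀ 1 ∧ x₁ 1 ≤ b 1) ∨ (b 1 ≤ x₀ 1 ∧ x₁ 1 ≤ a 1)) := by
  obtain ⟨⟨h1, h2⟩, -⟩ := mem_hullEdges.1 he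
  rcases hs 0 with h | h
  · exact ⟨e.1, h1, e.2, h2, hz, h.1, h.2, hs 1⟩
  · exact ⟨e.2, h2, e.1, h1, segment_symm ℝ e.1 e.2 ▸ hz, h.1, h.2, (hs 1).symm⟩

lemma IsOptimal.eq_part_of_spans (hS : Set.InjOn (fun p : Plane => p 0) (S : Set Plane))
    {C : Clustering S} {k : ℕ} (hC : C.IsOptimal k) {A B : Finset Plane} (hA : A ∈ C.parts)
    (hB : B ∈ C.parts) {e f : Plane × Plane} (he : e ∈ hullEdges A) (hf : f ∈ hullEdges B)
    {x₀ x₁ l u : Fin 2 → ℝ} (hl : ∀ i, x₀ i ≤ l i) (hu : ∀ i, u i ≤ x₁ i)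
    (hw : ∀ i, u i - l i ≤ (x₁ i - x₀ i) / 20000) (hse : ∀ i, Spans e i (x₀ i) (x₁ i))
    (hsf : ∀ i, Spans f i (x₀ i) (x₁ i)) {z z' : Plane} (hz : z ∈ segment ℝ e.1 e.2)
    (hz' : z' ∈ segment ℝ f.1 f.2) (hzl : ∀ i, l i ≤ z i) (hzu : ∀ i, z i ≤ u i)
    (hzl' : ∀ i, l i ≤ z' i) (hzu' : ∀ i, z' i ≤ u i) : A = B := by
  by_contra hAB
  have hzA := hullEdges_subset_convexHull he hz
  have hzB := hullEdges_subset_convexHull hf hz'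
  obtain ⟨a, ha, b, hb, hab, ha0, hb0, h1⟩ := exists_ends_of_spans he hse hz
  obtain ⟨c, hc, d, hd, hcd, hc0, hd0, h2⟩ := exists_ends_of_spans hf hsf hz'
  have z0 := (hl 0).trans (hzl 0)
  have z1 := (hl 1).trans (hzl 1)
  have z2 := (hzu 0).trans (hu 0)
  have z3 := (hzu 1).trans (hu 1)
  have z0' := (hl 0).trans (hzl' 0)
  have z1' := (hl 1).trans (hzl' 1)
  have z2' := (hzu' 0).trans (hu 0)
  have z3' := (hzu' 1).trans (hu 1)
  rcases h1 with h1 | h1 <;> rcases h2 with h2 | h2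
  · exact hC.false_of_comonotone hS hA hB hAB ha hb hc hd hab hcd hl hu hw hzl hzu hzl' hzu'
      (Fin.forall_fin_two.2 ⟨Or.inl ⟨ha0, hc0, hb0, hd0⟩, Or.inl ⟨h1.1, h2.1, h1.2, h2.2⟩⟩)
  · exact hC.false_of_antitone hS hA hB hAB ha hb hc hd hzA hzB
      (Fin.forall_fin_two.2 ⟨by linarith, by linarith⟩)
      (Fin.forall_fin_two.2 ⟨by linarith, by linarith⟩) (by linarith) (by linarith) (by linarith)
      (by linarith)
  · exact hC.false_of_antitone hS hB hA (Ne.symm hAB) hc hd ha hb hzB hzA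
      (Fin.forall_fin_two.2 ⟨by linarith, by linarith⟩)
      (Fin.forall_fin_two.2 ⟨by linarith, by linarith⟩) (by linarith) (by linarith) (by linarith)
      (by linarith)
  · exact hC.false_of_comonotone hS hA hB hAB ha hb hc hd hab hcd hl hu hw hzl hzu hzl' hzu'
      (Fin.forall_fin_two.2 ⟨Or.inl ⟨ha0, hc0, hb0, hd0⟩, Or.inr ⟨h1.1, h2.1, h1.2, h2.2⟩⟩)

/-- All three edges must belong to one cluster by `eq_part_of_spans`. -/
lemma IsOptimal.not_three_spans (hS : Set.InjOn (fun p : Plane => p 0) (S : Set Plane))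
    {C : Clustering S} {k : ℕ} (hC : C.IsOptimal k) {e : Fin 3 → Plane × Plane}
    (he : Function.Injective e) (heC : ∀ n, e n ∈ C.edges)
    {x₀ x₁ l u : Fin 2 → ℝ} (hl : ∀ i, x₀ i ≤ l i) (hu : ∀ i, u i ≤ x₁ i)
    (hw : ∀ i, u i - l i ≤ (x₁ i - x₀ i) / 20000) (hs : ∀ n i, Spans (e n) i (x₀ i) (x₁ i))
    {z : Fin 3 → Plane} (hz : ∀ n, z n ∈ segment ℝ (e n).1 (e n).2) (hzl : ∀ n i, l i ≤ z n i)
    (hzu : ∀ n i, z n i ≤ u i) : False := by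
  choose A hA heA using heC
  have hAA : ∀ n, A n = A 0 := fun n => hC.eq_part_of_spans hS (hA n) (hA 0) (heA n) (heA 0) hl hu hw
    (hs n) (hs 0) (hz n) (hz 0) (hzl n) (hzu n) (hzl 0) (hzu 0)
  simp only [hAA] at heA
  -- If some gap is nondegenerate, two edges cross its middle line in the same sense. Otherwise the
  -- region is a single actual point.
  by_cases hi : ∃ i, x₀ i < x₁ i
  · obtain ⟨i, hi⟩ := hi
    obtain ⟨m, n, -, hmn, -, -, h⟩ := exists_ne_iff fun n => (e n).1 i ≤ x₀ i ∧ x₁ i ≤ (e n).2 i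
    refine hmn (he ?_)
    by_cases hm : (e m).1 i ≤ x₀ i ∧ x₁ i ≤ (e m).2 i
    · obtain ⟨θ, hθ⟩ := exists_angle i
      have hn := h.1 hm
      refine hullEdge_unique θ (heA m) (heA n) (t := (x₀ i + x₁ i) / 2) ?_ ?_ ?_ ?_ <;>
        rw [hθ] <;> linarith
    · obtain ⟨θ, hθ⟩ := exists_angle_neg i
      have hm' := (hs m i).resolve_left hm
      have hn' := (hs n i).resolve_left (mt h.2 hm)
      refine hullEdge_unique θ (heA m) (heA n) (t := -((x₀ i + x₁ i) / 2)) ?_ ?_ ?_ ?_ <;>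
        rw [hθ] <;> linarith
  · push Not at hi
    have hzz : ∀ n, z n = z 0 := fun n => by
      ext i
      linarith [hi i, hl i, hu i, hzl n i, hzu n i, hzl 0 i, hzu 0 i]
    refine not_three_hullEdges_through (A := A 0) (hS.mono ?_) he heA (z := z 0) fun n =>
      hzz n ▸ hz n
    exact_mod_cast C.subset_of_mem_parts (hA 0)

end Clustering

/-! ### Formal positions, gaps and grid lines -/

lemma pos_le_iff {c d : Pos} : c ≤ d ↔ (ofLex c).1 < (ofLex d).1 ∨
    (ofLex c).1 = (ofLex d).1 ∧ (ofLex c).2 ≤ (ofLex d).2 := Prod.Lex.le_iff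

lemma pos_lt_iff {c d : Pos} : c < d ↔ (ofLex c).1 < (ofLex d).1 ∨
    (ofLex c).1 = (ofLex d).1 ∧ (ofLex c).2 < (ofLex d).2 := Prod.Lex.lt_iff

lemma coord_le_of_le {c d : Pos} (h : c ≤ d) : (ofLex c).1 ≤ (ofLex d).1 := by
  rcases pos_le_iff.1 h with h | h
  · exact h.le
  · exact h.1.le

lemma le_toLex_neg_one {c : Pos} {b : ℝ} (h : c ≤ toLex (b, -1)) :
    (ofLex c).1 < b ∨ (ofLex c).1 = b ∧ (ofLex c).2 = -1 := by
  rcases pos_le_iff.1 h with h | ⟨h, h'⟩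
  · exact Or.inl h
  · exact Or.inr ⟨h, le_antisymm h' (SignType.neg_one_le _)⟩

lemma toLex_one_le {c : Pos} {a : ℝ} (h : toLex (a, 1) ≤ c) :
    a < (ofLex c).1 ∨ (ofLex c).1 = a ∧ (ofLex c).2 = 1 := by
  rcases pos_le_iff.1 h with h | ⟨h, h'⟩
  · exact Or.inl h
  · exact Or.inr ⟨h.symm, le_antisymm (SignType.le_one _) h'⟩

lemma coord_mem_Icc {e : Plane × Plane} {x : Plane} (hx : x ∈ segment ℝ e.1 e.2) (i : Fin 2) :
    (e.1 i ≤ x i ∧ x i ≤ e.2 i) ∨ (e.2 i ≤ x i ∧ x i ≤ e.1 i) := by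
  obtain ⟨θ, h⟩ := exists_angle i
  simp only [← h]
  rcases le_total (proj θ e.1) (proj θ e.2) with h' | h'
  · exact Or.inl ⟨ge_of_mem_segment _ hx le_rfl h', le_of_mem_segment _ hx h' le_rfl⟩
  · exact Or.inr ⟨ge_of_mem_segment _ hx h' le_rfl, le_of_mem_segment _ hx le_rfl h'⟩

/-- `a < b` are consecutive `i`-th coordinates of points of `S`. -/
structure IsGap (S : Finset Plane) (i : Fin 2) (a b : ℝ) : Prop where
  lt : a < b
  left_mem : ∃ p ∈ S, p i = a
  right_mem : ∃ q ∈ S, q i = b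
  le_or_le : ∀ r ∈ S, r i ≤ a ∨ b ≤ r i

/-- Between the main lines just inside the gap, the edge has a point with coordinate greater than
`a` and one with coordinate less than `b`, the formal displacement supplying it if the actual point
is on the border. Its ends avoid the open gap, so they lie on opposite sides. -/
lemma IsGap.spans {S : Finset Plane} {i : Fin 2} {a b : ℝ} (h : IsGap S i a b) {e : Plane × Plane}
    (h1 : e.1 ∈ S) (h2 : e.2 ∈ S) {P : FormalPoint} (hP : P ∈ edgeTrace e)
    (ha : toLex (a, 1) ≤ P i) (hb : P i ≤ toLex (b, -1)) : Spans e i a b := by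
  obtain ⟨z, hz, w, hw, hzw⟩ := hP
  obtain ⟨hz1, hz2⟩ := hzw i
  have hx : ∃ x ∈ segment ℝ e.1 e.2, a < x i := by
    rcases toLex_one_le ha with h | ⟨h, h'⟩
    · exact ⟨z, hz, hz1 ▸ h⟩
    · rw [h'] at hz2
      have := sign_eq_one_iff.1 (hz2.resolve_left (by decide)).symm
      exact ⟨w, hw, by linarith⟩
  have hy : ∃ y ∈ segment ℝ e.1 e.2, y i < b := by
    rcases le_toLex_neg_one hb with h | ⟨h, h'⟩
    · exact ⟨z, hz, hz1 ▸ h⟩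
    · rw [h'] at hz2
      have := sign_eq_neg_one_iff.1 (hz2.resolve_left (by decide)).symm
      exact ⟨w, hw, by linarith⟩
  obtain ⟨x, hx, hax⟩ := hx
  obtain ⟨y, hy, hyb⟩ := hy
  have hx := coord_mem_Icc hx i
  have hy := coord_mem_Icc hy i
  unfold Spans
  rcases h.le_or_le _ h1 with h1 | h1 <;> rcases h.le_or_le _ h2 with h2 | h2
  · exfalso; rcases hx with h | h <;> linarith
  · exact Or.inl ⟨h1, h2⟩
  · exact Or.inr ⟨h2, h1⟩
  · exfalso; rcases hy with h | h <;> linarith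

lemma exists_consecutive {S : Finset Plane} {i : Fin 2} {x y : ℝ} (hp : ∃ p ∈ S, p i ≤ x)
    (hq : ∃ q ∈ S, y ≤ q i) (h : ∀ r ∈ S, r i ≤ x ∨ y ≤ r i) :
    ∃ a b, (∃ p ∈ S, p i = a) ∧ (∃ q ∈ S, q i = b) ∧ (∀ r ∈ S, r i ≤ a ∨ b ≤ r i) ∧
      a ≤ x ∧ y ≤ b := by
  obtain ⟨p, hp, hpm⟩ := exists_max_image (S.filter fun p => p i ≤ x) (fun p => p i)
    (by obtain ⟨p, hp, h⟩ := hp; exact ⟨p, mem_filter.2 ⟨hp, h⟩⟩)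
  obtain ⟨q, hq, hqm⟩ := exists_min_image (S.filter fun p => y ≤ p i) (fun p => p i)
    (by obtain ⟨p, hp, h⟩ := hq; exact ⟨p, mem_filter.2 ⟨hp, h⟩⟩)
  rw [mem_filter] at hp hq
  refine ⟨p i, q i, ⟨p, hp.1, rfl⟩, ⟨q, hq.1, rfl⟩, fun r hr => ?_, hp.2, hq.2⟩
  rcases h r hr with h | h
  · exact Or.inl (hpm r (mem_filter.2 ⟨hr, h⟩))
  · exact Or.inr (hqm r (mem_filter.2 ⟨hr, h⟩))

lemma IsGap.left_mem_gridLines {S : Finset Plane} {i : Fin 2} {a b : ℝ} (h : IsGap S i a b) :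
    toLex (a, 1) ∈ gridLines S i := by
  obtain ⟨p, hp, rfl⟩ := h.left_mem
  exact Or.inl ⟨p, hp, Or.inr rfl⟩

lemma IsGap.right_mem_gridLines {S : Finset Plane} {i : Fin 2} {a b : ℝ} (h : IsGap S i a b) :
    toLex (b, -1) ∈ gridLines S i := by
  obtain ⟨p, hp, rfl⟩ := h.right_mem
  exact Or.inl ⟨p, hp, Or.inl rfl⟩

lemma IsGap.help_mem_gridLines {S : Finset Plane} {i : Fin 2} {a b : ℝ} (h : IsGap S i a b) {j : ℕ}
    (h1 : 1 ≤ j) (h2 : j ≤ 19999) : toLex (a + (b - a) / 20000 * (j : ℝ), 0) ∈ gridLines S i := by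
  obtain ⟨p, hp, rfl⟩ := h.left_mem
  obtain ⟨q, hq, rfl⟩ := h.right_mem
  refine Or.inr ⟨p, hp, q, hq, h.lt, fun r hr hr' => ?_, j, h1, h2, rfl⟩
  rcases h.le_or_le r hr with h | h <;> linarith

lemma IsGap.exists_gridLines {S : Finset Plane} {i : Fin 2} {a b : ℝ} (h : IsGap S i a b) {x : ℝ}
    (ha : a ≤ x) (hb : x < b) : ∃ L ∈ gridLines S i, ∃ U ∈ gridLines S i, toLex (a, 1) ≤ L ∧
      U ≤ toLex (b, -1) ∧ (ofLex L).1 ≤ x ∧ x < (ofLex U).1 ∧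
      (ofLex U).1 - (ofLex L).1 ≤ (b - a) / 20000 ∧ L < toLex (b, -1) ∧ toLex (a, 1) < U := by
  set δ := (b - a) / 20000 with hδ
  have hδ0 : 0 < δ := by have := h.lt; simp only [hδ]; linarith
  have hbδ : b = a + δ * 20000 := by rw [hδ]; ring
  -- `x` lies in part `j` of the 20000 parts. For `j = 0` and `j + 1 = 20000` the bordering line is
  -- a main line instead of a help line.
  set j := ⌊(x - a) / δ⌋₊
  have hj : δ * j ≤ x - a := by
    have := Nat.floor_le (div_nonneg (sub_nonneg.2 ha) hδ0.le)
    rwa [le_div_iff₀ hδ0, mul_comm] at this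
  have hj' : x - a < δ * (j + 1 : ℕ) := by
    have := Nat.lt_floor_add_one ((x - a) / δ)
    rw [div_lt_iff₀ hδ0, mul_comm] at this
    exact_mod_cast this
  have hj2 : j < 20000 := by
    have : δ * j < δ * 20000 := by linarith
    exact_mod_cast lt_of_mul_lt_mul_left this hδ0.le
  obtain ⟨L, hL, hL1, hL2, hL3⟩ : ∃ L ∈ gridLines S i, (ofLex L).1 = a + δ * j ∧ toLex (a, 1) ≤ L ∧
      L < toLex (b, -1) := by
    rcases Nat.eq_zero_or_pos j with h0 | h0
    · exact ⟨toLex (a, 1), h.left_mem_gridLines, by simp [h0], le_rfl, pos_lt_iff.2 (Or.inl h.lt)⟩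
    · refine ⟨_, h.help_mem_gridLines h0 (by omega), rfl, pos_le_iff.2 (Or.inl ?_),
        pos_lt_iff.2 (Or.inl ?_)⟩
      · have : (0 : ℝ) < j := by exact_mod_cast h0
        have := mul_pos hδ0 this
        simpa using this
      · change a + δ * j < b
        linarith
  obtain ⟨U, hU, hU1, hU2, hU3⟩ : ∃ U ∈ gridLines S i, (ofLex U).1 = a + δ * (j + 1 : ℕ) ∧
      U ≤ toLex (b, -1) ∧ toLex (a, 1) < U := by
    rcases (show j + 1 ≤ 20000 from hj2).eq_or_lt with h0 | h0
    · exact ⟨toLex (b, -1), h.right_mem_gridLines, by rw [h0, hbδ]; norm_num, le_rfl,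
        pos_lt_iff.2 (Or.inl h.lt)⟩
    · refine ⟨_, h.help_mem_gridLines (j := j + 1) (by omega) (by omega), rfl,
        pos_le_iff.2 (Or.inl ?_), pos_lt_iff.2 (Or.inl ?_)⟩
      · have : ((j + 1 : ℕ) : ℝ) < 20000 := by exact_mod_cast h0
        have := mul_lt_mul_of_pos_left this hδ0
        change a + δ * (j + 1 : ℕ) < b
        linarith
      · change a < a + δ * (j + 1 : ℕ)
        linarith
  refine ⟨L, hL, U, hU, hL2, hU2, ?_, ?_, ?_, hL3, hU3⟩
  · linarith
  · linarith
  · rw [hL1, hU1]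
    push_cast
    linarith

lemma exists_le_of_mem_gridLines {S : Finset Plane} {i : Fin 2} {c : Pos}
    (hc : c ∈ gridLines S i) : ∃ p ∈ S, p i ≤ (ofLex c).1 := by
  rcases hc with ⟨p, hp, rfl | rfl⟩ | ⟨p, hp, q, hq, hpq, -, j, -, -, rfl⟩
  · exact ⟨p, hp, le_rfl⟩
  · exact ⟨p, hp, le_rfl⟩
  · refine ⟨p, hp, ?_⟩
    have : 0 ≤ (q i - p i) / 20000 * (j : ℝ) := by
      have : 0 ≤ q i - p i := by linarith
      positivity
    simpa using this

lemma exists_ge_of_mem_gridLines {S : Finset Plane} {i : Fin 2} {c : Pos}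
    (hc : c ∈ gridLines S i) : ∃ p ∈ S, (ofLex c).1 ≤ p i := by
  rcases hc with ⟨p, hp, rfl | rfl⟩ | ⟨p, hp, q, hq, hpq, -, j, -, hj, rfl⟩
  · exact ⟨p, hp, le_rfl⟩
  · exact ⟨p, hp, le_rfl⟩
  · refine ⟨q, hq, ?_⟩
    have hj : (j : ℝ) ≤ 19999 := by exact_mod_cast hj
    change p i + (q i - p i) / 20000 * (j : ℝ) ≤ q i
    nlinarith

/-- A set of formal points is thin in the direction `i` if all its points have the same `i`-th
coordinate, or if it lies in a small part of one gap between consecutive points of `S`. -/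
def Thin (S : Finset Plane) (R : Set FormalPoint) (i : Fin 2) : Prop :=
  (∃ x, ∀ P ∈ R, (ofLex (P i)).1 = x) ∨
  ∃ a b l u, IsGap S i a b ∧ a ≤ l ∧ u ≤ b ∧ u - l ≤ (b - a) / 20000 ∧
    ∀ P ∈ R, toLex (a, 1) ≤ P i ∧ P i ≤ toLex (b, -1) ∧ l ≤ (ofLex (P i)).1 ∧ (ofLex (P i)).1 ≤ u

lemma Thin.mono {S : Finset Plane} {R R' : Set FormalPoint} {i : Fin 2} (h : Thin S R i)
    (hR : R' ⊆ R) : Thin S R' i := by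
  rcases h with ⟨x, h⟩ | ⟨a, b, l, u, h1, h2, h3, h4, h5⟩
  · exact Or.inl ⟨x, fun P hP => h P (hR hP)⟩
  · exact Or.inr ⟨a, b, l, u, h1, h2, h3, h4, fun P hP => h5 P (hR hP)⟩

lemma thin_of_no_gridLines {S : Finset Plane} {R : Set FormalPoint} {i : Fin 2} {L U : Pos}
    (hL : L ∈ gridLines S i) (hU : U ∈ gridLines S i) (hLU : L < U)
    (h : ∀ c ∈ gridLines S i, ¬ (L < c ∧ c < U)) (hR : ∀ P ∈ R, L ≤ P i ∧ P i ≤ U) :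
    Thin S R i := by
  rcases (coord_le_of_le hLU.le).eq_or_lt with h0 | h0
  · refine Or.inl ⟨(ofLex L).1, fun P hP => ?_⟩
    have h1 := coord_le_of_le (hR P hP).1
    have h2 := coord_le_of_le (hR P hP).2
    exact le_antisymm (h0 ▸ h2) h1
  · obtain ⟨a, b, ha, hb, hab, hax, hby⟩ := exists_consecutive (exists_le_of_mem_gridLines hL)
      (exists_ge_of_mem_gridLines hU) (fun r hr => by
        by_contra! hr'
        exact h _ (Or.inl ⟨r, hr, Or.inl rfl⟩)
          ⟨pos_lt_iff.2 (Or.inl hr'.1), pos_lt_iff.2 (Or.inl hr'.2)⟩)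
    have hg : IsGap S i a b := ⟨by linarith, ha, hb, hab⟩
    have haL : toLex (a, 1) ≤ L := by
      by_contra! h'
      exact h _ hg.left_mem_gridLines ⟨h', pos_lt_iff.2 (Or.inl (hax.trans_lt h0))⟩
    have hbU : U ≤ toLex (b, -1) := by
      by_contra! h'
      exact h _ hg.right_mem_gridLines ⟨pos_lt_iff.2 (Or.inl (h0.trans_le hby)), h'⟩
    -- `U'` is the first grid line with actual coordinate beyond that of `L`. As no grid line
    -- separates `L` and `U`, it bounds `U`.
    obtain ⟨L', -, U', hU', -, -, h1, h2, h3, -⟩ := hg.exists_gridLines hax (h0.trans_le hby)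
    have h4 : U ≤ U' := by
      by_contra! h'
      exact h _ hU' ⟨pos_lt_iff.2 (Or.inl h2), h'⟩
    have h5 := coord_le_of_le h4
    refine Or.inr ⟨a, b, (ofLex L).1, (ofLex U).1, hg, hax, hby, by linarith, fun P hP => ?_⟩
    exact ⟨haL.trans (hR P hP).1, (hR P hP).2.trans hbU, coord_le_of_le (hR P hP).1,
      coord_le_of_le (hR P hP).2⟩

/-- Both kinds of thinness take one form: a set with a single actual coordinate is treated as lying
in a gap of length zero. -/
lemma Thin.exists_bounds {S : Finset Plane} {R : Set FormalPoint} {i : Fin 2} (h : Thin S R i) :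
    ∃ x₀ x₁ l u : ℝ, x₀ ≤ l ∧ u ≤ x₁ ∧ u - l ≤ (x₁ - x₀) / 20000 ∧
      ∀ P ∈ R, l ≤ (ofLex (P i)).1 ∧ (ofLex (P i)).1 ≤ u ∧
        ∀ e : Plane × Plane, e.1 ∈ S → e.2 ∈ S → P ∈ edgeTrace e → Spans e i x₀ x₁ := by
  rcases h with ⟨x, h⟩ | ⟨a, b, l, u, h1, h2, h3, h4, h5⟩
  · refine ⟨x, x, x, x, le_rfl, le_rfl, by simp, fun P hP => ⟨(h P hP).ge, (h P hP).le, ?_⟩⟩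
    rintro e - - ⟨z, hz, w, hw, hzw⟩
    rw [← h P hP, (hzw i).1]
    rcases coord_mem_Icc hz i with h | h
    · exact Or.inl h
    · exact Or.inr h
  · exact ⟨a, b, l, u, h2, h3, h4, fun P hP => ⟨(h5 P hP).2.2.1, (h5 P hP).2.2.2,
      fun e he1 he2 hPe => h1.spans he1 he2 hPe (h5 P hP).1 (h5 P hP).2.1⟩⟩

namespace Clustering

variable {S : Finset Plane}

lemma mem_of_mem_edges {C : Clustering S} {e : Plane × Plane} (he : e ∈ C.edges) :
    e.1 ∈ S ∧ e.2 ∈ S := by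
  obtain ⟨A, hA, he⟩ := he
  have := (mem_hullEdges.1 he).1
  exact ⟨C.subset_of_mem_parts hA this.1, C.subset_of_mem_parts hA this.2⟩

lemma finite_edges (C : Clustering S) : C.edges.Finite :=
  (S ×ˢ S).finite_toSet.subset fun _ he => mem_coe.2 (mem_product.2 (mem_of_mem_edges he))

lemma exists_three_edges {C : Clustering S} {X : Set FormalPoint} (h : ¬ AtMostTwoEdges C X) :
    ∃ e : Fin 3 → Plane × Plane, Function.Injective e ∧ (∀ n, e n ∈ C.edges) ∧
      ∀ n, ∃ P ∈ X, P ∈ edgeTrace (e n) := by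
  unfold AtMostTwoEdges at h
  rw [not_le] at h
  have h' : (3 : ℕ∞) ≤ {e ∈ C.edges | (edgeTrace e ∩ X).Nonempty}.encard := by
    have := Order.add_one_le_of_lt h
    norm_num at this
    exact this
  obtain ⟨t, ht, ht3⟩ := Set.exists_subset_encard_eq h'
  obtain ⟨x, y, z, hxy, hxz, hyz, rfl⟩ := Set.encard_eq_three.1 ht3
  refine ⟨![x, y, z], ?_, ?_, ?_⟩
  · intro m n
    fin_cases m <;> fin_cases n <;> simp [hxy, hxz, hyz, hxy.symm, hxz.symm, hyz.symm]
  · have := fun e he => (ht (a := e) he).1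
    intro n
    fin_cases n
    · exact this x (by simp)
    · exact this y (by simp)
    · exact this z (by simp)
  · have : ∀ e ∈ ({x, y, z} : Set _), ∃ P ∈ X, P ∈ edgeTrace e := fun e he => by
      obtain ⟨P, hP, hX⟩ := (ht he).2
      exact ⟨P, hX, hP⟩
    intro n
    fin_cases n
    · exact this x (by simp)
    · exact this y (by simp)
    · exact this z (by simp)

lemma atMostTwoEdges_mono {C : Clustering S} {X Y : Set FormalPoint} (h : AtMostTwoEdges C Y)
    (hXY : X ⊆ Y) : AtMostTwoEdges C X :=
  (Set.encard_le_encard (t := {e ∈ C.edges | (edgeTrace e ∩ Y).Nonempty}) fun _ he =>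
    ⟨he.1, he.2.mono (Set.inter_subset_inter_right _ hXY)⟩).trans h

lemma IsOptimal.atMostTwoEdges_of_thin (hS : Set.InjOn (fun p : Plane => p 0) (S : Set Plane))
    {C : Clustering S} {k : ℕ} (hC : C.IsOptimal k) {R : Set FormalPoint}
    (hR : ∀ i, Thin S R i) : AtMostTwoEdges C R := by
  by_contra h
  obtain ⟨e, he, heC, hP⟩ := exists_three_edges h
  choose P hPR hPe using hP
  choose x₀ x₁ l u h1 h2 h3 h4 using fun i => (hR i).exists_bounds
  choose z hz w hw hzw using hPe
  refine hC.not_three_spans hS he heC h1 h2 h3 (fun n i => ?_) hz (fun n i => ?_) (fun n i => ?_)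
  · exact (h4 i (P n) (hPR n)).2.2 _ (mem_of_mem_edges (heC n)).1 (mem_of_mem_edges (heC n)).2
      ⟨z n, hz n, w n, hw n, hzw n⟩
  · rw [← (hzw n i).1]
    exact (h4 i (P n) (hPR n)).1
  · rw [← (hzw n i).1]
    exact (h4 i (P n) (hPR n)).2.1

end Clustering

/-! ### Dividing a box -/

namespace Box

variable {S : Finset Plane} (B : Box S)

lemma slice_subset_region (i : Fin 2) (c : Pos) : B.slice i c ⊆ B.region := fun _ h => h.1

lemma thin_slice (i : Fin 2) (c : Pos) : Thin S (B.slice i c) i :=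
  Or.inl ⟨(ofLex c).1, fun P hP => by rw [hP.2]⟩

lemma thin_region {i : Fin 2} (h : ∀ c ∈ gridLines S i, ¬ B.IsSeparator i c) :
    Thin S B.region i :=
  thin_of_no_gridLines (B.lo_mem i) (B.hi_mem i) (B.lo_lt_hi i) h
    fun _ hP => ⟨hP.1 i, hP.2 i⟩

lemma lo_mem_region : B.lo ∈ B.region := ⟨le_rfl, fun i => (B.lo_lt_hi i).le⟩

lemma hi_mem_region : B.hi ∈ B.region := ⟨fun i => (B.lo_lt_hi i).le, le_rfl⟩

/-- Every side of a smaller box is part of a side of `B` or is the good separator. -/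
lemma exists_divides {i : Fin 2} {c : Pos} (hc : c ∈ gridLines S i) (hs : B.IsSeparator i c)
    {C : Clustering S} (hB : B.Invariant C) (h2 : AtMostTwoEdges C (B.slice i c)) :
    ∃ Bl Br : Box S, B.Divides i c Bl Br ∧ Bl.region ⊂ B.region ∧ Br.region ⊂ B.region ∧
      Bl.Invariant C ∧ Br.Invariant C := by
  let Bl : Box S := ⟨B.lo, Function.update B.hi i c, B.lo_mem,
    fun j => by
      rcases eq_or_ne j i with rfl | h
      · simpa using hc
      · simpa [h] using B.hi_mem j,
    fun j => by
      rcases eq_or_ne j i with rfl | h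
      · simpa using hs.1
      · simpa [h] using B.lo_lt_hi j⟩
  let Br : Box S := ⟨Function.update B.lo i c, B.hi,
    fun j => by
      rcases eq_or_ne j i with rfl | h
      · simpa using hc
      · simpa [h] using B.lo_mem j, B.hi_mem,
    fun j => by
      rcases eq_or_ne j i with rfl | h
      · simpa using hs.2
      · simpa [h] using B.lo_lt_hi j⟩
  have hl : Bl.region ⊆ B.region := Set.Icc_subset_Icc le_rfl fun j => by
    rcases eq_or_ne j i with rfl | h
    · simpa [Bl] using hs.2.le
    · simp [Bl, h]
  have hr : Br.region ⊆ B.region := Set.Icc_subset_Icc (fun j => by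
    rcases eq_or_ne j i with rfl | h
    · simpa [Br] using hs.1.le
    · simp [Br, h]) le_rfl
  have hsl : ∀ j d, Bl.slice j d ⊆ B.slice j d := fun j d P hP => ⟨hl hP.1, hP.2⟩
  have hsr : ∀ j d, Br.slice j d ⊆ B.slice j d := fun j d P hP => ⟨hr hP.1, hP.2⟩
  refine ⟨Bl, Br, ⟨rfl, rfl, rfl, rfl⟩, ⟨hl, fun h => ?_⟩, ⟨hr, fun h => ?_⟩, fun j => ⟨?_, ?_⟩,
    fun j => ⟨?_, ?_⟩⟩
  · have := (h B.hi_mem_region).2 i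
    simp only [Bl, Function.update_self] at this
    exact this.not_gt hs.2
  · have := (h B.lo_mem_region).1 i
    simp only [Br, Function.update_self] at this
    exact this.not_gt hs.1
  · exact Clustering.atMostTwoEdges_mono (hB j).1 (hsl j _)
  · rcases eq_or_ne j i with rfl | h
    · refine Clustering.atMostTwoEdges_mono h2 ?_
      have : Bl.hi j = c := by simp [Bl]
      rw [this]
      exact hsl j c
    · refine Clustering.atMostTwoEdges_mono (hB j).2 ?_
      have : Bl.hi j = B.hi j := by simp [Bl, h]
      rw [this]
      exact hsl j _
  · rcases eq_or_ne j i with rfl | h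
    · refine Clustering.atMostTwoEdges_mono h2 ?_
      have : Br.lo j = c := by simp [Br]
      rw [this]
      exact hsr j c
    · refine Clustering.atMostTwoEdges_mono (hB j).1 ?_
      have : Br.lo j = B.lo j := by simp [Br, h]
      rw [this]
      exact hsr j _
  · exact Clustering.atMostTwoEdges_mono (hB j).2 (hsr j _)

end Box

/-! ### Chords of edges and exits from a box -/

/-- The parameters of the points in `K` form a compact set, and its least and greatest elements give
`s` and `t`. -/
lemma exists_chord {K : Set Plane} (hK : IsClosed K) {p q : Plane}
    (h : ∃ y ∈ segment ℝ p q, y ∈ K) : ∃ s t, (s ∈ segment ℝ p q ∧ s ∈ K) ∧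
      (t ∈ segment ℝ p q ∧ t ∈ K) ∧ ∀ y ∈ segment ℝ p q, y ∈ K → y ∈ segment ℝ s t := by
  set γ : ℝ →ᵃ[ℝ] Plane := AffineMap.lineMap p q with hγ
  have hγc : Continuous γ := AffineMap.lineMap_continuous (R := ℝ)
  have hc : IsCompact (Set.Icc (0 : ℝ) 1 ∩ γ ⁻¹' K) :=
    isCompact_Icc.inter_right (hK.preimage hγc)
  have hmem : ∀ τ ∈ Set.Icc (0 : ℝ) 1, γ τ ∈ segment ℝ p q := fun τ hτ => by
    rw [segment_eq_image_lineMap]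
    exact ⟨τ, hτ, rfl⟩
  have hex : ∀ y ∈ segment ℝ p q, y ∈ K → ∃ τ ∈ Set.Icc (0 : ℝ) 1 ∩ γ ⁻¹' K, γ τ = y :=
    fun y hy hyK => by
      rw [segment_eq_image_lineMap] at hy
      obtain ⟨τ, hτ, rfl⟩ := hy
      exact ⟨τ, ⟨hτ, hyK⟩, rfl⟩
  obtain ⟨y, hy, hyK⟩ := h
  obtain ⟨τ, hτ, -⟩ := hex y hy hyK
  obtain ⟨a, ha, hal⟩ := hc.exists_isLeast ⟨τ, hτ⟩
  obtain ⟨b, hb, hbl⟩ := hc.exists_isGreatest ⟨τ, hτ⟩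
  refine ⟨γ a, γ b, ⟨hmem a ha.1, ha.2⟩, ⟨hmem b hb.1, hb.2⟩, fun y hy hyK => ?_⟩
  obtain ⟨τ, hτ, rfl⟩ := hex y hy hyK
  have : τ ∈ segment ℝ a b := by
    rw [segment_eq_Icc (hal hb)]
    exact ⟨hal hτ, hbl hτ⟩
  rw [← image_segment ℝ γ a b]
  exact ⟨τ, this, rfl⟩

lemma three_mul_length_le_sum_length {ε : Type*} (E : Fin 3 → Finset ε) (l r : Fin 3 → ε → ℝ)
    (h : ∀ m, ∀ e ∈ E m, l m e ≤ r m e) {a b : ℝ} (hab : a ≤ b) {N : Set ℝ} (hN : N.Finite)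
    (hcov : ∀ x ∉ N, a < x → x < b → ∃ e : Fin 3 → ε, Function.Injective e ∧
      ∀ n, ∃ m, e n ∈ E m ∧ l m (e n) ≤ x ∧ x ≤ r m (e n)) :
    3 * (b - a) ≤ ∑ m, ∑ e ∈ E m, (r m e - l m e) := by
  classical
  have := mul_length_le_sum_length ((univ : Finset (Fin 3)).sigma E) (fun p => l p.1 p.2)
    (fun p => r p.1 p.2) (fun p hp => h _ _ (mem_sigma.1 hp).2) hab 3 hN fun x hx hax hxb => by
      obtain ⟨e, he, hm⟩ := hcov x hx hax hxb
      choose m h1 h2 h3 using hm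
      refine ⟨univ.image fun n => ⟨m n, e n⟩, fun p hp => ?_, ?_, fun p hp => ?_⟩
      · obtain ⟨n, -, rfl⟩ := mem_image.1 hp
        exact mem_sigma.2 ⟨mem_univ _, h1 n⟩
      · rw [card_image_of_injective]
        · simp
        · intro n n' hn
          exact he (by simpa using congrArg Sigma.snd hn)
      · obtain ⟨n, -, rfl⟩ := mem_image.1 hp
        exact ⟨h2 n, h3 n⟩
  rw [sum_sigma] at this
  exact_mod_cast this

/-- From a border point, a step towards a strictly interior coordinate is formally directed into the
interval. -/
lemma mem_Icc_of_toward {L U : Pos} {x v : ℝ} (hx : (ofLex L).1 ≤ x) (hx' : x ≤ (ofLex U).1)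
    (hv : (ofLex L).1 < v) (hv' : v < (ofLex U).1) :
    L ≤ toLex (x, SignType.sign (v - x)) ∧ toLex (x, SignType.sign (v - x)) ≤ U := by
  constructor
  · rcases hx.eq_or_lt with h | h
    · refine pos_le_iff.2 (Or.inr ⟨h, ?_⟩)
      change _ ≤ SignType.sign (v - x)
      rw [sign_pos (by linarith)]
      exact SignType.le_one _
    · exact pos_le_iff.2 (Or.inl h)
  · rcases hx'.eq_or_lt with h | h
    · refine pos_le_iff.2 (Or.inr ⟨h, ?_⟩)
      change SignType.sign (v - x) ≤ _
      rw [sign_neg (by linarith)]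
      exact SignType.neg_one_le _
    · exact pos_le_iff.2 (Or.inl h)

lemma mem_edgeTrace_of_ne {e : Plane × Plane} {i j : Fin 2} (hij : i ≠ j) {z w : Plane}
    (hz : z ∈ segment ℝ e.1 e.2) (hw : w ∈ segment ℝ e.1 e.2) {Q : FormalPoint}
    (hi : Q i = toLex (z i, SignType.sign (w i - z i))) (hj : (ofLex (Q j)).1 = z j)
    (hj' : (ofLex (Q j)).2 = 0 ∨ (ofLex (Q j)).2 = SignType.sign (w j - z j)) :
    Q ∈ edgeTrace e := by
  refine ⟨z, hz, w, hw, fun m => ?_⟩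
  by_cases h : m = j
  · subst h
    exact ⟨hj, hj'⟩
  · obtain rfl : m = i := by omega
    rw [hi]
    exact ⟨rfl, Or.inr rfl⟩

lemma Box.mem_slice_of_ne {S : Finset Plane} {B : Box S} {i j : Fin 2} (hij : i ≠ j)
    {Q : FormalPoint} (hl : B.lo i ≤ Q i) (hu : Q i ≤ B.hi i) (hl' : B.lo j ≤ Q j)
    (hu' : Q j ≤ B.hi j) : Q ∈ B.slice j (Q j) := by
  have h : ∀ m, B.lo m ≤ Q m ∧ Q m ≤ B.hi m := fun m => by
    by_cases h : m = j
    · subst h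
      exact ⟨hl', hu'⟩
    · obtain rfl : m = i := by omega
      exact ⟨hl, hu⟩
  exact ⟨⟨fun m => (h m).1, fun m => (h m).2⟩, rfl⟩

/-- An edge going from a point of the box to a point `y` on the other side of a line `d` meets `d`
inside the box, no farther from `y` in direction `i` than where it started. `hPd` treats the start
lying actually on `d` when `d` is displaced away from `y`. -/
lemma Box.exists_mem_slice_of_exit {S : Finset Plane} {B : Box S} {i j : Fin 2} (hij : i ≠ j)
    {e : Plane × Plane} {P : FormalPoint} (hP : P ∈ B.region) (hPe : P ∈ edgeTrace e) {y : Plane}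
    (hy : y ∈ segment ℝ e.1 e.2) (hl : (ofLex (B.lo i)).1 < y i) (hu : y i < (ofLex (B.hi i)).1)
    {d : Pos} (hdl : B.lo j ≤ d) (hdu : d ≤ B.hi j) (hd0 : y j ≠ (ofLex d).1)
    (hd : ((ofLex (P j)).1 - (ofLex d).1) * (y j - (ofLex d).1) ≤ 0)
    (hPd : (ofLex (P j)).1 = (ofLex d).1 → (ofLex d).2 = -SignType.sign (y j - (ofLex d).1) →
      P j = d) :
    ∃ Q ∈ B.slice j d, Q ∈ edgeTrace e ∧ |(ofLex (Q i)).1 - y i| ≤ |(ofLex (P i)).1 - y i| := by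
  by_cases hPj : P j = d
  · exact ⟨P, ⟨hP, hPj⟩, hPe, le_rfl⟩
  obtain ⟨z, hz, w, hw, hzw⟩ := hPe
  have hzi := (hzw i).1
  have hzj := (hzw j).1
  have hl1 := coord_le_of_le (hP.1 i)
  have hu1 := coord_le_of_le (hP.2 i)
  rw [hzj] at hd hPd
  rw [hzi] at hl1 hu1
  have hd0' : y j - (ofLex d).1 ≠ 0 := sub_ne_zero.2 hd0
  obtain ⟨s, hs0, hs1, hs, hspos⟩ : ∃ s : ℝ, 0 ≤ s ∧ s ≤ 1 ∧ (1 - s) * z j + s * y j = (ofLex d).1 ∧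
      (z j ≠ (ofLex d).1 → 0 < s) := by
    generalize (ofLex d).1 = D at *
    rcases lt_or_gt_of_ne hd0' with h | h
    · have hz : 0 ≤ z j - D := by nlinarith
      refine ⟨(z j - D) / (z j - y j), div_nonneg hz (by linarith),
        (div_le_one (by linarith)).2 (by linarith), ?_, fun h' => div_pos ?_ (by linarith)⟩
      · have : z j - y j ≠ 0 := by linarith
        field_simp
        ring
      · exact lt_of_le_of_ne hz (sub_ne_zero.2 h').symm
    · have hz : z j - D ≤ 0 := by nlinarith
      refine ⟨(D - z j) / (y j - z j), div_nonneg (by linarith) (by linarith),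
        (div_le_one (by linarith)).2 (by linarith), ?_, fun h' => div_pos ?_ (by linarith)⟩
      · have : y j - z j ≠ 0 := by linarith
        field_simp
        ring
      · exact lt_of_le_of_ne (by linarith) (sub_ne_zero.2 h'.symm).symm
  set v : Plane := (1 - s) • z + s • y with hv
  have hvseg : v ∈ segment ℝ e.1 e.2 :=
    convex_segment e.1 e.2 hz hy (by linarith) hs0 (by ring)
  have hvi : v i = (1 - s) * z i + s * y i := by simp [hv]
  have hvj : v j = (ofLex d).1 := by rw [← hs]; simp [hv]
  have habs : |v i - y i| ≤ |z i - y i| := by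
    rw [hvi, show (1 - s) * z i + s * y i - y i = (1 - s) * (z i - y i) by ring, abs_mul,
      abs_of_nonneg (by linarith : 0 ≤ 1 - s)]
    exact mul_le_of_le_one_left (abs_nonneg _) (by linarith)
  have hconv : ∀ {p : ℝ}, p ≤ z i → p ≤ y i → p ≤ v i := fun h1 h2 => by rw [hvi]; nlinarith
  have hconv' : ∀ {p : ℝ}, z i ≤ p → y i ≤ p → v i ≤ p := fun h1 h2 => by rw [hvi]; nlinarith
  have build : ∀ u ∈ segment ℝ e.1 e.2,
      ((ofLex d).2 = 0 ∨ (ofLex d).2 = SignType.sign (u j - v j)) →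
      B.lo i ≤ toLex (v i, SignType.sign (u i - v i)) →
      toLex (v i, SignType.sign (u i - v i)) ≤ B.hi i →
      ∃ Q ∈ B.slice j d, Q ∈ edgeTrace e ∧ |(ofLex (Q i)).1 - y i| ≤ |(ofLex (P i)).1 - y i| := by
    intro u hu h1 h2 h3
    set Q : FormalPoint := fun m => if m = j then d else toLex (v i, SignType.sign (u i - v i)) with hQ
    have hQj : Q j = d := by simp [hQ]
    have hQi : Q i = toLex (v i, SignType.sign (u i - v i)) := by simp [hQ, hij]
    refine ⟨Q, ?_, ?_, ?_⟩
    · have := Box.mem_slice_of_ne (B := B) (Q := Q) hij (hQi ▸ h2) (hQi ▸ h3) (hQj ▸ hdl) (hQj ▸ hdu)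
      rwa [hQj] at this
    · exact mem_edgeTrace_of_ne hij hvseg hu hQi (by rw [hQj, hvj]) (by rwa [hQj])
    · rw [hQi, hzi]
      exact habs
  -- The crossing point `v` needs a formal displacement in direction `j` matching `d`. It is
  -- obtained by moving towards `y` here, and towards `z` in the other case; there `v` is strictly
  -- inside in direction `i` because `v ≠ z`.
  by_cases hA : (ofLex d).2 = 0 ∨ (ofLex d).2 = SignType.sign (y j - v j)
  · obtain ⟨h1, h2⟩ := mem_Icc_of_toward (hconv hl1 hl.le) (hconv' hu1 hu.le) hl hu
    exact build y hy hA h1 h2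
  · have hτ : (ofLex d).2 = -SignType.sign (y j - (ofLex d).1) := by
      rw [hvj] at hA
      have h0 : SignType.sign (y j - (ofLex d).1) ≠ 0 := by rwa [Ne, sign_eq_zero_iff]
      revert hA h0
      generalize SignType.sign (y j - (ofLex d).1) = σ
      generalize (ofLex d).2 = τ
      revert σ τ
      decide
    have hzd : z j ≠ (ofLex d).1 := fun h => hPj (hPd h hτ)
    have hs' := hspos hzd
    have hL : (ofLex (B.lo i)).1 < v i := by rw [hvi]; nlinarith
    have hU : v i < (ofLex (B.hi i)).1 := by rw [hvi]; nlinarith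
    refine build z hz (Or.inr ?_) (pos_le_iff.2 (Or.inl hL)) (pos_le_iff.2 (Or.inl hU))
    rw [hτ, hvj]
    rcases lt_or_gt_of_ne hd0' with h | h
    · rw [sign_neg h, sign_pos, neg_neg]
      exact lt_of_le_of_ne (by nlinarith) (sub_ne_zero.2 hzd).symm
    · rw [sign_pos h, sign_neg]
      exact lt_of_le_of_ne (by nlinarith) (sub_ne_zero.2 hzd)

/-! ### Boxes without good separators -/

namespace Box

variable {S : Finset Plane}

/-- The coordinate of the left (lower) edge of the box. -/
def left (B : Box S) (i : Fin 2) : ℝ := (ofLex (B.lo i)).1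

/-- The coordinate of the right (upper) edge of the box. -/
def right (B : Box S) (i : Fin 2) : ℝ := (ofLex (B.hi i)).1

/-- No separator of the box in the direction `i` that lies on a grid line is good. -/
def AllBad (B : Box S) (C : Clustering S) (i : Fin 2) : Prop :=
  ∀ c ∈ gridLines S i, B.IsSeparator i c → ¬ AtMostTwoEdges C (B.slice i c)

/-- The actual points that lie in the box. -/
def actual (B : Box S) : Set Plane := {y | ∀ m, B.left m ≤ y m ∧ y m ≤ B.right m}

lemma isClosed_actual (B : Box S) : IsClosed B.actual := by
  simp only [actual, Set.ofPred_forall]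
  refine isClosed_iInter fun m => ?_
  have hm : Continuous fun y : Plane => y m := by fun_prop
  exact (isClosed_le continuous_const hm).inter (isClosed_le hm continuous_const)

/-- With zero actual width, the three positions must have signs -1, 0, 1 over one coordinate. The
first makes it the coordinate of an input point, but the second is a help line, which lies strictly
inside a gap. -/
lemma left_lt_right {B : Box S} {i : Fin 2} {c : Pos} (hc : c ∈ gridLines S i)
    (hs : B.IsSeparator i c) : B.left i < B.right i := by
  have h1 := coord_le_of_le hs.1.le
  have h2 := coord_le_of_le hs.2.le
  refine lt_of_le_of_ne (h1.trans h2) fun h => ?_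
  have h3 : (ofLex (B.lo i)).1 = (ofLex c).1 := le_antisymm h1 (h2.trans h.ge)
  have h4 : (ofLex c).1 = (ofLex (B.hi i)).1 := h3.symm.trans h
  have h5 := (pos_lt_iff.1 hs.1).resolve_left h3.not_lt
  have h6 := (pos_lt_iff.1 hs.2).resolve_left h4.not_lt
  have h7 : (ofLex (B.lo i)).2 = -1 ∧ (ofLex c).2 = 0 := by
    have h5 := h5.2
    have h6 := h6.2
    revert h5 h6
    generalize (ofLex (B.lo i)).2 = s
    generalize (ofLex c).2 = t
    generalize (ofLex (B.hi i)).2 = u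
    revert s t u
    decide
  have hr : ∃ r ∈ S, r i = (ofLex (B.lo i)).1 := by
    rcases B.lo_mem i with ⟨p, hp, h | h⟩ | ⟨p, -, q, -, -, -, j, -, -, h⟩
    · exact ⟨p, hp, by rw [h]; rfl⟩
    · exact ⟨p, hp, by rw [h]; rfl⟩
    · rw [h] at h7
      exact absurd h7.1 (by decide : ¬ (0 : SignType) = -1)
  obtain ⟨r, hr, hrc⟩ := hr
  rw [h3] at hrc
  rcases hc with ⟨p, hp, rfl | rfl⟩ | ⟨p, -, q, -, hpq, hno, j, hj1, hj2, rfl⟩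
  · exact absurd h7.2 (by decide : ¬ (-1 : SignType) = 0)
  · exact absurd h7.2 (by decide : ¬ (1 : SignType) = 0)
  · refine hno r hr ?_
    change r i = p i + (q i - p i) / 20000 * (j : ℝ) at hrc
    have hj1 : (1 : ℝ) ≤ j := by exact_mod_cast hj1
    have hj2 : (j : ℝ) ≤ 19999 := by exact_mod_cast hj2
    rw [hrc]
    constructor <;> nlinarith

lemma AllBad.exists_edges {B : Box S} {C : Clustering S} {i : Fin 2} (h : B.AllBad C i) {c : Pos}
    (hc : c ∈ gridLines S i) (hs : B.IsSeparator i c) {a b : ℝ} (hg : IsGap S i a b)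
    (ha : toLex (a, 1) ≤ c) (hb : c ≤ toLex (b, -1)) :
    ∃ e : Fin 3 → Plane × Plane, Function.Injective e ∧ (∀ n, e n ∈ C.edges) ∧
      (∀ n, Spans (e n) i a b) ∧ ∀ n, ∃ P ∈ B.slice i c, P ∈ edgeTrace (e n) := by
  obtain ⟨e, he, heC, hP⟩ := Clustering.exists_three_edges (h c hc hs)
  refine ⟨e, he, heC, fun n => ?_, hP⟩
  obtain ⟨P, hP, hPe⟩ := hP n
  exact hg.spans (Clustering.mem_of_mem_edges (heC n)).1 (Clustering.mem_of_mem_edges (heC n)).2 hPe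
    (by rwa [hP.2]) (by rwa [hP.2])

lemma exists_mem_segment_of_mem_slice {B : Box S} {i j : Fin 2} {c : Pos} {P : FormalPoint}
    {e : Plane × Plane} (hP : P ∈ B.slice i c) (hPe : P ∈ edgeTrace e) :
    ∃ z ∈ segment ℝ e.1 e.2, z i = (ofLex c).1 ∧ B.left j ≤ z j ∧ z j ≤ B.right j := by
  obtain ⟨z, hz, w, -, hzw⟩ := hPe
  refine ⟨z, hz, by rw [← (hzw i).1, hP.2], ?_, ?_⟩
  · rw [← (hzw j).1]
    exact coord_le_of_le (hP.1.1 j)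
  · rw [← (hzw j).1]
    exact coord_le_of_le (hP.1.2 j)

lemma dist_le_of_eq {i j : Fin 2} (hij : i ≠ j) {z w : Plane} {l u : ℝ} (h : z i = w i)
    (hz : l ≤ z j ∧ z j ≤ u) (hw : l ≤ w j ∧ w j ≤ u) : dist z w ≤ u - l := by
  have h1 : |z i - w i| = 0 := by rw [h]; simp
  have h2 : |z j - w j| ≤ u - l := abs_le.2 ⟨by linarith, by linarith⟩
  have h3 := dist_le_abs_add_abs z w
  fin_cases i <;> fin_cases j <;> simp_all <;> linarith

lemma AllBad.eight_mul_le {B : Box S} {C : Clustering S} {k : ℕ} (hC : C.IsOptimal k)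
    (hS : Set.InjOn (fun p : Plane => p 0) (S : Set Plane)) {i j : Fin 2} (hij : i ≠ j)
    (h : B.AllBad C i) {c : Pos} (hc : c ∈ gridLines S i) (hs : B.IsSeparator i c)
    {a b : ℝ} (hg : IsGap S i a b) (ha : a < B.right i) (hb : B.left i < b)
    (hlong : 200 * (B.right i - B.left i) < b - a) :
    8 * (B.right i - B.left i) ≤ B.right j - B.left j := by
  have hw := left_lt_right hc hs
  have key : ∀ c ∈ gridLines S i, B.IsSeparator i c → toLex (a, 1) ≤ c → c ≤ toLex (b, -1) →
      ∃ e : Fin 3 → Plane × Plane, ∃ z : Fin 3 → Plane, Function.Injective e ∧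
      (∀ n, e n ∈ C.edges) ∧ (∀ n, Spans (e n) i a b) ∧
      (∀ n, z n ∈ segment ℝ (e n).1 (e n).2) ∧ (∀ n, z n i = (ofLex c).1) ∧
      ∀ m n, dist (z m) (z n) ≤ B.right j - B.left j := by
    intro c hc hs hac hcb
    obtain ⟨e, he, heC, hsp, hP⟩ := h.exists_edges hc hs hg hac hcb
    choose P hP hPe using hP
    choose z hz hzc hzj using fun n => exists_mem_segment_of_mem_slice (j := j) (hP n) (hPe n)
    exact ⟨e, z, he, heC, hsp, hz, hzc,
      fun m n => dist_le_of_eq hij ((hzc m).trans (hzc n).symm) (hzj m) (hzj n)⟩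
  -- A gap longer than 200w extends at least 99w beyond the box on one side. The separator is first
  -- moved into the gap if necessary, and 99/12 ≥ 8 gives the claim.
  by_cases hside : 99 * (B.right i - B.left i) ≤ b - B.right i
  · have hc' : max c (toLex (a, 1)) ∈ gridLines S i ∧ B.IsSeparator i (max c (toLex (a, 1))) := by
      have hu : max c (toLex (a, 1)) < B.hi i := max_lt hs.2 (pos_lt_iff.2 (Or.inl ha))
      refine ⟨?_, lt_of_lt_of_le hs.1 (le_max_left _ _), hu⟩
      rcases max_choice c (toLex (a, 1)) with h | h <;> rw [h]
      · exact hc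
      · exact hg.left_mem_gridLines
    have h1 := coord_le_of_le hc'.2.1.le
    have h2 := coord_le_of_le hc'.2.2.le
    have hac := le_max_right c (toLex (a, 1))
    generalize max c (toLex (a, 1)) = c at *
    obtain ⟨e, z, he, heC, hsp, hz, hzc, hd⟩ := key c hc'.1 hc'.2 hac
      (pos_le_iff.2 (Or.inl (lt_of_le_of_lt h2 (by unfold left right at *; change _ < b; linarith))))
    obtain ⟨φ, hφ⟩ := exists_angle i
    have := hC.gap_le hS φ (α := a) (β := b) (c := (ofLex c).1)
      (ρ := 99 * (B.right i - B.left i)) (fun x hx => by rw [hφ]; exact hg.le_or_le x hx)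
      (coord_le_of_le hac) (by linarith) (by unfold left right at *; linarith) he heC
      (fun n => by simp only [hφ]; exact hsp n) hz (fun n => by rw [hφ, hzc]) hd
    linarith
  · have hc' : min c (toLex (b, -1)) ∈ gridLines S i ∧ B.IsSeparator i (min c (toLex (b, -1))) := by
      have hu : B.lo i < min c (toLex (b, -1)) := lt_min hs.1 (pos_lt_iff.2 (Or.inl hb))
      refine ⟨?_, hu, lt_of_le_of_lt (min_le_left _ _) hs.2⟩
      rcases min_choice c (toLex (b, -1)) with h | h <;> rw [h]
      · exact hc
      · exact hg.right_mem_gridLines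
    have h1 := coord_le_of_le hc'.2.1.le
    have h2 := coord_le_of_le hc'.2.2.le
    have hac := min_le_right c (toLex (b, -1))
    generalize min c (toLex (b, -1)) = c at *
    obtain ⟨e, z, he, heC, hsp, hz, hzc, hd⟩ := key c hc'.1 hc'.2
      (pos_le_iff.2 (Or.inl (lt_of_lt_of_le (by unfold left right at *; change a < _; linarith) h1)))
      hac
    obtain ⟨φ, hφ⟩ := exists_angle_neg i
    have := hC.gap_le hS φ (α := -b) (β := -a) (c := -(ofLex c).1)
      (ρ := 99 * (B.right i - B.left i))
      (fun x hx => by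
        rw [hφ, neg_le_neg_iff, neg_le_neg_iff]
        exact (hg.le_or_le x hx).symm)
      (neg_le_neg (coord_le_of_le hac)) (by linarith) (by unfold left right at *; linarith) he heC
      (fun n => by
        simp only [hφ, neg_le_neg_iff]
        rcases hsp n with h | h
        · exact Or.inr ⟨h.2, h.1⟩
        · exact Or.inl ⟨h.2, h.1⟩) hz
      (fun n => by rw [hφ, hzc]) hd
    linarith

end Box

lemma eq_of_mem_segment_of_apply_eq {S : Finset Plane} {j : Fin 2}
    (hS : Set.InjOn (fun p : Plane => p j) (S : Set Plane)) {e : Plane × Plane} (h1 : e.1 ∈ S)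
    (h2 : e.2 ∈ S) {z w : Plane} (hz : z ∈ segment ℝ e.1 e.2) (hw : w ∈ segment ℝ e.1 e.2)
    (h : z j = w j) : z = w := by
  by_cases he : e.1 j = e.2 j
  · have he : e.1 = e.2 := hS (mem_coe.2 h1) (mem_coe.2 h2) he
    rw [he, segment_same] at hz hw
    rw [hz, hw]
  · rw [segment_eq_image'] at hz hw
    obtain ⟨s, -, rfl⟩ := hz
    obtain ⟨t, -, rfl⟩ := hw
    have : (s - t) * (e.2 j - e.1 j) = 0 := by
      simp only [PiLp.add_apply, PiLp.smul_apply, PiLp.sub_apply, smul_eq_mul] at h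
      linarith
    rcases mul_eq_zero.1 this with h | h
    · rw [sub_eq_zero.1 h]
    · exact absurd (sub_eq_zero.1 h).symm he

namespace Box

variable {S : Finset Plane}

/-- As coordinates of input points are distinct, an edge is a loop or not parallel to the line, so
it crosses it at one place `q e`. -/
lemma exists_crossings {B : Box S} {C : Clustering S} {i j : Fin 2}
    (hS : Set.InjOn (fun p : Plane => p j) (S : Set Plane)) {d : Pos}
    (h : AtMostTwoEdges C (B.slice j d)) : ∃ (T : Finset (Plane × Plane)) (q : Plane × Plane → ℝ),
      T.card ≤ 2 ∧ ∀ e ∈ C.edges, ∀ Q ∈ B.slice j d, Q ∈ edgeTrace e → e ∈ T ∧ (ofLex (Q i)).1 = q e := by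
  have hfin : {e ∈ C.edges | (edgeTrace e ∩ B.slice j d).Nonempty}.Finite :=
    C.finite_edges.subset fun _ he => he.1
  have hq : ∀ e, ∃ q, ∀ Q ∈ B.slice j d, e ∈ C.edges → Q ∈ edgeTrace e → (ofLex (Q i)).1 = q := by
    intro e
    by_cases he : e ∈ C.edges ∧ ∃ Q ∈ B.slice j d, Q ∈ edgeTrace e
    · obtain ⟨he, Q, hQ, z, hz, w, hw, hzw⟩ := he
      refine ⟨z i, ?_⟩
      rintro Q' hQ' - ⟨z', hz', w', hw', hzw'⟩
      rw [(hzw' i).1, eq_of_mem_segment_of_apply_eq hS (Clustering.mem_of_mem_edges he).1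
        (Clustering.mem_of_mem_edges he).2 hz' hz]
      rw [← (hzw j).1, ← (hzw' j).1, hQ.2, hQ'.2]
    · exact ⟨0, fun Q hQ heC hQe => absurd ⟨heC, Q, hQ, hQe⟩ he⟩
  choose q hq using hq
  refine ⟨hfin.toFinset, q, ?_, fun e he Q hQ hQe =>
    ⟨hfin.mem_toFinset.2 ⟨he, Q, hQe, hQ⟩, hq e Q hQ he hQe⟩⟩
  have h2 := h
  unfold AtMostTwoEdges at h2
  rw [← hfin.coe_toFinset, Set.encard_coe_eq_coe_finsetCard] at h2
  exact_mod_cast h2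

/-- Neighbouring grid lines around `x` are at most 200w/20000 = w/100 apart. One of them separates
the box, or else the whole side w would fit between them. -/
lemma exists_separator_near {B : Box S} {i : Fin 2}
    (hgaps : ∀ a b, IsGap S i a b → a < B.right i → B.left i < b →
      b - a ≤ 200 * (B.right i - B.left i)) {x : ℝ} (hx : ∀ r ∈ S, r i ≠ x) (hl : B.left i < x)
    (hr : x < B.right i) : ∃ a b c, IsGap S i a b ∧ a < x ∧ x < b ∧ c ∈ gridLines S i ∧
      B.IsSeparator i c ∧ toLex (a, 1) ≤ c ∧ c ≤ toLex (b, -1) ∧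
      |(ofLex c).1 - x| ≤ (B.right i - B.left i) / 100 := by
  obtain ⟨p, hp, hpx⟩ := exists_le_of_mem_gridLines (B.lo_mem i)
  obtain ⟨q, hq, hqx⟩ := exists_ge_of_mem_gridLines (B.hi_mem i)
  obtain ⟨a, b, ha, hb, hab, hax, hxb⟩ := exists_consecutive (S := S) (i := i) (x := x) (y := x)
    ⟨p, hp, hpx.trans hl.le⟩ ⟨q, hq, hr.le.trans hqx⟩ fun r _ => le_total _ _
  have hax : a < x := by
    obtain ⟨p, hp, rfl⟩ := ha
    exact lt_of_le_of_ne hax (hx p hp)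
  have hxb : x < b := by
    obtain ⟨p, hp, rfl⟩ := hb
    exact lt_of_le_of_ne hxb (hx p hp).symm
  have hg : IsGap S i a b := ⟨hax.trans hxb, ha, hb, hab⟩
  have hlen := hgaps a b hg (hax.trans hr) (hl.trans hxb)
  obtain ⟨L, hL, U, hU, haL, hUb, hLx, hxU, hUL, hLb, haU⟩ := hg.exists_gridLines hax.le hxb
  by_cases h1 : B.lo i < L
  · exact ⟨a, b, L, hg, hax, hxb, hL, ⟨h1, pos_lt_iff.2 (Or.inl (hLx.trans_lt hr))⟩, haL, hLb.le,
      abs_le.2 ⟨by linarith, by linarith⟩⟩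
  by_cases h2 : U < B.hi i
  · exact ⟨a, b, U, hg, hax, hxb, hU, ⟨pos_lt_iff.2 (Or.inl (hl.trans hxU)), h2⟩, haU.le, hUb,
      abs_le.2 ⟨by linarith, by linarith⟩⟩
  have h3 := coord_le_of_le (not_lt.1 h1)
  have h4 := coord_le_of_le (not_lt.1 h2)
  unfold left right at *
  linarith

lemma AllBad.three_mul_le {B : Box S} {C : Clustering S} {i j : Fin 2} (hij : i ≠ j)
    (hS : Set.InjOn (fun p : Plane => p j) (S : Set Plane)) (hB : B.Invariant C)
    (h : B.AllBad C i) (hw : B.left i < B.right i)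
    (hgaps : ∀ a b, IsGap S i a b → a < B.right i → B.left i < b →
      b - a ≤ 200 * (B.right i - B.left i))
    {E : Finset (Plane × Plane)} {s t : Plane × Plane → Plane}
    (hE : ∀ e ∈ C.edges, ∀ y ∈ segment ℝ e.1 e.2, y ∈ B.actual → e ∈ E ∧ y ∈ segment ℝ (s e) (t e)) :
    3 * (B.right i - B.left i) ≤
      ∑ e ∈ E, |s e i - t e i| + 8 * ((B.right i - B.left i) / 100) := by
  set δ := (B.right i - B.left i) / 100 with hδ
  have hδ0 : 0 ≤ δ := by linarith
  obtain ⟨T, q, hT, hTq⟩ := exists_crossings (i := i) hS (hB j).2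
  obtain ⟨T', q', hT', hTq'⟩ := exists_crossings (i := i) hS (hB j).1
  -- Index 0 is the chord inside the box; indices 1 and 2 are windows of radius δ around the exits
  -- through the upper and lower side. Each edge found at a separator near `x` is at position `x`
  -- still in the box, or has left it within δ of `x`. At most four windows of length 2δ give the
  -- term 8δ.
  have key := three_mul_length_le_sum_length ![E, T, T']
    ![fun e => min (s e i) (t e i), fun e => q e - δ, fun e => q' e - δ]
    ![fun e => max (s e i) (t e i), fun e => q e + δ, fun e => q' e + δ]
    (by
      intro m
      fin_cases m
      · exact fun e _ => min_le_max
      · intro e _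
        change q e - δ ≤ q e + δ
        linarith
      · intro e _
        change q' e - δ ≤ q' e + δ
        linarith) hw.le (N := (S.image fun r => r i : Finset ℝ)) (finite_toSet _) (by
      intro x hx hl hr
      obtain ⟨a, b, c, hg, hax, hxb, hc, hs, hac, hcb, hcx⟩ := exists_separator_near hgaps
        (fun r hr h => hx (mem_coe.2 (mem_image.2 ⟨r, hr, h⟩))) hl hr
      obtain ⟨e, he, heC, hsp, hP⟩ := h.exists_edges hc hs hg hac hcb
      refine ⟨e, he, fun n => ?_⟩
      obtain ⟨P, hP, hPe⟩ := hP n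
      obtain ⟨y, hy, hyx⟩ : ∃ y ∈ segment ℝ (e n).1 (e n).2, y i = x := by
        obtain ⟨θ, hθ⟩ := exists_angle i
        simp only [← hθ]
        rcases hsp n with h | h
        · exact exists_mem_segment_eq (proj θ) (by rw [hθ]; linarith) (by rw [hθ]; linarith)
        · rw [segment_symm]
          exact exists_mem_segment_eq (proj θ) (by rw [hθ]; linarith) (by rw [hθ]; linarith)
      have hPl := coord_le_of_le (hP.1.1 j)
      have hPu := coord_le_of_le (hP.1.2 j)
      have hPi : |(ofLex (P i)).1 - y i| ≤ δ := by rwa [hP.2, hyx]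
      have hlo := (B.lo_lt_hi j).le
      by_cases h1 : B.right j < y j
      · obtain ⟨Q, hQ, hQe, hQy⟩ := exists_mem_slice_of_exit hij hP.1 hPe hy (hyx ▸ hl) (hyx ▸ hr)
          hlo le_rfl h1.ne' (mul_nonpos_of_nonpos_of_nonneg (by linarith) (by
            unfold right at h1; linarith)) (by
            intro h2 h3
            unfold right at h1
            rw [sign_pos (by linarith)] at h3
            refine le_antisymm (hP.1.2 j) (pos_le_iff.2 (Or.inr ⟨h2.symm, ?_⟩))
            rw [h3]
            exact SignType.neg_one_le _)
        obtain ⟨h2, h3⟩ := hTq (e n) (heC n) Q hQ hQe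
        have h4 := abs_le.1 (hQy.trans hPi)
        rw [h3, hyx] at h4
        refine ⟨1, h2, ?_, ?_⟩
        · change q (e n) - δ ≤ x
          linarith
        · change x ≤ q (e n) + δ
          linarith
      by_cases h1' : y j < B.left j
      · obtain ⟨Q, hQ, hQe, hQy⟩ := exists_mem_slice_of_exit hij hP.1 hPe hy (hyx ▸ hl) (hyx ▸ hr)
          le_rfl hlo h1'.ne (mul_nonpos_of_nonneg_of_nonpos (by linarith) (by
            unfold left at h1'; linarith)) (by
            intro h2 h3
            unfold left at h1'
            rw [sign_neg (by linarith), neg_neg] at h3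
            refine le_antisymm (pos_le_iff.2 (Or.inr ⟨h2, ?_⟩)) (hP.1.1 j)
            rw [h3]
            exact SignType.le_one _)
        obtain ⟨h2, h3⟩ := hTq' (e n) (heC n) Q hQ hQe
        have h4 := abs_le.1 (hQy.trans hPi)
        rw [h3, hyx] at h4
        refine ⟨2, h2, ?_, ?_⟩
        · change q' (e n) - δ ≤ x
          linarith
        · change x ≤ q' (e n) + δ
          linarith
      have hyB : y ∈ B.actual := fun m => by
        by_cases hm : m = j
        · subst hm
          exact ⟨not_lt.1 h1', not_lt.1 h1⟩
        · obtain rfl : m = i := by omega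
          rw [hyx]
          exact ⟨hl.le, hr.le⟩
      obtain ⟨h2, h3⟩ := hE (e n) (heC n) y hy hyB
      refine ⟨0, h2, ?_⟩
      change min _ _ ≤ x ∧ x ≤ max _ _
      rw [min_le_iff, le_max_iff, ← hyx]
      rcases coord_mem_Icc (e := (s (e n), t (e n))) h3 i with h | h
      · exact ⟨Or.inl h.1, Or.inr h.2⟩
      · exact ⟨Or.inr h.1, Or.inl h.2⟩)
  rw [Fin.sum_univ_three] at key
  have e1 : ∑ e ∈ E, (max (s e i) (t e i) - min (s e i) (t e i)) = ∑ e ∈ E, |s e i - t e i| :=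
    sum_congr rfl fun e _ => by rw [max_sub_min_eq_abs, abs_sub_comm]
  have e2 : ∀ (X : Finset (Plane × Plane)) (p : Plane × Plane → ℝ), X.card ≤ 2 →
      ∑ e ∈ X, (p e + δ - (p e - δ)) ≤ 4 * δ := fun X p hX => by
    have : ∀ e ∈ X, p e + δ - (p e - δ) = 2 * δ := fun e _ => by ring
    rw [sum_congr rfl this, sum_const, nsmul_eq_mul]
    have : (X.card : ℝ) ≤ 2 := by exact_mod_cast hX
    nlinarith
  have e3 := e2 T q hT
  have e4 := e2 T' q' hT'
  simp only [Matrix.cons_val_zero, Matrix.cons_val_one, Matrix.cons_val] at key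
  rw [e1] at key
  linarith

/-- The constant 71/50 is slightly above √2. -/
lemma abs_add_abs_le_dist (z w : Plane) : |z 0 - w 0| + |z 1 - w 1| ≤ 71 / 50 * dist z w := by
  have h := norm_sq_plane (z - w)
  rw [← dist_eq_norm] at h
  refine abs_le_of_sq_le_sq' ?_ (by positivity) |>.2
  simp only [PiLp.sub_apply] at h
  have h0 := sq_abs (z 0 - w 0)
  have h1 := sq_abs (z 1 - w 1)
  nlinarith [sq_nonneg (|z 0 - w 0| - |z 1 - w 1|), sq_nonneg (dist z w)]

lemma not_allBad {B : Box S} {C : Clustering S} {k : ℕ} (hC : C.IsOptimal k)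
    (hS : ∀ i : Fin 2, Set.InjOn (fun p : Plane => p i) (S : Set Plane))
    (hne : ¬ B.IsElementary) (hB : B.Invariant C) : ¬ ∀ i, B.AllBad C i := by
  intro hbad
  -- If no grid line separates in direction `i`, a slice by a separator in the other direction is
  -- thin in both directions, hence good.
  have hsep : ∀ i, ∃ c ∈ gridLines S i, B.IsSeparator i c := by
    by_contra! h
    obtain ⟨i, hi⟩ := h
    simp only [IsElementary] at hne
    push Not at hne
    obtain ⟨j, c, hc, hs⟩ := hne
    have hij : i ≠ j := fun h => hi c (h ▸ hc) (h ▸ hs)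
    refine hbad j c hc hs (hC.atMostTwoEdges_of_thin (hS 0) fun m => ?_)
    by_cases hm : m = j
    · subst hm
      exact B.thin_slice m c
    · obtain rfl : m = i := by omega
      exact (B.thin_region hi).mono (B.slice_subset_region j c)
  choose c hc hs using hsep
  have hw : ∀ i, B.left i < B.right i := fun i => left_lt_right (hc i) (hs i)
  have hch : ∀ e : Plane × Plane, ∃ s t, (∃ y ∈ segment ℝ e.1 e.2, y ∈ B.actual) →
      (s ∈ segment ℝ e.1 e.2 ∧ s ∈ B.actual) ∧ (t ∈ segment ℝ e.1 e.2 ∧ t ∈ B.actual) ∧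
      ∀ y ∈ segment ℝ e.1 e.2, y ∈ B.actual → y ∈ segment ℝ s t := fun e => by
    by_cases he : ∃ y ∈ segment ℝ e.1 e.2, y ∈ B.actual
    · obtain ⟨s, t, h⟩ := exists_chord B.isClosed_actual he
      exact ⟨s, t, fun _ => h⟩
    · exact ⟨0, 0, fun h => absurd h he⟩
  choose s t hst using hch
  have hfin : {e ∈ C.edges | ∃ y ∈ segment ℝ e.1 e.2, y ∈ B.actual}.Finite :=
    C.finite_edges.subset fun _ he => he.1
  set E := hfin.toFinset with hEdef
  have hE : ∀ e ∈ E, e ∈ C.edges ∧ ∃ y ∈ segment ℝ e.1 e.2, y ∈ B.actual :=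
    fun e he => hfin.mem_toFinset.1 he
  have hE' : ∀ e ∈ C.edges, ∀ y ∈ segment ℝ e.1 e.2, y ∈ B.actual →
      e ∈ E ∧ y ∈ segment ℝ (s e) (t e) := fun e he y hy hyB =>
    ⟨hfin.mem_toFinset.2 ⟨he, y, hy, hyB⟩, (hst e ⟨y, hy, hyB⟩).2.2 y hy hyB⟩
  have hlin := hC.sum_dist_le (E := E) (fun e he => (hE e he).1) (s := s) (t := t)
    (fun e he => (hst e (hE e he).2).1.1) (fun e he => (hst e (hE e he).2).2.1.1)
    (l := B.left) (u := B.right) (fun i => (hw i).le)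
    (fun e he => (hst e (hE e he).2).1.2) (fun e he => (hst e (hE e he).2).2.1.2)
  have hdich : ∀ i j, i ≠ j → 8 * (B.right i - B.left i) ≤ B.right j - B.left j ∨
      3 * (B.right i - B.left i) ≤
        ∑ e ∈ E, |s e i - t e i| + 8 * ((B.right i - B.left i) / 100) := by
    intro i j hij
    by_cases hgaps : ∀ a b, IsGap S i a b → a < B.right i → B.left i < b →
      b - a ≤ 200 * (B.right i - B.left i)
    · exact Or.inr ((hbad i).three_mul_le hij (hS j) hB (hw i) hgaps hE')
    · push Not at hgaps
      obtain ⟨a, b, hg, ha, hb, hab⟩ := hgaps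
      exact Or.inl ((hbad i).eight_mul_le hC (hS 0) hij (hc i) (hs i) hg ha hb hab)
  have hle : ∀ i, ∑ e ∈ E, |s e i - t e i| ≤ ∑ e ∈ E, dist (s e) (t e) := fun i =>
    sum_le_sum fun e _ => by
      simpa [dist_eq_norm] using abs_apply_le_norm (s e - t e) i
  have hle2 : ∑ e ∈ E, |s e 0 - t e 0| + ∑ e ∈ E, |s e 1 - t e 1| ≤
      71 / 50 * ∑ e ∈ E, dist (s e) (t e) := by
    rw [← sum_add_distrib, mul_sum]
    exact sum_le_sum fun e _ => abs_add_abs_le_dist _ _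
  have h0 := hw 0
  have h1 := hw 1
  -- Two long gaps would make each side at least 8 times the other. With 8w ≤ h and the covering
  -- bound for h, one gets 2.92h ≤ 2(w + h) ≤ 2.25h. Two covering bounds give 2.92(w + h) ≤ 2.84(w +
  -- h).
  rcases hdich 0 1 (by decide) with h | h <;> rcases hdich 1 0 (by decide) with h' | h'
  · linarith
  · linarith [hle 1]
  · linarith [hle 0]
  · linarith

end Box

end

theorem mainTheorem4 (S : Finset Plane)
    (hS : ∀ i : Fin 2, Set.InjOn (fun p : Plane => p i) (S : Set Plane))
    (k : ℕ) (C : Clustering S) (hC : C.IsOptimal k) (B : Box S) :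
    (B.IsElementary → AtMostTwoEdges C B.region ∧ B.Invariant C) ∧
    (¬ B.IsElementary → B.Invariant C →
      ∃ (i : Fin 2) (c : Pos), c ∈ gridLines S i ∧ B.IsSeparator i c ∧
        AtMostTwoEdges C (B.slice i c) ∧
        ∃ Bl Br : Box S, B.Divides i c Bl Br ∧
          Bl.region ⊂ B.region ∧ Br.region ⊂ B.region ∧
          Bl.Invariant C ∧ Br.Invariant C) := by
  refine ⟨fun hel => ?_, fun hne hB => ?_⟩
  · have h : AtMostTwoEdges C B.region :=
      hC.atMostTwoEdges_of_thin (hS 0) fun i => B.thin_region (hel i)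
    exact ⟨h, fun i => ⟨Clustering.atMostTwoEdges_mono h (B.slice_subset_region _ _),
      Clustering.atMostTwoEdges_mono h (B.slice_subset_region _ _)⟩⟩
  · have h := Box.not_allBad hC hS hne hB
    simp only [Box.AllBad] at h
    push Not at h
    obtain ⟨i, c, hc, hs, h2⟩ := h
    exact ⟨i, c, hc, hs, h2, B.exists_divides hc hs hB h2⟩
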